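/- Let $M$ be a smooth manifold (Hausdorff, second countable, without boundary) with a smooth foliation $\mathcal F$ of dimension $p$ and codimension $q$. Write $\mathcal F_x\subset T_xM$ for the tangent space of the leaf through $x$ and $\Gamma(\mathcal F)$ for the smooth vector fields on $M$ tangent to the leaves. Let $E$ be a foliated vector bundle over $(M,\mathcal F)$, i.e. a smooth real vector bundle of finite rank with a bilinear operator $\nabla:\Gamma(\mathcal F)\times\Gamma(E)\to\Gamma(E)$ such that $$\nabla_{fX}s=f\nabla_Xs,\qquad \nabla_X(fs)=f\nabla_Xs+X(f)s,\qquad \nabla_{[X,Y]}=[\nabla_X,\nabla_Y]$$ for all $X,Y\in\Gamma(\mathcal F)$, $f\in C^\infty(M)$, $s\in\Gamma(E)$. Let $\Omega^k(M,\mathcal F;E)=\Gamma(\Lambda^k\mathcal F^*\otimes E)$ be the space of smooth $E$-valued $k$-forms on $\mathcal F$, with the differential $$d\omega(X_1,\dots,X_{k+1})=\sum_{i<j}(-1)^{i+j-1}\omega([X_i,X_j],X_1,\dots,\hat X_i,\dots,\hat X_j,\dots,X_{k+1})+\sum_{i=1}^{k+1}(-1)^i\nabla_{X_i}\bigl(\omega(X_1,\dots,\hat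 X_i,\dots,X_{k+1})\bigr)$$ for $X_1,\dots,X_{k+1}\in\Gamma(\mathcal F)$, let $H^k(\mathcal F;E)$ be its cohomology in degree $k$, and let $H^k_c(\mathcal F;E)$ be the cohomology of the subcomplex of forms with compact support. For the trivial line bundle with $\nabla_Xf=X(f)$ write $H^k(\mathcal F)$ and $H^k_c(\mathcal F)$. Let $\Gamma_\nabla(E)$ be the sheaf on $M$ whose sections over an open set $U$ are the smooth $\nabla$-constant sections of $E|_U$, and let $\Omega^0_{bas}$ be the sheaf of smooth real functions that are locally constant along the leaves. For a sheaf $\mathcal A$ of real vector spaces on $M$, let $H^k(M;\mathcal A)$ and $H^k_c(M;\mathcal A)$ be the $k$-th right derived functors, evaluated at $\mathcal A$, of global sections and of global sections with compact support. Then for every $k\ge 0$ there are isomorphisms of real vector spaces $$H^k(\mathcal F;E)\cong H^k(M;\Gamma_\nabla(E)),\qquad H^k_c(\mathcal F;E)\cong H^k_c(M;\Gamma_\nabla(E)),$$ and in particular $$H^k(\mathcal F)\cong H^k(M;\Omega^0_{bas}),\qquad H^k_c(\mathcal F)\cong H^k_c(M;\Omega^0_{bas}).$$ -/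

import Mathlib

open scoped Manifold ContDiff Topology
open Bundle TopologicalSpace VectorField CategoryTheory Opposite

universe u

noncomputable section VectorFields

variable {E : Type*} [NormedAddCommGroup E] [NormedSpace ℝ E]
  {M : Type*} [TopologicalSpace M] [ChartedSpace E M]
  {G : Type*} [NormedAddCommGroup G] [NormedSpace ℝ G]

/-- The derivative `X(f)` of a vector-valued function `f` along a vector field `X`. -/
def dirDeriv (X : ∀ x : M, TangentSpace 𝓘(ℝ, E) x) (f : M → G) : M → G :=
  fun y => mfderiv 𝓘(ℝ, E) 𝓘(ℝ, G) f y (X y)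

/-- The vector field `X` read in the chart at `x`. -/
def chartField (x : M) (X : ∀ x : M, TangentSpace 𝓘(ℝ, E) x) : E → E :=
  fun z => mpullbackWithin 𝓘(ℝ, E) 𝓘(ℝ, E) (extChartAt 𝓘(ℝ, E) x).symm X Set.univ z

variable [IsManifold 𝓘(ℝ, E) ∞ M]

theorem fderiv_chartField (x : M) {g : M → G} (X : ∀ x : M, TangentSpace 𝓘(ℝ, E) x) {z : E}
    (hz : z ∈ (extChartAt 𝓘(ℝ, E) x).target)
    (hg : MDifferentiableAt 𝓘(ℝ, E) 𝓘(ℝ, G) g ((extChartAt 𝓘(ℝ, E) x).symm z)) :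
    fderiv ℝ (g ∘ (extChartAt 𝓘(ℝ, E) x).symm) z (chartField x X z) =
    dirDeriv X g ((extChartAt 𝓘(ℝ, E) x).symm z) := by
  have hinv := isInvertible_mfderivWithin_extChartAt_symm (I := 𝓘(ℝ, E)) hz
  have hd := mdifferentiableWithinAt_extChartAt_symm (I := 𝓘(ℝ, E)) hz
  simp only [modelWithCornersSelf_coe, Set.range_id, mfderivWithin_univ,
    mdifferentiableWithinAt_univ] at hinv hd
  rw [← mfderiv_eq_fderiv, mfderiv_comp z hg hd]
  have hX : (mfderiv 𝓘(ℝ, E) 𝓘(ℝ, E) (extChartAt 𝓘(ℝ, E) x).symm z : E →L[ℝ] E)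
      (chartField (E := E) x X z) = (X ((extChartAt 𝓘(ℝ, E) x).symm z) : E) := by
    have h : chartField x X z = (mfderiv 𝓘(ℝ, E) 𝓘(ℝ, E) (extChartAt 𝓘(ℝ, E) x).symm z).inverse
        (X ((extChartAt 𝓘(ℝ, E) x).symm z)) := by
      unfold chartField
      rw [mpullbackWithin_apply, mfderivWithin_univ]
    rw [h]
    obtain ⟨A, hA⟩ := hinv
    rw [← hA, ContinuousLinearMap.inverse_equiv]
    exact A.apply_symm_apply _
  exact congrArg (mfderiv 𝓘(ℝ, E) 𝓘(ℝ, G) g ((extChartAt 𝓘(ℝ, E) x).symm z)) hX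

theorem dirDeriv_mlieBracket_eq_fderiv (x : M) {f : M → G} (X Y : ∀ x : M, TangentSpace 𝓘(ℝ, E) x)
    (hf : MDifferentiableAt 𝓘(ℝ, E) 𝓘(ℝ, G) f x) :
    dirDeriv (mlieBracket 𝓘(ℝ, E) X Y) f x =
      fderiv ℝ (f ∘ (extChartAt 𝓘(ℝ, E) x).symm) (extChartAt 𝓘(ℝ, E) x x)
        (lieBracket ℝ (E := E) (chartField x X) (chartField x Y) (extChartAt 𝓘(ℝ, E) x x)) := by
  have hex := extChartAt_to_inv (I := 𝓘(ℝ, E)) x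
  have hL : (mlieBracket 𝓘(ℝ, E) X Y x : E) =
      (mfderiv 𝓘(ℝ, E) 𝓘(ℝ, E) (extChartAt 𝓘(ℝ, E) x) x).inverse
        (lieBracket ℝ (E := E) (chartField x X) (chartField x Y) (extChartAt 𝓘(ℝ, E) x x)) := by
    have hb := mlieBracketWithin_apply (I := 𝓘(ℝ, E)) (V := X) (W := Y) (s := Set.univ) (x₀ := x)
    simp only [modelWithCornersSelf_coe, Set.range_id, Set.preimage_univ, Set.inter_univ,
      mlieBracketWithin_univ] at hb
    rw [← lieBracketWithin_univ]
    exact hb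
  have hinv : (mfderiv 𝓘(ℝ, E) 𝓘(ℝ, E) (extChartAt 𝓘(ℝ, E) x) x : E →L[ℝ] E)
      (mlieBracket 𝓘(ℝ, E) X Y x : E) =
      lieBracket ℝ (E := E) (chartField x X) (chartField x Y) (extChartAt 𝓘(ℝ, E) x x) := by
    rw [hL]
    obtain ⟨A, hA⟩ := isInvertible_mfderiv_extChartAt (I := 𝓘(ℝ, E)) (x := x)
      (mem_extChartAt_source (I := 𝓘(ℝ, E)) x)
    rw [← hA, ContinuousLinearMap.inverse_equiv]
    exact A.apply_symm_apply _
  have hd := mdifferentiableWithinAt_extChartAt_symm (I := 𝓘(ℝ, E))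
    (mem_extChartAt_target (I := 𝓘(ℝ, E)) x)
  simp only [modelWithCornersSelf_coe, Set.range_id, mdifferentiableWithinAt_univ] at hd
  have hF : MDifferentiableAt 𝓘(ℝ, E) 𝓘(ℝ, G) (f ∘ (extChartAt 𝓘(ℝ, E) x).symm)
      (extChartAt 𝓘(ℝ, E) x x) :=
    MDifferentiableAt.comp _ (I' := 𝓘(ℝ, E)) (by rw [hex]; exact hf) hd
  have hcomp : mfderiv 𝓘(ℝ, E) 𝓘(ℝ, G) f x =
      (mfderiv 𝓘(ℝ, E) 𝓘(ℝ, G) (f ∘ (extChartAt 𝓘(ℝ, E) x).symm) (extChartAt 𝓘(ℝ, E) x x)).comp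
        (mfderiv 𝓘(ℝ, E) 𝓘(ℝ, E) (extChartAt 𝓘(ℝ, E) x) x) := by
    rw [← mfderiv_comp x hF (mdifferentiableAt_extChartAt (mem_chart_source E x))]
    refine Filter.EventuallyEq.mfderiv_eq ?_
    filter_upwards [extChartAt_source_mem_nhds (I := 𝓘(ℝ, E)) x] with y hy
    simp only [Function.comp_apply, (extChartAt 𝓘(ℝ, E) x).left_inv hy]
  rw [← hinv, ← mfderiv_eq_fderiv]
  exact congrArg (fun A : E →L[ℝ] G => A (mlieBracket 𝓘(ℝ, E) X Y x)) hcomp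

/-- `[X, Y](f) = X(Y(f)) - Y(X(f))`. -/
theorem dirDeriv_mlieBracket [FiniteDimensional ℝ E] {f : M → G} {x : M}
    {X Y : ∀ x : M, TangentSpace 𝓘(ℝ, E) x}
    (hX : CMDiff ∞ (T% X)) (hY : CMDiff ∞ (T% Y))
    (hf : ContMDiffAt 𝓘(ℝ, E) 𝓘(ℝ, G) 2 f x) :
    dirDeriv (mlieBracket 𝓘(ℝ, E) X Y) f x =
      dirDeriv X (dirDeriv Y f) x - dirDeriv Y (dirDeriv X f) x := by
  set e := extChartAt 𝓘(ℝ, E) x with he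
  have hxt : e x ∈ e.target := mem_extChartAt_target x
  have hex : e.symm (e x) = x := extChartAt_to_inv x
  have htn : e.target ∈ 𝓝 (e x) := extChartAt_target_mem_nhds x
  set F : E → G := f ∘ e.symm with hF
  have hPd : ∀ Z : (∀ x : M, TangentSpace 𝓘(ℝ, E) x), CMDiff ∞ (T% Z) →
      DifferentiableAt ℝ (chartField x Z) (e x) := by
    intro Z hZ
    have := MDifferentiableWithinAt.differentiableWithinAt_mpullbackWithin_vectorField
      (I := 𝓘(ℝ, E)) (s := Set.univ) (x := x) (V := Z)
      ((hZ.mdifferentiable (by simp)) x).mdifferentiableWithinAt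
    simp only [modelWithCornersSelf_coe, Set.range_id, Set.preimage_univ, Set.inter_univ] at this
    exact differentiableWithinAt_univ.1 this
  have hFd : ContDiffAt ℝ 2 F (e x) := by
    have h := contMDiffAt_iff_contDiffAt.1
      (ContMDiffAt.comp (e x) (I' := 𝓘(ℝ, E)) (by rw [hex]; exact hf)
        (((contMDiffOn_extChartAt_symm (I := 𝓘(ℝ, E)) (n := 2) x).contMDiffAt htn)))
    exact h
  have hmd : ∀ᶠ y in 𝓝 x, MDifferentiableAt 𝓘(ℝ, E) 𝓘(ℝ, G) f y :=
    ((contMDiffAt_iff_contMDiffAt_nhds (by simp)).1 hf).mono fun y hy => hy.mdifferentiableAt (by simp)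
  have hsymm : Filter.Tendsto e.symm (𝓝 (e x)) (𝓝 x) := by
    have := continuousAt_extChartAt_symm (I := 𝓘(ℝ, E)) x
    rw [ContinuousAt, ← he, hex] at this
    exact this
  have hev : ∀ Z : (∀ x : M, TangentSpace 𝓘(ℝ, E) x),
      (dirDeriv Z f ∘ e.symm) =ᶠ[𝓝 (e x)] fun z => fderiv ℝ F z (chartField x Z z) := by
    intro Z
    filter_upwards [htn, hsymm.eventually hmd] with z hz hz'
    exact (fderiv_chartField x Z hz hz').symm
  have hdd : DifferentiableAt ℝ (fderiv ℝ F) (e x) :=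
    (hFd.fderiv_right (m := 1) (by norm_num)).differentiableAt (by simp)
  have hGd : ∀ Z : (∀ x : M, TangentSpace 𝓘(ℝ, E) x), CMDiff ∞ (T% Z) →
      DifferentiableAt ℝ (fun z => fderiv ℝ F z (chartField x Z z)) (e x) := fun Z hZ =>
    hdd.clm_apply (hPd Z hZ)
  have hgd : ∀ Z : (∀ x : M, TangentSpace 𝓘(ℝ, E) x), CMDiff ∞ (T% Z) →
      MDifferentiableAt 𝓘(ℝ, E) 𝓘(ℝ, G) (dirDeriv Z f) x := by
    intro Z hZ
    have h1 : MDifferentiableAt 𝓘(ℝ, E) 𝓘(ℝ, G)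
        ((fun z => fderiv ℝ F z (chartField x Z z)) ∘ e) x :=
      MDifferentiableAt.comp x (hGd Z hZ).mdifferentiableAt
        (mdifferentiableAt_extChartAt (mem_chart_source E x))
    refine h1.congr_of_eventuallyEq ?_
    have hc : Filter.Tendsto e (𝓝 x) (𝓝 (e x)) := continuousAt_extChartAt (I := 𝓘(ℝ, E)) x
    filter_upwards [hc.eventually (hev Z), extChartAt_source_mem_nhds (I := 𝓘(ℝ, E)) x]
      with y hy hy'
    rw [Function.comp_apply, ← hy, Function.comp_apply, e.left_inv hy']
  have key : ∀ Z W : (∀ x : M, TangentSpace 𝓘(ℝ, E) x), CMDiff ∞ (T% Z) → CMDiff ∞ (T% W) →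
      dirDeriv W (dirDeriv Z f) x =
      fderiv ℝ (fderiv ℝ F) (e x) (chartField x W (e x)) (chartField x Z (e x)) +
        fderiv ℝ F (e x) (fderiv ℝ (chartField x Z) (e x) (chartField x W (e x))) := by
    intro Z W hZ hW
    have h := fderiv_chartField x W (g := dirDeriv Z f) hxt (by rw [← he, hex]; exact hgd Z hZ)
    rw [← he, (hev Z).fderiv_eq, hex] at h
    rw [← h, fderiv_clm_apply hdd (hPd Z hZ)]
    simp [add_comm]
  rw [key Y X hY hX, key X Y hX hY]
  have hsym : fderiv ℝ (fderiv ℝ F) (e x) (chartField x X (e x)) (chartField x Y (e x)) =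
      fderiv ℝ (fderiv ℝ F) (e x) (chartField x Y (e x)) (chartField x X (e x)) :=
    (hFd.isSymmSndFDerivAt (by simp)) _ _
  rw [dirDeriv_mlieBracket_eq_fderiv x X Y (hf.mdifferentiableAt (by simp)), ← he, ← hF,
    lieBracket, map_sub, hsym]
  abel

end VectorFields

noncomputable section Foliations

variable {E : Type*} [NormedAddCommGroup E] [NormedSpace ℝ E]
  {M : Type*} [TopologicalSpace M] [ChartedSpace E M]

/-- `φ` is a foliated chart for the family of subspaces `T x` of the tangent spaces of `M`: a smooth
chart with values in `ℝ^p × ℝ^q` such that `T` is tangent to the plaques, i.e. to the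
level sets of the transverse coordinate `y ↦ (φ y).2`. -/
structure IsFoliatedChart {p q : ℕ} (T : ∀ x : M, Submodule ℝ (TangentSpace 𝓘(ℝ, E) x))
    (φ : OpenPartialHomeomorph M (EuclideanSpace ℝ (Fin p) × EuclideanSpace ℝ (Fin q))) : Prop where
  contMDiffOn : ContMDiffOn 𝓘(ℝ, E) 𝓘(ℝ, EuclideanSpace ℝ (Fin p) × EuclideanSpace ℝ (Fin q)) ∞
    φ φ.source
  contMDiffOn_symm : ContMDiffOn 𝓘(ℝ, EuclideanSpace ℝ (Fin p) × EuclideanSpace ℝ (Fin q)) 𝓘(ℝ, E)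
    ∞ φ.symm φ.target
  mem_iff : ∀ x ∈ φ.source, ∀ v : TangentSpace 𝓘(ℝ, E) x, v ∈ T x ↔
    mfderiv 𝓘(ℝ, E) 𝓘(ℝ, EuclideanSpace ℝ (Fin q)) (fun y => (φ y).2) x v = 0

variable (E M) in
/-- A smooth foliation of dimension `p` and codimension `q` of `M`, given by its tangent
spaces: around every point there is a foliated chart. -/
structure Foliation (p q : ℕ) where
  /-- The tangent space at `x` of the leaf through `x`. -/
  tangent : ∀ x : M, Submodule ℝ (TangentSpace 𝓘(ℝ, E) x)
  exists_chart : ∀ x : M,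
    ∃ φ : OpenPartialHomeomorph M (EuclideanSpace ℝ (Fin p) × EuclideanSpace ℝ (Fin q)),
      x ∈ φ.source ∧ IsFoliatedChart tangent φ

variable (E M) in
/-- Smooth vector fields on `M`. -/
abbrev SmoothFields [IsManifold 𝓘(ℝ, E) ∞ M] : Type _ :=
  Cₛ^∞⟮𝓘(ℝ, E); E, (TangentSpace 𝓘(ℝ, E) : M → Type _)⟯

/-- The Lie derivative `L_X f = X(f)` of a smooth function along a smooth vector field. -/
def lieDeriv [IsManifold 𝓘(ℝ, E) ∞ M] (X : SmoothFields E M)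
    (f : C^∞⟮𝓘(ℝ, E), M; ℝ⟯) : C^∞⟮𝓘(ℝ, E), M; ℝ⟯ :=
  ⟨dirDeriv X f, by
    have h1 := (f.contMDiff.contMDiff_tangentMap (m := ∞) (by simp)).comp X.contMDiff
    exact (contMDiff_snd_tangentBundle_modelSpace ℝ 𝓘(ℝ, ℝ)).comp h1⟩

/-- The product `f • s` of a smooth function and a smooth section. -/
def funSMul {W : Type*} [NormedAddCommGroup W] [NormedSpace ℝ W] {V : M → Type*}
    [TopologicalSpace (TotalSpace W V)] [∀ x, TopologicalSpace (V x)] [FiberBundle W V]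
    [∀ x, AddCommGroup (V x)] [∀ x, Module ℝ (V x)] [VectorBundle ℝ W V]
    (f : C^∞⟮𝓘(ℝ, E), M; ℝ⟯) (s : Cₛ^∞⟮𝓘(ℝ, E); W, V⟯) : Cₛ^∞⟮𝓘(ℝ, E); W, V⟯ :=
  ⟨fun x => f x • s x, f.contMDiff.smul_section s.contMDiff⟩

namespace Foliation

variable [IsManifold 𝓘(ℝ, E) ∞ M] {p q : ℕ} (F : Foliation E M p q)

/-- `Γ(F)`: the smooth vector fields on `M` tangent to the leaves. -/
def fields : Submodule ℝ (SmoothFields E M) where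
  carrier := {X | ∀ x, X x ∈ F.tangent x}
  zero_mem' x := (F.tangent x).zero_mem
  add_mem' hX hY x := (F.tangent x).add_mem (hX x) (hY x)
  smul_mem' c _ hX x := (F.tangent x).smul_mem c (hX x)

variable {F}

/-- The product `f X ∈ Γ(F)` of a smooth function `f` and `X ∈ Γ(F)`. -/
def fieldSMul (f : C^∞⟮𝓘(ℝ, E), M; ℝ⟯) (X : F.fields) : F.fields :=
  ⟨funSMul f X.1, fun x => (F.tangent x).smul_mem (f x) (X.2 x)⟩

variable [FiniteDimensional ℝ E]

theorem contMDiff_bracket (X Y : SmoothFields E M) :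
    CMDiff ∞ (T% (mlieBracket 𝓘(ℝ, E) X Y)) := by
  have : IsManifold 𝓘(ℝ, E) (minSmoothness ℝ 2) M := by
    rw [minSmoothness_of_isRCLikeNormedField]; infer_instance
  have : IsManifold 𝓘(ℝ, E) (((⊤ : ℕ∞) : ℕ∞ω) + 1) M := ‹IsManifold 𝓘(ℝ, E) ∞ M›
  exact fun x => ContMDiffAt.mlieBracket_vectorField (n := ⊤) (m := ⊤) (X.contMDiff x)
    (Y.contMDiff x) (by simp)

theorem bracket_mem (X Y : F.fields) (x : M) :
    mlieBracket 𝓘(ℝ, E) X.1 Y.1 x ∈ F.tangent x := by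
  obtain ⟨φ, hx, hφ⟩ := F.exists_chart x
  have hf : ContMDiffAt 𝓘(ℝ, E) 𝓘(ℝ, EuclideanSpace ℝ (Fin q)) ∞ (fun y => (φ y).2) x :=
    contDiff_snd.contMDiff.contMDiffAt.comp x
      (hφ.contMDiffOn.contMDiffAt (φ.open_source.mem_nhds hx))
  have hz : ∀ Z : F.fields, dirDeriv Z.1 (fun y => (φ y).2) =ᶠ[𝓝 x] fun _ => 0 := fun Z => by
    filter_upwards [φ.open_source.mem_nhds hx] with y hy
    exact (hφ.mem_iff y hy _).1 (Z.2 y)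
  have h0 : ∀ Z Z' : F.fields, dirDeriv Z'.1 (dirDeriv Z.1 (fun y => (φ y).2)) x = 0 := by
    intro Z Z'
    have h := (hz Z).mfderiv_eq (I := 𝓘(ℝ, E)) (I' := 𝓘(ℝ, EuclideanSpace ℝ (Fin q)))
    rw [mfderiv_const] at h
    exact congrArg (fun A : E →L[ℝ] EuclideanSpace ℝ (Fin q) => A (Z'.1 x)) h
  have h := dirDeriv_mlieBracket X.1.contMDiff Y.1.contMDiff (hf.of_le (ENat.LEInfty.out))
  rw [h0, h0, sub_zero] at h
  exact (hφ.mem_iff x hx _).2 h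

/-- The Lie bracket `[X, Y] ∈ Γ(F)` of `X, Y ∈ Γ(F)`. -/
def bracket (X Y : F.fields) : F.fields :=
  ⟨⟨mlieBracket 𝓘(ℝ, E) X.1 Y.1, contMDiff_bracket X.1 Y.1⟩, bracket_mem X Y⟩

end Foliation

/-- A flat `F`-connection on the smooth vector bundle `V` over `M`. A foliated vector
bundle over `(M, F)` is a smooth vector bundle with a flat `F`-connection. -/
structure FlatConnection [IsManifold 𝓘(ℝ, E) ∞ M] [FiniteDimensional ℝ E] {p q : ℕ}
    (F : Foliation E M p q) (W : Type*) [NormedAddCommGroup W] [NormedSpace ℝ W] (V : M → Type*)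
    [TopologicalSpace (TotalSpace W V)] [∀ x, TopologicalSpace (V x)] [FiberBundle W V]
    [∀ x, AddCommGroup (V x)] [∀ x, Module ℝ (V x)] [VectorBundle ℝ W V] where
  /-- The operator `∇ : Γ(F) × Γ(V) → Γ(V)`. -/
  nabla : F.fields →ₗ[ℝ] Cₛ^∞⟮𝓘(ℝ, E); W, V⟯ →ₗ[ℝ] Cₛ^∞⟮𝓘(ℝ, E); W, V⟯
  nabla_funSMul_left : ∀ (f : C^∞⟮𝓘(ℝ, E), M; ℝ⟯) (X : F.fields) (s : Cₛ^∞⟮𝓘(ℝ, E); W, V⟯),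
    nabla (Foliation.fieldSMul f X) s = funSMul f (nabla X s)
  nabla_funSMul_right : ∀ (f : C^∞⟮𝓘(ℝ, E), M; ℝ⟯) (X : F.fields) (s : Cₛ^∞⟮𝓘(ℝ, E); W, V⟯),
    nabla X (funSMul f s) = funSMul f (nabla X s) + funSMul (lieDeriv X.1 f) s
  flat : ∀ (X Y : F.fields) (s : Cₛ^∞⟮𝓘(ℝ, E); W, V⟯),
    nabla (Foliation.bracket X Y) s = nabla X (nabla Y s) - nabla Y (nabla X s)

section TrivialBundle

theorem mdifferentiableAt_smooth (f : C^∞⟮𝓘(ℝ, E), M; ℝ⟯) (x : M) :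
    MDifferentiableAt 𝓘(ℝ, E) 𝓘(ℝ, ℝ) f x :=
  (f.contMDiff x).mdifferentiableAt (by simp)

variable [IsManifold 𝓘(ℝ, E) ∞ M]

theorem lieDeriv_add (X : SmoothFields E M) (f g : C^∞⟮𝓘(ℝ, E), M; ℝ⟯) :
    lieDeriv X (f + g) = lieDeriv X f + lieDeriv X g := by
  ext x
  have h := mfderiv_add (mdifferentiableAt_smooth f x) (mdifferentiableAt_smooth g x)
  exact congrArg (fun A : E →L[ℝ] ℝ => A (X x)) h

theorem lieDeriv_smul (X : SmoothFields E M) (c : ℝ) (f : C^∞⟮𝓘(ℝ, E), M; ℝ⟯) :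
    lieDeriv X (c • f) = c • lieDeriv X f := by
  ext x
  have h := const_smul_mfderiv (mdifferentiableAt_smooth f x) c
  exact congrArg (fun A : E →L[ℝ] ℝ => A (X x)) h

theorem lieDeriv_mul (X : SmoothFields E M) (f g : C^∞⟮𝓘(ℝ, E), M; ℝ⟯) :
    lieDeriv X (f * g) = f * lieDeriv X g + lieDeriv X f * g := by
  ext x
  have h := ((mdifferentiableAt_smooth f x).hasMFDerivAt.mul
    (mdifferentiableAt_smooth g x).hasMFDerivAt).mfderiv
  refine (congrArg (fun A : E →L[ℝ] ℝ => A (X x)) h).trans ?_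
  change f x * lieDeriv X g x + g x * lieDeriv X f x = f x * lieDeriv X g x + lieDeriv X f x * g x
  rw [mul_comm (g x)]

/-- A smooth section of the trivial line bundle is a smooth function. -/
def trivialSectionEquiv :
    Cₛ^∞⟮𝓘(ℝ, E); ℝ, Bundle.Trivial M ℝ⟯ ≃ C^∞⟮𝓘(ℝ, E), M; ℝ⟯ where
  toFun s := ⟨fun x => s x, fun x => (Bundle.contMDiffAt_section x).1 (s.contMDiff x)⟩
  invFun f := ⟨fun x => f x, fun x => (Bundle.contMDiffAt_section x).2 (f.contMDiff x)⟩
  left_inv _ := rfl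
  right_inv _ := rfl

variable [FiniteDimensional ℝ E]

/-- The trivial line bundle `M × ℝ` as a foliated vector bundle, with `∇_X f = L_X f`. -/
def trivialConnection {p q : ℕ} (F : Foliation E M p q) :
    FlatConnection F ℝ (Bundle.Trivial M ℝ) where
  nabla := LinearMap.mk₂ ℝ
    (fun X s => trivialSectionEquiv.symm (lieDeriv X.1 (trivialSectionEquiv s)))
    (fun X Y s => by
      ext x
      exact (mfderiv 𝓘(ℝ, E) 𝓘(ℝ, ℝ) (trivialSectionEquiv s) x).map_add (X.1 x) (Y.1 x))
    (fun c X s => by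
      ext x
      exact (mfderiv 𝓘(ℝ, E) 𝓘(ℝ, ℝ) (trivialSectionEquiv s) x).map_smul c (X.1 x))
    (fun X s t => congrArg trivialSectionEquiv.symm
      (lieDeriv_add X.1 (trivialSectionEquiv s) (trivialSectionEquiv t)))
    (fun c X s => congrArg trivialSectionEquiv.symm (lieDeriv_smul X.1 c (trivialSectionEquiv s)))
  nabla_funSMul_left f X s := by
    ext x
    exact (mfderiv 𝓘(ℝ, E) 𝓘(ℝ, ℝ) (trivialSectionEquiv s) x).map_smul (f x) (X.1 x)
  nabla_funSMul_right f X s := congrArg trivialSectionEquiv.symm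
    (lieDeriv_mul X.1 f (trivialSectionEquiv s))
  flat X Y s := by
    ext x
    exact dirDeriv_mlieBracket X.1.contMDiff Y.1.contMDiff
      (((trivialSectionEquiv s).contMDiff x).of_le (ENat.LEInfty.out))

end TrivialBundle

section Cohomology

variable [IsManifold 𝓘(ℝ, E) ∞ M] [FiniteDimensional ℝ E] {p q : ℕ} (F : Foliation E M p q)
  (W : Type*) [NormedAddCommGroup W] [NormedSpace ℝ W] (V : M → Type*)
  [TopologicalSpace (TotalSpace W V)] [∀ x, TopologicalSpace (V x)] [FiberBundle W V]
  [∀ x, AddCommGroup (V x)] [∀ x, Module ℝ (V x)] [VectorBundle ℝ W V]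

/-- `Ω^k(M, F; V)`: the `V`-valued `k`-forms on `F`, i.e. the smooth families of
alternating `k`-forms on the spaces `F_x` with values in `V_x`. Such a family is smooth if its
values on smooth vector fields tangent to `F` are smooth sections of `V`. -/
def foliatedForms (k : ℕ) : Submodule ℝ (∀ x, F.tangent x [⋀^Fin k]→ₗ[ℝ] V x) where
  carrier := {α | ∀ X : Fin k → F.fields, ContMDiff 𝓘(ℝ, E) (𝓘(ℝ, E).prod 𝓘(ℝ, W)) ∞
    (fun x => TotalSpace.mk' W x (α x (fun i => ⟨(X i).1 x, (X i).2 x⟩)))}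
  zero_mem' _ := (0 : Cₛ^∞⟮𝓘(ℝ, E); W, V⟯).contMDiff
  add_mem' hα hβ X := (hα X).add_section (hβ X)
  smul_mem' _ _ hα X := (hα X).const_smul_section

/-- `Ω^k(M, F; V)`: the vector space of smooth `V`-valued `k`-forms on `F`. -/
def FoliatedForms (k : ℕ) : Type _ := foliatedForms F W V k

instance (k : ℕ) : AddCommGroup (FoliatedForms F W V k) :=
  inferInstanceAs (AddCommGroup (foliatedForms F W V k))

instance (k : ℕ) : Module ℝ (FoliatedForms F W V k) :=
  inferInstanceAs (Module ℝ (foliatedForms F W V k))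

/-- The submodule `Ω_c^k(M, F; V)` of the forms with compact support. -/
def compactForms (k : ℕ) : Submodule ℝ (FoliatedForms F W V k) where
  carrier := {α | ∃ K : Set M, IsCompact K ∧ ∀ x ∉ K, α.1 x = 0}
  zero_mem' := ⟨∅, isCompact_empty, fun _ _ => rfl⟩
  add_mem' := by
    rintro α β ⟨K, hK, hα⟩ ⟨L, hL, hβ⟩
    refine ⟨K ∪ L, hK.union hL, fun x hx => ?_⟩
    have h := not_or.1 hx
    change α.1 x + β.1 x = 0
    rw [hα x h.1, hβ x h.2, add_zero]
  smul_mem' := by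
    rintro c α ⟨K, hK, hα⟩
    refine ⟨K, hK, fun x hx => ?_⟩
    change c • α.1 x = 0
    rw [hα x hx, smul_zero]

variable {F W V}

/-- The section `α(X_1, …, X_k)` of `V`. -/
def evalForm {k : ℕ} (X : Fin k → F.fields) :
    FoliatedForms F W V k →ₗ[ℝ] Cₛ^∞⟮𝓘(ℝ, E); W, V⟯ where
  toFun α := ⟨fun x => α.1 x (fun i => ⟨(X i).1 x, (X i).2 x⟩), α.2 X⟩
  map_add' _ _ := rfl
  map_smul' _ _ := rfl

/-- The Koszul formula for `(dα)(X_1, …, X_{k+1})`,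
`∑_{i<j} (-1)^(i+j-1) α([X_i, X_j], X_1, …, X̂_i, …, X̂_j, …, X_{k+1})
  + ∑_i (-1)^i ∇_{X_i} (α(X_1, …, X̂_i, …, X_{k+1}))`, with the indices shifted to start from `0`.
In the first sum the pair `i < j` is given by `i : Fin (k + 1)` and `j : Fin (k + 2)`. -/
def koszul (D : FlatConnection F W V) : ∀ {k : ℕ}, (Fin (k + 1) → F.fields) →
    (FoliatedForms F W V k →ₗ[ℝ] Cₛ^∞⟮𝓘(ℝ, E); W, V⟯)
  | 0, X => -(D.nabla (X 0) ∘ₗ evalForm ![])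
  | k + 1, X =>
    (∑ i : Fin (k + 1), ∑ j : Fin (k + 2), if i.castSucc < j then
      (-1 : ℝ) ^ ((i : ℕ) + j + 1) •
        evalForm (Fin.cons (Foliation.bracket (X i.castSucc) (X j)) (i.removeNth (j.removeNth X)))
      else 0) +
    ∑ i : Fin (k + 2), (-1 : ℝ) ^ ((i : ℕ) + 1) • (D.nabla (X i) ∘ₗ evalForm (i.removeNth X))

/-- The cocycles of degree `k` among the forms in `A k`: the forms `α` with `dα = 0`. -/
def cocycles (D : FlatConnection F W V) (A : ∀ k, Submodule ℝ (FoliatedForms F W V k)) (k : ℕ) :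
    Submodule ℝ (FoliatedForms F W V k) :=
  A k ⊓ ⨅ X : Fin (k + 1) → F.fields, LinearMap.ker (koszul D X)

/-- The coboundaries of degree `k`: the forms `α = dβ` with `β` in `A (k - 1)`,
and `0` in degree `0`. -/
def coboundaries (D : FlatConnection F W V) (A : ∀ k, Submodule ℝ (FoliatedForms F W V k)) :
    ∀ k : ℕ, Submodule ℝ (FoliatedForms F W V k)
  | 0 => ⊥
  | k + 1 =>
    { carrier := {α | ∃ β ∈ A k, ∀ X : Fin (k + 1) → F.fields, evalForm X α = koszul D X β}
      zero_mem' := ⟨0, (A k).zero_mem, fun _ => by rw [map_zero, map_zero]⟩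
      add_mem' := by
        rintro α α' ⟨β, hβ, h⟩ ⟨β', hβ', h'⟩
        exact ⟨β + β', (A k).add_mem hβ hβ', fun _ => by rw [map_add, map_add, h, h']⟩
      smul_mem' := by
        rintro c _ ⟨β, hβ, h⟩
        exact ⟨c • β, (A k).smul_mem c hβ, fun _ => by rw [map_smul, map_smul, h]⟩ }

/-- Cocycles modulo coboundaries. -/
abbrev cohomologyOf (D : FlatConnection F W V) (A : ∀ k, Submodule ℝ (FoliatedForms F W V k))
    (k : ℕ) : Type _ :=
  cocycles D A k ⧸ (coboundaries D A k).submoduleOf (cocycles D A k)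

/-- The foliated cohomology `H^k(F; V)`. -/
abbrev foliatedCohomology (D : FlatConnection F W V) (k : ℕ) : Type _ :=
  cohomologyOf D (fun _ => ⊤) k

/-- The foliated cohomology with compact supports `H_c^k(F; V)`. -/
abbrev compactFoliatedCohomology (D : FlatConnection F W V) (k : ℕ) : Type _ :=
  cohomologyOf D (compactForms F W V) k

end Cohomology

end Foliations

noncomputable section Sheaves

/-- A local condition on sections `∀ x : U, T x`, over the open sets `U` of `X`, of a family of real
vector spaces `T x`, such that the sections satisfying it form a vector space for every `U`. -/
structure LinearLocalPredicate {X : TopCat.{u}} (T : X → Type u) [∀ x, AddCommGroup (T x)]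
    [∀ x, Module ℝ (T x)] extends TopCat.LocalPredicate T where
  zero_mem : ∀ U : Opens X, pred (fun x : U => (0 : T x))
  add_mem : ∀ (U : Opens X) (s t : ∀ x : U, T x), pred s → pred t → pred (fun x => s x + t x)
  smul_mem : ∀ (U : Opens X) (c : ℝ) (s : ∀ x : U, T x), pred s → pred (fun x => c • s x)

namespace LinearLocalPredicate

variable {X : TopCat.{u}} {T : X → Type u} [∀ x, AddCommGroup (T x)] [∀ x, Module ℝ (T x)]
  (P : LinearLocalPredicate T)

/-- The vector space of sections over `U` that satisfy the condition. -/
def sections (U : Opens X) : Submodule ℝ (∀ x : U, T x) where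
  carrier := {s | P.pred s}
  zero_mem' := P.zero_mem U
  add_mem' := P.add_mem U _ _
  smul_mem' c _ hs := P.smul_mem U c _ hs

/-- The presheaf `U ↦ P.sections U`, with the restriction of sections. -/
def presheaf : TopCat.Presheaf AddCommGrpCat.{u} X where
  obj U := AddCommGrpCat.of (P.sections U.unop)
  map i := AddCommGrpCat.ofHom
    { toFun := fun s => ⟨fun x => s.1 ⟨x.1, i.unop.le x.2⟩, P.res i.unop s.1 s.2⟩
      map_zero' := rfl
      map_add' := fun _ _ => rfl }
  map_id _ := rfl
  map_comp _ _ := rfl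

/-- The sheaf `U ↦ P.sections U`. -/
def sheaf : TopCat.Sheaf AddCommGrpCat.{u} X where
  obj := P.presheaf
  property := by
    rw [CategoryTheory.Presheaf.isSheaf_iff_isSheaf_forget _ _
      (CategoryTheory.forget AddCommGrpCat)]
    exact (TopCat.subsheafToTypes P.toLocalPredicate).property

/-- Multiplication by a real number `c`, as an endomorphism of the sheaf. -/
def scalar (c : ℝ) : P.sheaf ⟶ P.sheaf :=
  CategoryTheory.ObjectProperty.homMk
    { app := fun U => AddCommGrpCat.ofHom
        { toFun := fun s : P.sections U.unop => c • s
          map_zero' := smul_zero c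
          map_add' := smul_add c }
      naturality := fun _ _ _ => rfl }

theorem scalar_one : P.scalar 1 = 𝟙 _ := by
  apply CategoryTheory.ObjectProperty.hom_ext
  ext U s
  exact one_smul ℝ (show P.sections U.unop from s)

theorem scalar_mul (c d : ℝ) : P.scalar (c * d) = P.scalar d ≫ P.scalar c := by
  apply CategoryTheory.ObjectProperty.hom_ext
  ext U s
  exact mul_smul c d (show P.sections U.unop from s)

theorem scalar_add (c d : ℝ) : P.scalar (c + d) = P.scalar c + P.scalar d := by
  apply CategoryTheory.ObjectProperty.hom_ext
  ext U s
  exact add_smul c d (show P.sections U.unop from s)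

/-- The value of a functor `Φ` at the sheaf of sections. If `Φ` is additive it is a real vector
space, with the scalar multiplication induced by that of the sheaf. -/
def Value (Φ : TopCat.Sheaf AddCommGrpCat.{u} X ⥤ AddCommGrpCat.{u}) : Type u := Φ.obj P.sheaf

instance (Φ : TopCat.Sheaf AddCommGrpCat.{u} X ⥤ AddCommGrpCat.{u}) :
    AddCommGroup (P.Value Φ) :=
  inferInstanceAs (AddCommGroup (Φ.obj P.sheaf))

instance (Φ : TopCat.Sheaf AddCommGrpCat.{u} X ⥤ AddCommGrpCat.{u}) [Φ.Additive] :
    Module ℝ (P.Value Φ) where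
  smul c x := (Φ.map (P.scalar c)).hom x
  one_smul x := by
    change (Φ.map (P.scalar 1)).hom x = x
    rw [scalar_one, Φ.map_id]; rfl
  mul_smul c d x := by
    change (Φ.map (P.scalar (c * d))).hom x = (Φ.map (P.scalar c)).hom ((Φ.map (P.scalar d)).hom x)
    rw [scalar_mul, Φ.map_comp]; rfl
  smul_zero c := (Φ.map (P.scalar c)).hom.map_zero
  smul_add c := (Φ.map (P.scalar c)).hom.map_add
  add_smul c d x := by
    change (Φ.map (P.scalar (c + d))).hom x =
      (Φ.map (P.scalar c)).hom x + (Φ.map (P.scalar d)).hom x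
    rw [scalar_add, Φ.map_add]; rfl
  zero_smul x := by
    change (Φ.map (P.scalar 0)).hom x = 0
    have h : P.scalar 0 = 0 := by
      have := P.scalar_add 0 0
      rwa [add_zero, left_eq_add] at this
    rw [h, Φ.map_zero]; rfl

end LinearLocalPredicate

/-- The group of global sections with compact support of a sheaf of abelian groups, i.e. those that
vanish on an open set with compact complement. -/
def compactSectionsSubgroup {X : TopCat.{u}} (A : TopCat.Sheaf AddCommGrpCat.{u} X) :
    AddSubgroup (A.obj.obj (op ⊤)) where
  carrier := {s | ∃ U : Opens X, IsCompact ((U : Set X)ᶜ) ∧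
    (A.obj.map (homOfLE (le_top : U ≤ ⊤)).op).hom s = 0}
  zero_mem' := ⟨⊤, by simp, map_zero _⟩
  neg_mem' := by
    rintro s ⟨U, hU, hs⟩
    exact ⟨U, hU, by rw [map_neg, hs, neg_zero]⟩
  add_mem' := by
    rintro s t ⟨U, hU, hs⟩ ⟨W, hW, ht⟩
    refine ⟨U ⊓ W, ?_, ?_⟩
    · rw [Opens.coe_inf, Set.compl_inter]
      exact hU.union hW
    · have h1 : (homOfLE (le_top : U ⊓ W ≤ ⊤)).op =
          (homOfLE (le_top : U ≤ ⊤)).op ≫ (homOfLE (inf_le_left : U ⊓ W ≤ U)).op := rfl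
      have h2 : (homOfLE (le_top : U ⊓ W ≤ ⊤)).op =
          (homOfLE (le_top : W ≤ ⊤)).op ≫ (homOfLE (inf_le_right : U ⊓ W ≤ W)).op := rfl
      have e1 : (A.obj.map (homOfLE (le_top : U ⊓ W ≤ ⊤)).op).hom s = 0 := by
        rw [h1, A.obj.map_comp, AddCommGrpCat.hom_comp, AddMonoidHom.comp_apply, hs, map_zero]
      have e2 : (A.obj.map (homOfLE (le_top : U ⊓ W ≤ ⊤)).op).hom t = 0 := by
        rw [h2, A.obj.map_comp, AddCommGrpCat.hom_comp, AddMonoidHom.comp_apply, ht, map_zero]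
      rw [map_add, e1, e2, add_zero]

/-- The functor `Γ_c` of global sections with compact support. -/
def compactSections (X : TopCat.{u}) :
    TopCat.Sheaf AddCommGrpCat.{u} X ⥤ AddCommGrpCat.{u} where
  obj A := AddCommGrpCat.of (compactSectionsSubgroup A)
  map {A B} f := AddCommGrpCat.ofHom
    (((f.hom.app (op ⊤)).hom.comp (compactSectionsSubgroup A).subtype).codRestrict
      (compactSectionsSubgroup B) (by
        rintro ⟨s, U, hU, hs⟩
        refine ⟨U, hU, ?_⟩
        have h := congrArg (fun g => g.hom s) (f.hom.naturality (homOfLE (le_top : U ≤ ⊤)).op)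
        simp only [AddCommGrpCat.hom_comp, AddMonoidHom.comp_apply] at h
        rw [hs, map_zero] at h
        exact h.symm))
  map_id _ := rfl
  map_comp _ _ := rfl

instance (X : TopCat.{u}) : (compactSections X).Additive where
  map_add := rfl

/-- Right derived functors are additive. -/
theorem rightDerived_additive {C D : Type*} [Category* C] [Category* D] [Abelian C]
    [HasInjectiveResolutions C] [Abelian D] (Φ : C ⥤ D) [Φ.Additive] (k : ℕ) :
    (Φ.rightDerived k).Additive where
  map_add {A B f g} := by
    have hf := InjectiveResolution.desc_commutes f (injectiveResolution B) (injectiveResolution A)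
    have hg := InjectiveResolution.desc_commutes g (injectiveResolution B) (injectiveResolution A)
    rw [Φ.rightDerived_map_eq k f _ hf, Φ.rightDerived_map_eq k g _ hg,
      Φ.rightDerived_map_eq k (f + g)
        (InjectiveResolution.desc f (injectiveResolution B) (injectiveResolution A) +
          InjectiveResolution.desc g (injectiveResolution B) (injectiveResolution A))
        (by rw [Preadditive.comp_add, hf, hg, Functor.map_add, Preadditive.add_comp]),
      Functor.map_add, Preadditive.add_comp, Preadditive.comp_add]

/-- The functor `H^k(X; -)` of sheaf cohomology. -/
def sheafCohomology (X : TopCat.{u}) (k : ℕ) :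
    TopCat.Sheaf AddCommGrpCat.{u} X ⥤ AddCommGrpCat.{u} :=
  Sheaf.functorH.{u} (Opens.grothendieckTopology X) k

instance (X : TopCat.{u}) (k : ℕ) : (sheafCohomology X k).Additive :=
  inferInstanceAs (Sheaf.functorH.{u} (Opens.grothendieckTopology X) k).Additive

/-- The functor `H_c^k(X; -)` of sheaf cohomology with compact supports: the `k`-th right derived
functor of `Γ_c`. -/
def compactSheafCohomology (X : TopCat.{u}) (k : ℕ) :
    TopCat.Sheaf AddCommGrpCat.{u} X ⥤ AddCommGrpCat.{u} :=
  (compactSections X).rightDerived k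

instance (X : TopCat.{u}) (k : ℕ) : (compactSheafCohomology X k).Additive :=
  rightDerived_additive (compactSections X) k

end Sheaves

noncomputable section FoliationSheaves

variable {E : Type*} [NormedAddCommGroup E] [NormedSpace ℝ E] [FiniteDimensional ℝ E]
  {M : Type u} [TopologicalSpace M] [ChartedSpace E M] [IsManifold 𝓘(ℝ, E) ∞ M] {p q : ℕ}

/-- A property holds near `x` in `U` if and only if it holds near `x` in a larger open set. -/
theorem eventually_nhds_opens {U U' : Opens M} (h : U ≤ U') (x : U) (P : U' → Prop) :
    (∀ᶠ y : U' in 𝓝 ⟨x.1, h x.2⟩, P y) ↔ ∀ᶠ y : U in 𝓝 x, P ⟨y.1, h y.2⟩ := by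
  have e := (Opens.isOpenEmbedding_of_le h).map_nhds_eq x
  change (∀ᶠ y : U' in 𝓝 (Set.inclusion h x), P y) ↔ _
  rw [← e]
  rfl

/-- The sheaf `Γ_∇(V)` of `∇`-constant sections of a foliated vector bundle `V`. A section `s` of
`V` over an open set `U` is in it if for every `x ∈ U` it agrees near `x` with a global smooth
section `t` of `V` such that `(∇_X t)(x) = 0` for all `X ∈ Γ(F)`. (As `∇` is a local operator and
germs of smooth sections and of smooth fields extend to `M`, this says that `s` is smooth and is
constant for the restriction of `∇` to `U`.) -/
def constantSections {F : Foliation E M p q} {W : Type*} [NormedAddCommGroup W] [NormedSpace ℝ W]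
    {V : M → Type u} [TopologicalSpace (TotalSpace W V)] [∀ x, TopologicalSpace (V x)]
    [FiberBundle W V] [∀ x, AddCommGroup (V x)] [∀ x, Module ℝ (V x)] [VectorBundle ℝ W V]
    (D : FlatConnection F W V) : LinearLocalPredicate (X := TopCat.of M) V where
  pred {U} s := ∀ x : U, ∃ t : Cₛ^∞⟮𝓘(ℝ, E); W, V⟯,
    (∀ᶠ y : U in 𝓝 x, t y.1 = s y) ∧ ∀ X : F.fields, D.nabla X t x.1 = 0
  res {U U'} i s hs x := by
    obtain ⟨t, ht, h⟩ := hs ⟨x.1, i.le x.2⟩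
    exact ⟨t, (eventually_nhds_opens (M := M) i.le x (fun y => t y.1 = s y)).1 ht, h⟩
  locality {U} s hs x := by
    obtain ⟨U', hx, i, h⟩ := hs x
    obtain ⟨t, ht, h⟩ := h ⟨x, hx⟩
    exact ⟨t, (eventually_nhds_opens (M := M) i.le ⟨x.1, hx⟩ (fun y => t y.1 = s y)).2 ht, h⟩
  zero_mem U x := ⟨0, Filter.Eventually.of_forall fun _ => rfl, fun X => by rw [map_zero]; rfl⟩
  add_mem U s s' hs hs' x := by
    obtain ⟨t, ht, h⟩ := hs x
    obtain ⟨t', ht', h'⟩ := hs' x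
    refine ⟨t + t', ?_, fun X => ?_⟩
    · filter_upwards [ht, ht'] with y hy hy'
      rw [← hy, ← hy']; rfl
    · rw [map_add]
      change D.nabla X t x.1 + D.nabla X t' x.1 = 0
      rw [h, h', add_zero]
  smul_mem U c s hs x := by
    obtain ⟨t, ht, h⟩ := hs x
    refine ⟨c • t, ?_, fun X => ?_⟩
    · filter_upwards [ht] with y hy
      rw [← hy]; rfl
    · rw [map_smul]
      change c • D.nabla X t x.1 = 0
      rw [h, smul_zero]

/-- The sheaf `Ω^0_bas` of smooth real functions that are locally constant along the leaves: near
every point `x` and in every foliated chart `φ` around `x`, such a function is constant on the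
plaque through `x`. (`ULift ℝ` is a copy of `ℝ` in the universe of `M`.) -/
def basicFunctions (F : Foliation E M p q) :
    LinearLocalPredicate (X := TopCat.of M) (fun _ => ULift.{u} ℝ) where
  pred {U} f := ContMDiff 𝓘(ℝ, E) 𝓘(ℝ, ℝ) ∞ (fun y : U => (f y).down) ∧ ∀ x : U,
    ∀ φ : OpenPartialHomeomorph M (EuclideanSpace ℝ (Fin p) × EuclideanSpace ℝ (Fin q)),
      IsFoliatedChart F.tangent φ → x.1 ∈ φ.source →
        ∀ᶠ y : U in 𝓝 x, (φ y.1).2 = (φ x.1).2 → f y = f x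
  res {U U'} i f hf := by
    refine ⟨hf.1.comp (contMDiff_inclusion i.le), fun x φ hφ hx => ?_⟩
    exact (eventually_nhds_opens (M := M) i.le x
      (fun y => (φ y.1).2 = (φ x.1).2 → f y = f ⟨x.1, i.le x.2⟩)).1
      (hf.2 ⟨x.1, i.le x.2⟩ φ hφ hx)
  locality {U} f hf := by
    refine ⟨fun x => ?_, fun x φ hφ hx => ?_⟩
    · obtain ⟨U', hx', i, h⟩ := hf x
      exact ((contDiffWithinAt_localInvariantProp (I := 𝓘(ℝ, E)) (I' := 𝓘(ℝ, ℝ))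
        ∞).liftPropAt_iff_comp_inclusion i.le (fun y : U => (f y).down) ⟨x.1, hx'⟩).2
        (h.1 ⟨x.1, hx'⟩)
    · obtain ⟨U', hx', i, h⟩ := hf x
      exact (eventually_nhds_opens (M := M) i.le ⟨x.1, hx'⟩
        (fun y => (φ y.1).2 = (φ x.1).2 → f y = f x)).2 (h.2 ⟨x.1, hx'⟩ φ hφ hx)
  zero_mem U := ⟨contMDiff_const, fun _ _ _ _ => Filter.Eventually.of_forall fun _ _ => rfl⟩
  add_mem U f g hf hg := by
    refine ⟨hf.1.add hg.1, fun x φ hφ hx => ?_⟩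
    filter_upwards [hf.2 x φ hφ hx, hg.2 x φ hφ hx] with y hy hy' h
    rw [hy h, hy' h]
  smul_mem U c f hf := by
    refine ⟨?_, fun x φ hφ hx => ?_⟩
    · exact (contDiff_const_smul (𝕜 := ℝ) (F := ℝ) (n := ∞) c).contMDiff.comp hf.1
    · filter_upwards [hf.2 x φ hφ hx] with y hy h
      rw [hy h]

end FoliationSheaves

/-!
The theorem holds because the complex of sheaves of foliated forms is a resolution of the sheaf of
constant sections by soft sheaves.

**Local exactness.** Near every point there are a foliated chart and a frame of the bundle in which
the connection is differentiation along the plaques (`FlatChart.exists_mem_dom`). The frame is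
obtained from an arbitrary one by solving `dS = S A` along the plaques, where `A` is the connection
form, along radial segments; flatness is the integrability condition. The equation on a segment is
solved as a fixed point problem in the Banach space of continuous curves, which gives smooth
dependence on all parameters (`exists_flat_frame`). In such a chart the Koszul formula is, up to
sign, the exterior derivative along the plaques, with the transverse coordinates as parameters
(`FlatChart.frame_koszul`). Hence it defines a differential on forms, and the Poincaré lemma with
parameters (`exists_sliceExtDeriv_eq`) shows that closed forms of positive degree are locally exact
(`FlatConnection.exists_differential_eq`). In degree `0` the closed forms are the constant sections
(`constantSections_pred_iff`), which for the trivial line bundle are the functions that are locally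
constant along the leaves (`basicFunctions_pred_iff`).

**Softness.** Foliated forms can be multiplied by smooth cutoff functions, so that their sheaves are
soft (`SectionSpace.isSoft_germs`). On a locally compact second countable Hausdorff space an
epimorphism with soft kernel is surjective on sections (`IsSoft.secMap_surjective`) and on sections
with compact support (`IsSoft.compactSections_surjective`): local lifts are merged over an
increasing sequence of compact sets, after correction by sections of the kernel. As injective
sheaves are flasque and quotients of soft sheaves by soft sheaves are soft, soft sheaves are adapted
to both functors (`isAdapted_globalSections`, `isAdapted_compactSections`).

**Comparison.** The mapping cone of a map from a soft resolution to an injective one is an exact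
sequence of soft sheaves, and it stays exact under both functors. Hence the soft resolution computes
what the injective one does (`IsAdapted.exists_cls`), namely right derived functors
(`computedBy_rightDerived`) and, for global sections, sheaf cohomology, which is `Ext` from a
constant sheaf (`computedBy_sheafCohomology`). The comparison is natural in endomorphisms of the
resolved sheaf, and the scalars act by such endomorphisms, so it is linear over the real numbers
(`LocalResolution.exists_linear_cls`).
-/

set_option linter.unusedSectionVars false

/-! ### Soft sheaves -/

section SoftSheaves

variable {X : TopCat.{u}}

/-- The group of sections over `U` of a sheaf of abelian groups. -/
abbrev Sec (A : TopCat.Sheaf AddCommGrpCat.{u} X) (U : Opens X) : Type u := A.obj.obj (op U)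

/-- Restriction of sections. -/
def secRes (A : TopCat.Sheaf AddCommGrpCat.{u} X) {U V : Opens X} (h : V ≤ U) :
    Sec A U →+ Sec A V :=
  (A.obj.map (homOfLE h).op).hom

/-- The action of a morphism of sheaves on sections. -/
def secMap {A B : TopCat.Sheaf AddCommGrpCat.{u} X} (f : A ⟶ B) (U : Opens X) :
    Sec A U →+ Sec B U :=
  (f.hom.app (op U)).hom

variable {A B C : TopCat.Sheaf AddCommGrpCat.{u} X}

@[simp]
theorem secRes_secRes {U V W : Opens X} (h : V ≤ U) (h' : W ≤ V) (s : Sec A U) :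
    secRes A h' (secRes A h s) = secRes A (h'.trans h) s := by
  have := congrArg (fun g => g.hom s) (A.obj.map_comp (homOfLE h).op (homOfLE h').op)
  exact this.symm

@[simp]
theorem secRes_self {U : Opens X} (h : U ≤ U) (s : Sec A U) : secRes A h s = s :=
  congrArg (fun g => g.hom s) (A.obj.map_id (op U))

theorem secRes_secMap (f : A ⟶ B) {U V : Opens X} (h : V ≤ U) (s : Sec A U) :
    secRes B h (secMap f U s) = secMap f V (secRes A h s) :=
  (congrArg (fun g => g.hom s) (f.hom.naturality (homOfLE h).op)).symm

theorem secMap_comp (f : A ⟶ B) (g : B ⟶ C) (U : Opens X) (s : Sec A U) :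
    secMap (f ≫ g) U s = secMap g U (secMap f U s) := rfl

theorem secMap_add (f g : A ⟶ B) (U : Opens X) (s : Sec A U) :
    secMap (f + g) U s = secMap f U s + secMap g U s := rfl

theorem secMap_zero (U : Opens X) (s : Sec A U) : secMap (0 : A ⟶ B) U s = 0 := rfl

theorem secMap_id (U : Opens X) (s : Sec A U) : secMap (𝟙 A) U s = s := rfl

theorem sec_eq_of_cover {ι : Type*} (U : ι → Opens X) {V : Opens X} (hU : ∀ i, U i ≤ V)
    (hV : V ≤ iSup U) {s t : Sec A V} (h : ∀ i, secRes A (hU i) s = secRes A (hU i) t) : s = t :=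
  A.eq_of_locally_eq' U V (fun i => homOfLE (hU i)) hV s t h

theorem sec_eq_of_locally {V : Opens X} {s t : Sec A V}
    (h : ∀ x ∈ V, ∃ (U : Opens X) (hU : U ≤ V), x ∈ U ∧ secRes A hU s = secRes A hU t) :
    s = t := by
  choose U hU hx he using h
  exact sec_eq_of_cover (fun x : V => U x.1 x.2) (fun x => hU x.1 x.2)
    (fun x hxV => Opens.mem_iSup.2 ⟨⟨x, hxV⟩, hx x hxV⟩) (fun x => he x.1 x.2)

theorem exists_glue {ι : Type*} (U : ι → Opens X) {V : Opens X} (hU : ∀ i, U i ≤ V)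
    (hV : V ≤ iSup U) (s : ∀ i, Sec A (U i))
    (h : ∀ i j, secRes A (inf_le_left : U i ⊓ U j ≤ U i) (s i) =
      secRes A (inf_le_right : U i ⊓ U j ≤ U j) (s j)) :
    ∃ t : Sec A V, ∀ i, secRes A (hU i) t = s i :=
  (A.existsUnique_gluing' U V (fun i => homOfLE (hU i)) hV s h).exists

/-- Two sections that agree on an open set containing the intersection of their domains can be
glued. -/
theorem exists_glue_two {U V N W : Opens X} (hU : U ≤ W) (hV : V ≤ W) (hW : W ≤ U ⊔ V)
    (hNU : N ≤ U) (hNV : N ≤ V) (hN : U ⊓ V ≤ N) (s : Sec A U) (t : Sec A V)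
    (h : secRes A hNU s = secRes A hNV t) :
    ∃ w : Sec A W, secRes A hU w = s ∧ secRes A hV w = t := by
  have key : secRes A (inf_le_left : U ⊓ V ≤ U) s = secRes A (inf_le_right : U ⊓ V ≤ V) t := by
    have := congrArg (secRes A hN) h
    simpa using this
  let U' : Bool → Opens X := fun b => bif b then U else V
  obtain ⟨w, hw⟩ := exists_glue (A := A) U' (V := W)
    (fun b => by cases b <;> assumption)
    (hW.trans (sup_le (le_iSup U' true) (le_iSup U' false)))
    (fun b => match b with | true => s | false => t)
    (by
      rintro (_ | _) (_ | _)
      · rfl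
      · have := congrArg (secRes A (le_of_eq (inf_comm V U) : V ⊓ U ≤ U ⊓ V)) key
        simp only [secRes_secRes] at this
        exact this.symm
      · exact key
      · rfl)
  exact ⟨w, hw true, hw false⟩

theorem sec_eq_of_two {U V W : Opens X} (hU : U ≤ W) (hV : V ≤ W) (hW : W ≤ U ⊔ V)
    {s t : Sec A W} (h : secRes A hU s = secRes A hU t) (h' : secRes A hV s = secRes A hV t) :
    s = t := by
  refine sec_eq_of_locally fun x hx => ?_
  rcases hW hx with hx | hx
  exacts [⟨U, hU, hx, h⟩, ⟨V, hV, hx, h'⟩]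

/-- A sheaf is soft (more precisely, `c`-soft) if every section over a neighbourhood of a compact
set agrees near that set with a global section. -/
def IsSoft (A : TopCat.Sheaf AddCommGrpCat.{u} X) : Prop :=
  ∀ (K : Set X) (U : Opens X), IsCompact K → K ⊆ U → ∀ s : Sec A U,
    ∃ (t : Sec A ⊤) (N : Opens X) (hN : N ≤ U), K ⊆ N ∧
      secRes A (le_top : N ≤ ⊤) t = secRes A hN s

/-- A flasque sheaf is soft. -/
theorem isSoft_of_surjective_res
    (h : ∀ U : Opens X, Function.Surjective (secRes A (le_top : U ≤ ⊤))) : IsSoft A := by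
  intro K U _ hKU s
  obtain ⟨t, ht⟩ := h U s
  exact ⟨t, U, le_rfl, hKU, by rw [ht, secRes_self]⟩

section ShortExact

variable {S : ShortComplex (TopCat.Sheaf AddCommGrpCat.{u} X)} (hS : S.ShortExact)
include hS

theorem secMap_locally_surjective {U : Opens X} (c : Sec S.X₃ U) (x : X) (hx : x ∈ U) :
    ∃ (V : Opens X) (hV : V ≤ U) (b : Sec S.X₂ V), x ∈ V ∧
      secMap S.g V b = secRes S.X₃ hV c := by
  have := (TopCat.Sheaf.isLocallySurjective_iff_epi S.g).mpr hS.epi_g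
  obtain ⟨V, hV, ⟨b, hb⟩, hxV⟩ :=
    (TopCat.Presheaf.isLocallySurjective_iff S.g.hom).mp this U c x hx
  exact ⟨V, hV, b, hxV, hb⟩

theorem exists_secMap_eq {U : Opens X} (b : Sec S.X₂ U) (hb : secMap S.g U b = 0) :
    ∃ a : Sec S.X₁ U, secMap S.f U a = b :=
  TopCat.Sheaf.sections_exact_of_left_exact hS.exact hS.mono_f b hb

omit hS in
theorem secMap_g_f {U : Opens X} (a : Sec S.X₁ U) : secMap S.g U (secMap S.f U a) = 0 := by
  rw [← secMap_comp, S.zero, secMap_zero]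

end ShortExact

theorem secMap_injective_of_mono (f : A ⟶ B) [Mono f] (U : Opens X) :
    Function.Injective (secMap f U) := by
  have h1 : Mono f.hom := inferInstanceAs (Mono ((TopCat.Sheaf.forget _ _).map f))
  have h2 : Mono (f.hom.app (op U)) := inferInstance
  exact (AddCommGrpCat.mono_iff_injective _).1 h2

end SoftSheaves

/-! ### Lifting sections along epimorphisms with soft kernel -/

section SoftLifting

variable {X : TopCat.{u}} {A : TopCat.Sheaf AddCommGrpCat.{u} X}
  {S : ShortComplex (TopCat.Sheaf AddCommGrpCat.{u} X)}

/-- One step of the extension of a local lift: a lift `b` of `c` near the compact set `F` and a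
lift `b₁` near the compact set `K` can be merged, after a correction of `b₁` by a section of the
soft sheaf `S.X₁`. The new lift agrees with `b` near `F`. -/
theorem exists_lift_union [T2Space X] (hS : S.ShortExact) (h₁ : IsSoft S.X₁) {U O V : Opens X}
    (hO : O ≤ U) (hV : V ≤ U) {F K : Set X} (hF : IsCompact F) (hK : IsCompact K) (hFO : F ⊆ O)
    (hKV : K ⊆ V) (c : Sec S.X₃ U) (b : Sec S.X₂ O) (b₁ : Sec S.X₂ V)
    (hb : secMap S.g O b = secRes S.X₃ hO c) (hb₁ : secMap S.g V b₁ = secRes S.X₃ hV c) :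
    ∃ (O' : Opens X) (hO' : O' ≤ U) (b' : Sec S.X₂ O') (N : Opens X) (hN : N ≤ O) (hN' : N ≤ O'),
      F ∪ K ⊆ O' ∧ secMap S.g O' b' = secRes S.X₃ hO' c ∧ F ⊆ N ∧
      secRes S.X₂ hN b = secRes S.X₂ hN' b' := by
  have hl : O ⊓ V ≤ O := inf_le_left
  have hr : O ⊓ V ≤ V := inf_le_right
  obtain ⟨a, ha⟩ := exists_secMap_eq hS (secRes S.X₂ hl b - secRes S.X₂ hr b₁) (by
    rw [map_sub, ← secRes_secMap, ← secRes_secMap, hb, hb₁, secRes_secRes, secRes_secRes, sub_self])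
  obtain ⟨a', N, hN, hFK, haa⟩ := h₁ (F ∩ K) (O ⊓ V) (hF.inter hK)
    (fun x hx => ⟨hFO hx.1, hKV hx.2⟩) a
  -- Away from `N` the compact sets `F` and `K` are disjoint, so that the domains of the two lifts
  -- can be shrunk until they meet only inside `N`.
  have hsep : SeparatedNhds (F \ N) (K \ N) := by
    refine SeparatedNhds.of_isCompact_isCompact (hF.diff N.isOpen) (hK.diff N.isOpen) ?_
    rw [Set.disjoint_left]
    exact fun x hx hx' => hx.2 (hFK ⟨hx.1, hx'.1⟩)
  obtain ⟨A₁, B₁, hA₁, hB₁, hFA, hKB, hdisj⟩ := hsep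
  let O₁ : Opens X := (⟨A₁, hA₁⟩ ⊔ N) ⊓ O
  let O₂ : Opens X := (⟨B₁, hB₁⟩ ⊔ N) ⊓ V
  have hO₁ : O₁ ≤ O := inf_le_right
  have hO₂ : O₂ ≤ V := inf_le_right
  have hN₁ : N ≤ O₁ := le_inf le_sup_right (hN.trans hl)
  have hN₂ : N ≤ O₂ := le_inf le_sup_right (hN.trans hr)
  have hcap : O₁ ⊓ O₂ ≤ N := by
    rintro x ⟨⟨hx | hx, -⟩, ⟨hx' | hx', -⟩⟩
    · exact (Set.disjoint_left.1 hdisj hx hx').elim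
    all_goals assumption
  let b₂ : Sec S.X₂ V := b₁ + secMap S.f V (secRes S.X₁ le_top a')
  have hb₂ : secMap S.g V b₂ = secRes S.X₃ hV c := by
    rw [map_add, secMap_g_f, add_zero, hb₁]
  have hagree : secRes S.X₂ hN₁ (secRes S.X₂ hO₁ b) = secRes S.X₂ hN₂ (secRes S.X₂ hO₂ b₂) := by
    have h1 := congrArg (secRes S.X₂ hN) ha
    rw [secRes_secMap, ← haa] at h1
    simp only [map_sub, secRes_secRes] at h1
    simp only [b₂, secRes_secRes, map_add, secRes_secMap, h1, add_sub_cancel]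
  obtain ⟨b', hb'₁, hb'₂⟩ := exists_glue_two (W := O₁ ⊔ O₂) le_sup_left le_sup_right le_rfl
    hN₁ hN₂ hcap _ _ hagree
  refine ⟨O₁ ⊔ O₂, sup_le (hO₁.trans hO) (hO₂.trans hV), b', O₁, hO₁, le_sup_left, ?_, ?_, ?_,
    hb'₁.symm⟩
  · rintro x (hx | hx)
    · refine Or.inl ⟨?_, hFO hx⟩
      by_cases hxN : x ∈ N
      exacts [Or.inr hxN, Or.inl (hFA ⟨hx, hxN⟩)]
    · refine Or.inr ⟨?_, hKV hx⟩
      by_cases hxN : x ∈ N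
      exacts [Or.inr hxN, Or.inl (hKB ⟨hx, hxN⟩)]
  · refine sec_eq_of_two (U := O₁) (V := O₂) le_sup_left le_sup_right le_rfl ?_ ?_
    · rw [secRes_secMap, hb'₁, ← secRes_secMap, hb, secRes_secRes, secRes_secRes]
    · rw [secRes_secMap, hb'₂, ← secRes_secMap, hb₂, secRes_secRes, secRes_secRes]
  · intro x hx
    refine ⟨?_, hFO hx⟩
    by_cases hxN : x ∈ N
    exacts [Or.inr hxN, Or.inl (hFA ⟨hx, hxN⟩)]

/-- A nonempty open set on which the property `P` holds locally is covered by the interiors of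
countably many compact sets, each of which lies in an open set with the property `P`. -/
theorem exists_seq_compact_cover [LocallyCompactSpace X] [SecondCountableTopology X]
    [T2Space X] {U : Opens X} (hU : (U : Set X).Nonempty) (P : Opens X → Prop)
    (h : ∀ x ∈ U, ∃ V : Opens X, x ∈ V ∧ P V) :
    ∃ (V : ℕ → Opens X) (K : ℕ → Set X), (∀ n, P (V n)) ∧ (∀ n, IsCompact (K n)) ∧
      (∀ n, K n ⊆ V n) ∧ (U : Set X) ⊆ ⋃ n, interior (K n) := by
  choose V hxV hPV using h
  have hK : ∀ x (hx : x ∈ U), ∃ K, IsCompact K ∧ x ∈ interior K ∧ K ⊆ V x hx := fun x hx =>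
    exists_compact_subset (V x hx).isOpen (hxV x hx)
  choose K hKc hxK hKV using hK
  obtain ⟨t, ht, hcov⟩ := TopologicalSpace.isOpen_iUnion_countable
    (fun x : U => interior (K x.1 x.2)) (fun _ => isOpen_interior)
  obtain ⟨x₀, hx₀⟩ := hU
  have htne : t.Nonempty := by
    have : x₀ ∈ ⋃ x : U, interior (K x.1 x.2) := Set.mem_iUnion.2 ⟨⟨x₀, hx₀⟩, hxK x₀ hx₀⟩
    rw [← hcov] at this
    obtain ⟨i, hi, -⟩ := Set.mem_iUnion₂.1 this
    exact ⟨i, hi⟩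
  obtain ⟨f, rfl⟩ := ht.exists_eq_range htne
  refine ⟨fun n => V (f n).1 (f n).2, fun n => K (f n).1 (f n).2, fun n => hPV _ _,
    fun n => hKc _ _, fun n => hKV _ _, fun x hx => ?_⟩
  have : x ∈ ⋃ x : U, interior (K x.1 x.2) := Set.mem_iUnion.2 ⟨⟨x, hx⟩, hxK x hx⟩
  rw [← hcov] at this
  simpa using this

/-- A lift of the section `c` to `S.X₂` over some open neighbourhood of `F`. -/
structure PartialLift {U : Opens X} (c : Sec S.X₃ U) (F : Set X) where
  /-- The domain of the lift. -/
  dom : Opens X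
  dom_le : dom ≤ U
  subset_dom : F ⊆ dom
  /-- The lift. -/
  lift : Sec S.X₂ dom
  map_lift : secMap S.g dom lift = secRes S.X₃ dom_le c

theorem exists_dependent_seq {P : ℕ → Type*} (p₀ : P 0) (R : ∀ n, P n → P (n + 1) → Prop)
    (h : ∀ n (p : P n), ∃ p' : P (n + 1), R n p p') :
    ∃ p : ∀ n, P n, ∀ n, R n (p n) (p (n + 1)) := by
  choose next hnext using h
  exact ⟨fun n => Nat.rec p₀ next n, fun n => hnext n _⟩

/-- If the kernel of an epimorphism of sheaves is soft, then the epimorphism is surjective on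
sections over every open set. -/
theorem IsSoft.secMap_surjective [LocallyCompactSpace X] [SecondCountableTopology X]
    [T2Space X] (h₁ : IsSoft S.X₁) (hS : S.ShortExact) (U : Opens X) :
    Function.Surjective (secMap S.g U) := by
  intro c
  rcases (U : Set X).eq_empty_or_nonempty with hU | hU
  · refine ⟨0, sec_eq_of_locally fun x hx => ?_⟩
    have : x ∈ (U : Set X) := hx
    simp [hU] at this
  obtain ⟨V, K, hV, hK, hKV, hcov⟩ := exists_seq_compact_cover hU
    (fun V => ∃ (hV : V ≤ U) (b : Sec S.X₂ V), secMap S.g V b = secRes S.X₃ hV c)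
    (fun x hx => by
      obtain ⟨V, hV, b, hxV, hb⟩ := secMap_locally_surjective hS c x hx
      exact ⟨V, hxV, hV, b, hb⟩)
  choose hVU b hb using hV
  -- Lifts near the compact sets `F n` are built by recursion, each agreeing with the preceding one
  -- near `F n`. Their restrictions to the interiors of the `F n` are compatible and glue.
  let F : ℕ → Set X := fun n => ⋃ i < n, K i
  have hF : ∀ n, IsCompact (F n) := fun n => (Set.finite_lt_nat n).isCompact_biUnion
    fun i _ => hK i
  have hFs : ∀ n, F (n + 1) = F n ∪ K n := fun n => Set.biUnion_lt_succ K n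
  have hFmono : Monotone F := monotone_nat_of_le_succ fun n => by
    rw [hFs]; exact Set.subset_union_left
  have step : ∀ n (p : PartialLift c (F n)), ∃ p' : PartialLift c (F (n + 1)), ∃ (N : Opens X)
      (hN : N ≤ p.dom) (hN' : N ≤ p'.dom),
      F n ⊆ N ∧ secRes S.X₂ hN p.lift = secRes S.X₂ hN' p'.lift := by
    intro n p
    obtain ⟨O', hO', b', N, hN, hN', hFK, hb', hFN, he⟩ := exists_lift_union hS h₁ p.dom_le (hVU n)
      (hF n) (hK n) p.subset_dom (hKV n) c p.lift (b n) p.map_lift (hb n)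
    exact ⟨⟨O', hO', (hFs n).subset.trans hFK, b', hb'⟩, N, hN, hN', hFN, he⟩
  have h0 : F 0 = ∅ := by simp [F]
  obtain ⟨p, hp⟩ := exists_dependent_seq (P := fun n => PartialLift c (F n))
    ⟨⊥, bot_le, h0.subset, 0, sec_eq_of_locally fun x hx => hx.elim⟩ _ step
  let I : ℕ → Opens X := fun n => ⟨interior (F n), isOpen_interior⟩
  have hI : ∀ n, I n ≤ (p n).dom := fun n => interior_subset.trans (p n).subset_dom
  have hImono : Monotone I := fun m n h => interior_mono (hFmono h)
  have hsucc : ∀ n, secRes S.X₂ ((hImono n.le_succ).trans (hI (n + 1))) (p (n + 1)).lift =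
      secRes S.X₂ (hI n) (p n).lift := by
    intro n
    obtain ⟨N, hN, hN', hFN, he⟩ := hp n
    have hIN : I n ≤ N := interior_subset.trans hFN
    have := congrArg (secRes S.X₂ hIN) he
    simp only [secRes_secRes] at this
    exact this.symm
  have hle : ∀ n k, secRes S.X₂ ((hImono (Nat.le_add_right n k)).trans (hI (n + k)))
      (p (n + k)).lift = secRes S.X₂ (hI n) (p n).lift := by
    intro n k
    induction k with
    | zero => rfl
    | succ k ih =>
      rw [← ih]
      have := congrArg (secRes S.X₂ (hImono (Nat.le_add_right n k))) (hsucc (n + k))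
      simpa only [secRes_secRes] using! this
  have hIU : ∀ n, I n ≤ U := fun n => (hI n).trans (p n).dom_le
  have hcovI : U ≤ iSup I := by
    intro x hx
    obtain ⟨n, hn⟩ := Set.mem_iUnion.1 (hcov hx)
    refine Opens.mem_iSup.2 ⟨n + 1, interior_mono ?_ hn⟩
    rw [hFs]; exact Set.subset_union_right
  obtain ⟨t, ht⟩ := exists_glue I hIU hcovI (fun n => secRes S.X₂ (hI n) (p n).lift) (by
    have main : ∀ i k, secRes S.X₂ (inf_le_left : I i ⊓ I (i + k) ≤ I i)
        (secRes S.X₂ (hI i) (p i).lift) = secRes S.X₂ (inf_le_right : I i ⊓ I (i + k) ≤ I (i + k))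
          (secRes S.X₂ (hI (i + k)) (p (i + k)).lift) := by
      intro i k
      rw [← hle i k]
      simp only [secRes_secRes]
    intro i j
    rcases le_total i j with h | h
    · obtain ⟨k, rfl⟩ := Nat.exists_eq_add_of_le h
      exact main i k
    · obtain ⟨k, rfl⟩ := Nat.exists_eq_add_of_le h
      have := congrArg (secRes S.X₂ (le_of_eq (inf_comm (I (j + k)) (I j)))) (main j k)
      simp only [secRes_secRes] at this ⊢
      exact this.symm)
  refine ⟨t, sec_eq_of_cover I hIU hcovI fun n => ?_⟩
  rw [secRes_secMap, ht, ← secRes_secMap, (p n).map_lift, secRes_secRes]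

/-- A quotient of a soft sheaf by a soft sheaf is soft: a section of the quotient lifts, and the
lift extends. -/
theorem IsSoft.of_shortExact [LocallyCompactSpace X] [SecondCountableTopology X]
    [T2Space X] (hS : S.ShortExact) (h₁ : IsSoft S.X₁) (h₂ : IsSoft S.X₂) : IsSoft S.X₃ := by
  intro K U hK hKU c
  obtain ⟨b, rfl⟩ := h₁.secMap_surjective hS U c
  obtain ⟨b', N, hN, hKN, he⟩ := h₂ K U hK hKU b
  exact ⟨secMap S.g ⊤ b', N, hN, hKN, by rw [secRes_secMap, he, secRes_secMap]⟩

/-- If the kernel of an epimorphism of sheaves is soft, then the epimorphism is surjective on global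
sections with compact support. -/
theorem IsSoft.compactSections_surjective [LocallyCompactSpace X] [SecondCountableTopology X]
    [T2Space X] (h₁ : IsSoft S.X₁) (hS : S.ShortExact) :
    Function.Surjective ((compactSections X).map S.g).hom := by
  rintro ⟨c, U, hU, hc⟩
  change Sec S.X₃ ⊤ at c
  change secRes S.X₃ (le_top : U ≤ ⊤) c = 0 at hc
  obtain ⟨b, rfl⟩ := h₁.secMap_surjective hS ⊤ c
  rw [secRes_secMap] at hc
  obtain ⟨a, ha⟩ := exists_secMap_eq hS _ hc
  obtain ⟨L, hL, hUL⟩ := exists_compact_superset hU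
  have hD : IsCompact (L \ interior L) := hL.diff isOpen_interior
  obtain ⟨a', N, hN, hDN, he⟩ := h₁ (L \ interior L) U hD (fun x hx => by
    by_contra h
    exact hx.2 (hUL h)) a
  -- The lift `b`, corrected by the global section `a'` of `S.X₁`, vanishes near the boundary
  -- of `L`, so that it can be replaced by `0` outside `L`.
  let Lc : Opens X := ⟨Lᶜ, hL.isClosed.isOpen_compl⟩
  let O₁ : Opens X := ⟨interior L, isOpen_interior⟩ ⊔ N
  let O₂ : Opens X := Lc ⊔ N
  have hcov : (⊤ : Opens X) ≤ O₁ ⊔ O₂ := by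
    intro x _
    by_cases h1 : x ∈ interior L
    · exact Or.inl (Or.inl h1)
    by_cases h2 : x ∈ L
    · exact Or.inl (Or.inr (hDN ⟨h2, h1⟩))
    · exact Or.inr (Or.inl h2)
  have hcap : O₁ ⊓ O₂ ≤ N := by
    rintro x ⟨hx | hx, hx' | hx'⟩
    · exact (hx' (interior_subset hx)).elim
    all_goals assumption
  let b₁ : Sec S.X₂ ⊤ := b - secMap S.f ⊤ a'
  have hb₁ : secMap S.g ⊤ b₁ = secMap S.g ⊤ b := by rw [map_sub, secMap_g_f, sub_zero]
  have hzero : secRes S.X₂ (le_top : N ≤ ⊤) b₁ = 0 := by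
    have h1 := congrArg (secRes S.X₂ hN) ha
    rw [secRes_secMap, ← he, secRes_secRes] at h1
    rw [map_sub, secRes_secMap, h1, sub_self]
  obtain ⟨w, hw₁, hw₂⟩ := exists_glue_two (U := O₁) (V := O₂) (N := N) le_top le_top hcov
    le_sup_right le_sup_right hcap (secRes S.X₂ le_top b₁) (0 : Sec S.X₂ O₂)
    (by rw [secRes_secRes, hzero, map_zero])
  have hO₂U : O₂ ≤ U := by
    rintro x (hx | hx)
    · by_contra h
      exact hx (interior_subset (hUL h))
    · exact hN hx
  have hwc : w ∈ compactSectionsSubgroup S.X₂ := by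
    refine ⟨Lc, ?_, ?_⟩
    · change IsCompact Lᶜᶜ
      rwa [compl_compl]
    · have := congrArg (secRes S.X₂ (le_sup_left : Lc ≤ O₂)) hw₂
      rw [map_zero, secRes_secRes] at this
      exact this
  refine ⟨⟨w, hwc⟩, Subtype.ext ?_⟩
  change secMap S.g ⊤ w = secMap S.g ⊤ b
  refine sec_eq_of_two (U := O₁) (V := O₂) le_top le_top hcov ?_ ?_
  · rw [secRes_secMap, hw₁, ← secRes_secMap, hb₁]
  · have := congrArg (secRes S.X₃ hO₂U) (secRes_secMap S.g (le_top : U ≤ ⊤) b |>.trans hc)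
    rw [secRes_secRes, map_zero] at this
    rw [secRes_secMap, hw₂, map_zero, this]

/-- An injective sheaf is flasque: a section over `U` is a morphism from the free sheaf on `U`,
which embeds into the free sheaf on the whole space. -/
theorem secRes_surjective_of_injective [Injective A] (U : Opens X) :
    Function.Surjective (secRes A (le_top : U ≤ ⊤)) := by
  let adj := (AddCommGrpCat.adj.{u}.whiskerRight (Opens X)ᵒᵖ).comp
    (sheafificationAdjunction (Opens.grothendieckTopology X) AddCommGrpCat.{u})
  let L : Opens X ⥤ Sheaf (Opens.grothendieckTopology X) AddCommGrpCat.{u} :=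
    yoneda ⋙ ((Functor.whiskeringRight _ _ _).obj AddCommGrpCat.free ⋙
      presheafToSheaf (Opens.grothendieckTopology X) AddCommGrpCat.{u})
  let e : ∀ V : Opens X, (L.obj V ⟶ A) ≃ Sec A V := fun V =>
    (adj.homEquiv (yoneda.obj V) A).trans yonedaEquiv
  have he : ∀ {V V' : Opens X} (i : V ⟶ V') (φ : L.obj V' ⟶ A),
      e V (L.map i ≫ φ) = secRes A i.le (e V' φ) := by
    intro V V' i φ
    have h := adj.homEquiv_naturality_left (yoneda.map i) φ
    exact (congrArg yonedaEquiv h).trans (yonedaEquiv_naturality _ i).symm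
  intro s
  have : Mono (L.map (homOfLE (le_top : U ≤ ⊤))) := by
    have h1 : Mono (((Functor.whiskeringRight (Opens X)ᵒᵖ _ _).obj AddCommGrpCat.free).map
        (yoneda.map (homOfLE (le_top : U ≤ ⊤)))) := by
      have : ∀ W, Mono ((((Functor.whiskeringRight (Opens X)ᵒᵖ _ _).obj AddCommGrpCat.free).map
        (yoneda.map (homOfLE (le_top : U ≤ ⊤)))).app W) := by
        intro W
        have : Mono ((yoneda.map (homOfLE (le_top : U ≤ ⊤))).app W) := inferInstance
        exact inferInstanceAs (Mono (AddCommGrpCat.free.map _))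
      exact NatTrans.mono_of_mono_app _
    exact inferInstanceAs (Mono ((presheafToSheaf (Opens.grothendieckTopology X)
      AddCommGrpCat.{u}).map _))
  have hA : @Injective (Sheaf (Opens.grothendieckTopology X) AddCommGrpCat.{u}) _ A :=
    ‹Injective A›
  refine ⟨e ⊤ (Injective.factorThru ((e U).symm s) (L.map (homOfLE (le_top : U ≤ ⊤)))),
    (he (homOfLE le_top) _).symm.trans ((congrArg (e U) (Injective.comp_factorThru _ _)).trans
      ((e U).apply_symm_apply s))⟩

theorem IsSoft.of_injective [Injective A] : IsSoft A :=
  isSoft_of_surjective_res secRes_surjective_of_injective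

end SoftLifting

/-! ### Resolutions by objects of an adapted class -/

section AcyclicResolutions

open Limits

variable {C : Type*} [Category* C] [Abelian C]

/-- A right resolution `0 ⟶ A ⟶ K⁰ ⟶ K¹ ⟶ ⋯` of an object `A` of an abelian category. -/
structure Coresolution (A : C) where
  /-- The complex `K⁰ ⟶ K¹ ⟶ ⋯`. -/
  cx : CochainComplex C ℕ
  /-- The augmentation `A ⟶ K⁰`. -/
  ι : A ⟶ cx.X 0
  mono : Mono ι
  zero : ι ≫ cx.d 0 1 = 0
  exact_zero : (ShortComplex.mk ι (cx.d 0 1) zero).Exact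
  exact_succ : ∀ n, (ShortComplex.mk (cx.d n (n + 1)) (cx.d (n + 1) (n + 2))
    (cx.d_comp_d _ _ _)).Exact

/-- An injective resolution, seen as a right resolution. -/
def CategoryTheory.InjectiveResolution.toCoresolution {A : C} (I : InjectiveResolution A) :
    Coresolution A where
  cx := I.cocomplex
  ι := I.ι.f 0
  mono := by
    have h : Mono (I.ι.f 0) := inferInstance
    exact h
  zero := I.ι_f_zero_comp_complex_d
  exact_zero := I.exact₀
  exact_succ := I.exact_succ

namespace Coresolution

variable {A : C} (K : Coresolution A)

theorem exists_lift {T : C} (x : T ⟶ K.cx.X 0) (h : x ≫ K.cx.d 0 1 = 0) :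
    ∃ a, a ≫ K.ι = x :=
  have : Mono (ShortComplex.mk K.ι (K.cx.d 0 1) K.zero).f := K.mono
  K.exact_zero.lift' x h

theorem eq_zero_of_comp_ι {T : C} (a : T ⟶ A) (h : a ≫ K.ι = 0) : a = 0 :=
  have := K.mono
  zero_of_comp_mono K.ι h

/-- The identity of `A` extends to a cochain map from any resolution to an injective one. -/
theorem exists_desc (I : InjectiveResolution A) :
    ∃ f : K.cx ⟶ I.cocomplex, K.ι ≫ f.f 0 = I.toCoresolution.ι := by
  have := K.mono
  let f₀ : K.cx.X 0 ⟶ I.cocomplex.X 0 := Injective.factorThru I.toCoresolution.ι K.ι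
  have h₀ : K.ι ≫ f₀ = I.toCoresolution.ι := Injective.comp_factorThru _ _
  let f₁ : K.cx.X 1 ⟶ I.cocomplex.X 1 := K.exact_zero.descToInjective
    (f₀ ≫ I.cocomplex.d 0 1) (by
      change K.ι ≫ f₀ ≫ _ = 0
      rw [← Category.assoc, h₀]; exact I.toCoresolution.zero)
  have h₁ : K.cx.d 0 1 ≫ f₁ = f₀ ≫ I.cocomplex.d 0 1 := K.exact_zero.comp_descToInjective _ _
  refine ⟨CochainComplex.mkHom _ _ f₀ f₁ h₁.symm fun n ⟨g, g', w⟩ =>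
    ⟨(K.exact_succ n).descToInjective (g' ≫ I.cocomplex.d (n + 1) (n + 2)) ?_,
      ((K.exact_succ n).comp_descToInjective _ _).symm⟩, ?_⟩
  · change K.cx.d n (n + 1) ≫ g' ≫ _ = 0
    rw [← Category.assoc, ← w, Category.assoc, HomologicalComplex.d_comp_d, comp_zero]
  · rw [CochainComplex.mkHom_f_0, h₀]

/-- A cochain map from a resolution to an injective resolution that is zero on the augmentation
is null homotopic. -/
theorem exists_homotopy_zero {B : C} (I : InjectiveResolution B) (f : K.cx ⟶ I.cocomplex)
    (h : K.ι ≫ f.f 0 = 0) : Nonempty (Homotopy f 0) := by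
  let s₀ : K.cx.X 1 ⟶ I.cocomplex.X 0 := K.exact_zero.descToInjective (f.f 0) h
  have h₀ : K.cx.d 0 1 ≫ s₀ = f.f 0 := K.exact_zero.comp_descToInjective _ _
  let s₁ : K.cx.X 2 ⟶ I.cocomplex.X 1 := (K.exact_succ 0).descToInjective
    (f.f 1 - s₀ ≫ I.cocomplex.d 0 1) (by
      change K.cx.d 0 1 ≫ _ = 0
      rw [Preadditive.comp_sub, ← Category.assoc, h₀, HomologicalComplex.Hom.comm, sub_self])
  have h₁ : K.cx.d 1 2 ≫ s₁ = f.f 1 - s₀ ≫ I.cocomplex.d 0 1 :=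
    (K.exact_succ 0).comp_descToInjective _ _
  refine ⟨Homotopy.mkCoinductive _ s₀ h₀.symm s₁ (by rw [h₁]; abel) fun n ⟨g, g', w⟩ =>
    ⟨(K.exact_succ (n + 1)).descToInjective (f.f (n + 2) - g' ≫ I.cocomplex.d _ _) ?_, ?_⟩⟩
  · change K.cx.d (n + 1) (n + 2) ≫ _ = 0
    rw [Preadditive.comp_sub, ← HomologicalComplex.Hom.comm, w, Preadditive.add_comp,
      Category.assoc, Category.assoc, HomologicalComplex.d_comp_d, comp_zero, zero_add, sub_self]
  · have := (K.exact_succ (n + 1)).comp_descToInjective (f.f (n + 2) - g' ≫ I.cocomplex.d _ _) (by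
      change K.cx.d (n + 1) (n + 2) ≫ _ = 0
      rw [Preadditive.comp_sub, ← HomologicalComplex.Hom.comm, w, Preadditive.add_comp,
        Category.assoc, Category.assoc, HomologicalComplex.d_comp_d, comp_zero, zero_add, sub_self])
    change K.cx.d (n + 2) (n + 3) ≫ _ = _ at this
    rw [this]; abel

end Coresolution

variable (Φ : C ⥤ AddCommGrpCat.{u})

/-- The coboundaries in degree `n` of the complex `Φ(L)`. -/
def coboundarySubgroup (L : CochainComplex C ℕ) : ∀ n, AddSubgroup (Φ.obj (L.X n))
  | 0 => ⊥
  | n + 1 => (Φ.map (L.d n (n + 1))).hom.range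

/-- The class `P` of objects is adapted to the left exact functor `Φ`: it contains the injective
objects, is closed under finite sums and under quotients of objects of `P` by objects of `P`, and
`Φ` preserves short exact sequences whose kernel is in `P`. -/
structure IsAdapted (P : C → Prop) : Prop where
  of_injective : ∀ I : C, Injective I → P I
  biprod : ∀ A B : C, P A → P B → P (A ⊞ B)
  of_shortExact : ∀ S : ShortComplex C, S.ShortExact → P S.X₁ → P S.X₂ → P S.X₃
  surjective : ∀ S : ShortComplex C, S.ShortExact → P S.X₁ → Function.Surjective (Φ.map S.g).hom
  injective : ∀ {A B : C} (f : A ⟶ B), Mono f → Function.Injective (Φ.map f).hom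
  exact : ∀ S : ShortComplex C, S.ShortExact → ∀ x, (Φ.map S.g).hom x = 0 →
    ∃ y, (Φ.map S.f).hom y = x

variable {Φ} {P : C → Prop}

omit [Abelian C] in
theorem map_comp_hom_apply {A B B' : C} (f : A ⟶ B) (g : B ⟶ B') (x : Φ.obj A) :
    (Φ.map (f ≫ g)).hom x = (Φ.map g).hom ((Φ.map f).hom x) := by
  rw [Φ.map_comp]; rfl

theorem map_add_hom_apply [Φ.Additive] {A B : C} (f g : A ⟶ B) (x : Φ.obj A) :
    (Φ.map (f + g)).hom x = (Φ.map f).hom x + (Φ.map g).hom x := by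
  rw [Φ.map_add]; rfl

theorem map_neg_hom_apply [Φ.Additive] {A B : C} (f : A ⟶ B) (x : Φ.obj A) :
    (Φ.map (-f)).hom x = -(Φ.map f).hom x := by
  rw [Φ.map_neg]; rfl

theorem map_sub_hom_apply [Φ.Additive] {A B : C} (f g : A ⟶ B) (x : Φ.obj A) :
    (Φ.map (f - g)).hom x = (Φ.map f).hom x - (Φ.map g).hom x := by
  rw [Φ.map_sub]; rfl

theorem map_zero_hom_apply [Φ.Additive] {A B : C} (x : Φ.obj A) :
    (Φ.map (0 : A ⟶ B)).hom x = 0 := by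
  rw [Φ.map_zero]; rfl

omit [Abelian C] in
theorem map_id_hom_apply {A : C} (x : Φ.obj A) : (Φ.map (𝟙 A)).hom x = x := by
  rw [Φ.map_id]; rfl

namespace IsAdapted

section ExactSequence

/-- The short complex `ker g₁ ⟶ A₁ ⟶ ker g₂` of a complex `A₁ ⟶ A₂ ⟶ A₃`. -/
noncomputable abbrev kernelComplex {A₁ A₂ A₃ : C} (g₁ : A₁ ⟶ A₂) (g₂ : A₂ ⟶ A₃)
    (w : g₁ ≫ g₂ = 0) : ShortComplex C :=
  ShortComplex.mk (kernel.ι g₁) (kernel.lift g₂ g₁ w)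
    (by rw [← cancel_mono (kernel.ι g₂)]; simp)

/-- An exact sequence splits into short exact sequences `0 ⟶ ker g₁ ⟶ A₁ ⟶ ker g₂ ⟶ 0`. -/
theorem kernelComplex_shortExact {A₁ A₂ A₃ : C} (g₁ : A₁ ⟶ A₂) (g₂ : A₂ ⟶ A₃)
    (w : g₁ ≫ g₂ = 0) (h : (ShortComplex.mk g₁ g₂ w).Exact) :
    (kernelComplex g₁ g₂ w).ShortExact := by
  have h1 : Mono (kernelComplex g₁ g₂ w).f := equalizer.ι_mono
  have h2 : Epi (kernelComplex g₁ g₂ w).g := (ShortComplex.exact_iff_epi_kernel_lift _).1 h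
  refine ⟨?_⟩
  rw [ShortComplex.exact_iff_exact_up_to_refinements]
  intro T x hx
  have hx' : x ≫ g₁ = 0 := by
    have := hx =≫ kernel.ι g₂
    rwa [Category.assoc, kernel.lift_ι, zero_comp] at this
  exact ⟨T, 𝟙 T, inferInstance, kernel.lift g₁ x hx', by rw [Category.id_comp, kernel.lift_ι]⟩

variable (hP : IsAdapted Φ P)
include hP

/-- `Φ` preserves the exactness at `A₂` of an exact sequence `A₁ ⟶ A₂ ⟶ A₃ ⟶ A₄` if the kernel of
the first map is in the adapted class. -/
theorem exists_map_eq_of_kernel_mem {A₁ A₂ A₃ A₄ : C} (g₁ : A₁ ⟶ A₂) (g₂ : A₂ ⟶ A₃) (g₃ : A₃ ⟶ A₄)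
    (w₁ : g₁ ≫ g₂ = 0) (h₁ : (ShortComplex.mk g₁ g₂ w₁).Exact) (w₂ : g₂ ≫ g₃ = 0)
    (h₂ : (ShortComplex.mk g₂ g₃ w₂).Exact) (hk : P (kernel g₁)) (x : Φ.obj A₂)
    (hx : (Φ.map g₂).hom x = 0) : ∃ y, (Φ.map g₁).hom y = x := by
  have h : (Φ.map (kernel.lift g₃ g₂ w₂)).hom x = 0 := by
    refine hP.injective (kernel.ι g₃) inferInstance ?_
    rw [map_zero, ← map_comp_hom_apply, kernel.lift_ι, hx]
  obtain ⟨z, hz⟩ := hP.exact _ (kernelComplex_shortExact g₂ g₃ w₂ h₂) x h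
  obtain ⟨y, hy⟩ := hP.surjective _ (kernelComplex_shortExact g₁ g₂ w₁ h₁) hk z
  refine ⟨y, ?_⟩
  have h3 := map_comp_hom_apply (Φ := Φ) (kernel.lift g₂ g₁ w₁) (kernel.ι g₂) y
  rw [kernel.lift_ι] at h3
  exact h3.trans ((congrArg _ hy).trans hz)

variable {X₀ : C} {X : ℕ → C} (d₀ : X₀ ⟶ X 0) (d : ∀ n, X n ⟶ X (n + 1))
  (w₀ : d₀ ≫ d 0 = 0) (hd₀ : (ShortComplex.mk _ _ w₀).Exact)
  (w : ∀ n, d n ≫ d (n + 1) = 0) (hd : ∀ n, (ShortComplex.mk _ _ (w n)).Exact)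
include hd₀ hd

omit hd in
theorem kernel_mem_zero (h0 : Mono d₀) (hX₀ : P X₀) : P (kernel (d 0)) := by
  have hk : P (kernel d₀) := hP.of_injective _ (isZero_kernel_of_mono d₀).injective
  exact hP.of_shortExact _ (kernelComplex_shortExact d₀ (d 0) w₀ hd₀) hk hX₀

/-- Induction along an exact sequence: the kernels of all differentials are in the adapted class,
since each of them is the quotient of an object of the class by the preceding kernel. -/
theorem kernel_mem (h0 : Mono d₀) (hX₀ : P X₀) (hX : ∀ n, P (X n)) (n : ℕ) :
    P (kernel (d n)) := by
  induction n with
  | zero => exact hP.kernel_mem_zero d₀ d w₀ hd₀ h0 hX₀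
  | succ n ih =>
    exact hP.of_shortExact _ (kernelComplex_shortExact (d n) (d (n + 1)) (w n) (hd n)) ih (hX n)

/-- A left bounded exact sequence `0 ⟶ X₀ ⟶ X 0 ⟶ X 1 ⟶ ⋯` of objects in an adapted class stays
exact: in degree `0`. -/
theorem exists_map_eq_zero (h0 : Mono d₀) (x : Φ.obj (X 0))
    (hx : (Φ.map (d 0)).hom x = 0) : ∃ y, (Φ.map d₀).hom y = x :=
  hP.exists_map_eq_of_kernel_mem d₀ (d 0) (d 1) w₀ hd₀ (w 0) (hd 0)
    (hP.of_injective _ (isZero_kernel_of_mono d₀).injective) x hx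

/-- A left bounded exact sequence `0 ⟶ X₀ ⟶ X 0 ⟶ X 1 ⟶ ⋯` of objects in an adapted class stays
exact: in positive degrees. -/
theorem exists_map_eq_succ (h0 : Mono d₀) (hX₀ : P X₀) (hX : ∀ n, P (X n)) (n : ℕ)
    (x : Φ.obj (X (n + 1))) (hx : (Φ.map (d (n + 1))).hom x = 0) :
    ∃ y, (Φ.map (d n)).hom y = x :=
  hP.exists_map_eq_of_kernel_mem (d n) (d (n + 1)) (d (n + 2)) (w n) (hd n) (w (n + 1))
    (hd (n + 1)) (hP.kernel_mem d₀ d w₀ hd₀ w hd h0 hX₀ hX n) x hx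

end ExactSequence

section Cone

variable {A : C} (K : Coresolution A) (I : InjectiveResolution A) (f : K.cx ⟶ I.cocomplex)

/-- The objects `K¹ ⊞ I⁰, K² ⊞ I¹, …` of the mapping cone of `f : K ⟶ I`. -/
noncomputable abbrev coneX (n : ℕ) : C := K.cx.X (n + 1) ⊞ I.cocomplex.X n

/-- The first differential `K⁰ ⟶ K¹ ⊞ I⁰` of the mapping cone. -/
noncomputable abbrev coneD₀ : K.cx.X 0 ⟶ coneX K I 0 :=
  biprod.lift (K.cx.d 0 1) (f.f 0)

/-- The differential `(x, y) ↦ (d x, f x - d y)` of the mapping cone. -/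
noncomputable abbrev coneD (n : ℕ) : coneX K I n ⟶ coneX K I (n + 1) :=
  biprod.lift (biprod.fst ≫ K.cx.d (n + 1) (n + 2))
    (biprod.fst ≫ f.f (n + 1) - biprod.snd ≫ I.cocomplex.d n (n + 1))

theorem coneD₀_comp : coneD₀ K I f ≫ coneD K I f 0 = 0 := by
  apply biprod.hom_ext <;> simp

theorem coneD_comp (n : ℕ) : coneD K I f n ≫ coneD K I f (n + 1) = 0 := by
  apply biprod.hom_ext <;> simp [Preadditive.sub_comp]

variable {K I f} in
theorem comp_coneD_eq_zero {n : ℕ} {T : C} {x : T ⟶ coneX K I n}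
    (hx : x ≫ coneD K I f n = 0) :
    x ≫ biprod.fst ≫ K.cx.d (n + 1) (n + 2) = 0 ∧
      x ≫ biprod.fst ≫ f.f (n + 1) = x ≫ biprod.snd ≫ I.cocomplex.d n (n + 1) := by
  constructor
  · have := hx =≫ biprod.fst
    simpa using this
  · have := hx =≫ biprod.snd
    rw [Category.assoc, biprod.lift_snd, zero_comp, Preadditive.comp_sub] at this
    exact sub_eq_zero.1 this

variable {K I f} (hf : K.ι ≫ f.f 0 = I.toCoresolution.ι)
include hf

/-- The mapping cone of a quasi-isomorphism is exact; this is exactness in the lowest degree. -/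
theorem mono_coneD₀ : Mono (coneD₀ K I f) := by
  refine Preadditive.mono_of_cancel_zero _ fun {T} x hx => ?_
  have h1 : x ≫ K.cx.d 0 1 = 0 := by
    have := hx =≫ biprod.fst
    simpa using this
  have h2 : x ≫ f.f 0 = 0 := by
    have := hx =≫ biprod.snd
    simpa using this
  obtain ⟨a, rfl⟩ := K.exists_lift x h1
  rw [Category.assoc, hf] at h2
  rw [I.toCoresolution.eq_zero_of_comp_ι a h2, zero_comp]

/-- Exactness of the mapping cone at `K¹ ⊞ I⁰`. -/
theorem coneD₀_exact : (ShortComplex.mk _ _ (coneD₀_comp K I f)).Exact := by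
  rw [ShortComplex.exact_iff_exact_up_to_refinements]
  intro T x hx
  obtain ⟨h1, h2⟩ := comp_coneD_eq_zero hx
  obtain ⟨T', e, he, x', hx'⟩ := (ShortComplex.exact_iff_exact_up_to_refinements _).1
    (K.exact_succ 0) (x ≫ biprod.fst) (by rw [Category.assoc, h1])
  change e ≫ x ≫ biprod.fst = x' ≫ K.cx.d 0 1 at hx'
  have h3 : (e ≫ x ≫ biprod.snd - x' ≫ f.f 0) ≫ I.cocomplex.d 0 1 = 0 := by
    rw [Preadditive.sub_comp, Category.assoc, Category.assoc x', f.comm, ← Category.assoc x', ← hx']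
    simp only [Category.assoc]
    rw [h2, sub_self]
  obtain ⟨a, ha⟩ := I.toCoresolution.exists_lift _ h3
  refine ⟨T', e, he, x' + a ≫ K.ι, biprod.hom_ext _ _ ?_ ?_⟩
  · simp [K.zero, hx']
  · simp only [Category.assoc, biprod.lift_snd, Preadditive.add_comp, hf]
    exact (add_eq_of_eq_sub' ha).symm

omit hf in
/-- Exactness of the mapping cone at `Kⁿ⁺² ⊞ Iⁿ⁺¹`. -/
theorem coneD_exact (n : ℕ) : (ShortComplex.mk _ _ (coneD_comp K I f n)).Exact := by
  rw [ShortComplex.exact_iff_exact_up_to_refinements]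
  intro T x hx
  obtain ⟨h1, h2⟩ := comp_coneD_eq_zero hx
  obtain ⟨T', e, he, x', hx'⟩ := (ShortComplex.exact_iff_exact_up_to_refinements _).1
    (K.exact_succ (n + 1)) (x ≫ biprod.fst) (by rw [Category.assoc, h1])
  change e ≫ x ≫ biprod.fst = x' ≫ K.cx.d (n + 1) (n + 2) at hx'
  have h3 : (e ≫ x ≫ biprod.snd - x' ≫ f.f (n + 1)) ≫ I.cocomplex.d (n + 1) (n + 2) = 0 := by
    rw [Preadditive.sub_comp, Category.assoc, Category.assoc x', f.comm, ← Category.assoc x', ← hx']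
    simp only [Category.assoc]
    rw [h2, sub_self]
  obtain ⟨T'', e', he', y, hy⟩ :=
    (ShortComplex.exact_iff_exact_up_to_refinements _).1 (I.exact_succ n) _ h3
  change e' ≫ (e ≫ x ≫ biprod.snd - x' ≫ f.f (n + 1)) = y ≫ I.cocomplex.d n (n + 1) at hy
  refine ⟨T'', e' ≫ e, inferInstance, biprod.lift (e' ≫ x') (-y), biprod.hom_ext _ _ ?_ ?_⟩
  · simp [hx']
  · rw [Preadditive.comp_sub, sub_eq_iff_eq_add] at hy
    simp [hy, add_comm]

variable [Φ.Additive] (hP : IsAdapted Φ P) (hK : ∀ n, P (K.cx.X n))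
include hP hK

omit hf [Φ.Additive] in
theorem coneX_mem (n : ℕ) : P (coneX K I n) :=
  hP.biprod _ _ (hK _) (hP.of_injective _ (I.injective n))

omit hK in
/-- The comparison with an injective resolution is injective on cohomology in degree `0`. -/
theorem eq_zero_of_map_eq_zero (x : Φ.obj (K.cx.X 0)) (hx : (Φ.map (K.cx.d 0 1)).hom x = 0)
    (hfx : (Φ.map (f.f 0)).hom x = 0) : x = 0 := by
  refine hP.injective _ (mono_coneD₀ hf) ?_
  rw [map_zero, show coneD₀ K I f = K.cx.d 0 1 ≫ biprod.inl + f.f 0 ≫ biprod.inr from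
    biprod.lift_eq, map_add_hom_apply, map_comp_hom_apply, map_comp_hom_apply, hx, hfx,
    map_zero, map_zero, add_zero]

/-- The comparison with an injective resolution is injective on cohomology in positive degrees. -/
theorem exists_of_map_eq (n : ℕ) (x : Φ.obj (K.cx.X (n + 1)))
    (hx : (Φ.map (K.cx.d (n + 1) (n + 2))).hom x = 0) (y : Φ.obj (I.cocomplex.X n))
    (hfx : (Φ.map (f.f (n + 1))).hom x = (Φ.map (I.cocomplex.d n (n + 1))).hom y) :
    ∃ z, (Φ.map (K.cx.d n (n + 1))).hom z = x := by
  let v : Φ.obj (coneX K I n) := (Φ.map biprod.inl).hom x + (Φ.map biprod.inr).hom y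
  have hfst : (Φ.map biprod.fst).hom v = x := by
    rw [map_add, ← map_comp_hom_apply, ← map_comp_hom_apply, biprod.inl_fst, biprod.inr_fst,
      map_id_hom_apply, map_zero_hom_apply, add_zero]
  have hv : (Φ.map (coneD K I f n)).hom v = 0 := by
    rw [map_add, ← map_comp_hom_apply, ← map_comp_hom_apply]
    have h1 : biprod.inl ≫ coneD K I f n =
        K.cx.d (n + 1) (n + 2) ≫ biprod.inl + f.f (n + 1) ≫ biprod.inr := by
      apply biprod.hom_ext <;> simp
    have h2 : biprod.inr ≫ coneD K I f n = -(I.cocomplex.d n (n + 1) ≫ biprod.inr) := by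
      apply biprod.hom_ext <;> simp
    rw [h1, h2, map_add_hom_apply, map_neg_hom_apply, map_comp_hom_apply, map_comp_hom_apply,
      map_comp_hom_apply, hx, hfx, map_zero, zero_add, add_neg_cancel]
  cases n with
  | zero =>
    obtain ⟨c, hc⟩ := hP.exists_map_eq_zero _ _ (coneD₀_comp K I f) (coneD₀_exact hf)
      (coneD_comp K I f) coneD_exact (mono_coneD₀ hf) v hv
    refine ⟨c, ?_⟩
    rw [← hfst, ← hc, ← map_comp_hom_apply, biprod.lift_fst]
  | succ n =>
    obtain ⟨c, hc⟩ := hP.exists_map_eq_succ _ _ (coneD₀_comp K I f) (coneD₀_exact hf)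
      (coneD_comp K I f) coneD_exact (mono_coneD₀ hf) (hK 0) (coneX_mem hP hK) n v hv
    refine ⟨(Φ.map biprod.fst).hom c, ?_⟩
    rw [← hfst, ← hc, ← map_comp_hom_apply, ← map_comp_hom_apply, biprod.lift_fst]

/-- The comparison with an injective resolution is surjective on cohomology. -/
theorem exists_sub_mem (n : ℕ) (z : Φ.obj (I.cocomplex.X n))
    (hz : (Φ.map (I.cocomplex.d n (n + 1))).hom z = 0) :
    ∃ x, (Φ.map (K.cx.d n (n + 1))).hom x = 0 ∧
      (Φ.map (f.f n)).hom x - z ∈ coboundarySubgroup Φ I.cocomplex n := by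
  let v : Φ.obj (coneX K I n) := (Φ.map biprod.inr).hom z
  have hfst : (Φ.map biprod.fst).hom v = 0 := by
    rw [← map_comp_hom_apply, biprod.inr_fst, map_zero_hom_apply]
  have hsnd : (Φ.map biprod.snd).hom v = z := by
    rw [← map_comp_hom_apply, biprod.inr_snd, map_id_hom_apply]
  have hv : (Φ.map (coneD K I f n)).hom v = 0 := by
    rw [← map_comp_hom_apply]
    have h2 : biprod.inr ≫ coneD K I f n = -(I.cocomplex.d n (n + 1) ≫ biprod.inr) := by
      apply biprod.hom_ext <;> simp
    rw [h2, map_neg_hom_apply, map_comp_hom_apply, hz, map_zero, neg_zero]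
  cases n with
  | zero =>
    obtain ⟨c, hc⟩ := hP.exists_map_eq_zero _ _ (coneD₀_comp K I f) (coneD₀_exact hf)
      (coneD_comp K I f) coneD_exact (mono_coneD₀ hf) v hv
    refine ⟨c, ?_, ?_⟩
    · rw [← hfst, ← hc, ← map_comp_hom_apply, biprod.lift_fst]
    · rw [← hsnd, ← hc, ← map_comp_hom_apply, biprod.lift_snd, sub_self]
      exact zero_mem _
  | succ n =>
    obtain ⟨c, hc⟩ := hP.exists_map_eq_succ _ _ (coneD₀_comp K I f) (coneD₀_exact hf)
      (coneD_comp K I f) coneD_exact (mono_coneD₀ hf) (hK 0) (coneX_mem hP hK) n v hv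
    refine ⟨(Φ.map biprod.fst).hom c, ?_, (Φ.map biprod.snd).hom c, ?_⟩
    · rw [← hfst, ← hc, ← map_comp_hom_apply, ← map_comp_hom_apply, biprod.lift_fst]
    · rw [← hsnd, ← hc, ← map_comp_hom_apply, ← map_comp_hom_apply, ← map_comp_hom_apply,
        biprod.lift_snd, map_sub_hom_apply, map_comp_hom_apply, map_comp_hom_apply]
      abel

end Cone

end IsAdapted

end AcyclicResolutions

/-! ### Derived functors and `Ext` computed by adapted resolutions -/

section Computation

open Limits

variable {C : Type*} [Category* C] [Abelian C] (Φ R : C ⥤ AddCommGrpCat.{u})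

/-- The functor `R` is computed in degree `n` by applying `Φ` to injective resolutions: `R(A)` is
the group of cocycles of `Φ(I)` modulo coboundaries, compatibly with endomorphisms of `A`. -/
def ComputedBy (n : ℕ) : Prop :=
  ∀ {A : C} (I : InjectiveResolution A),
    ∃ cls : (Φ.map (I.cocomplex.d n (n + 1))).hom.ker →+ R.obj A,
      Function.Surjective cls ∧
      (∀ y, cls y = 0 ↔ y.1 ∈ coboundarySubgroup Φ I.cocomplex n) ∧
      ∀ (σ : A ⟶ A) (φ : I.cocomplex ⟶ I.cocomplex),
        I.toCoresolution.ι ≫ φ.f 0 = σ ≫ I.toCoresolution.ι → ∀ y y',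
          y'.1 = (Φ.map (φ.f n)).hom y.1 → (R.map σ).hom (cls y) = cls y'

/-- Right derived functors are computed by injective resolutions, by their construction. -/
theorem computedBy_rightDerived [HasInjectiveResolutions C] [Φ.Additive] (n : ℕ) :
    ComputedBy Φ (Φ.rightDerived n) n := by
  intro A I
  let L := (Φ.mapHomologicalComplex (ComplexShape.up ℕ)).obj I.cocomplex
  let k : AddCommGrpCat.of (Φ.map (I.cocomplex.d n (n + 1))).hom.ker ⟶ L.X n :=
    AddCommGrpCat.ofHom (Φ.map (I.cocomplex.d n (n + 1))).hom.ker.subtype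
  have hk : k ≫ L.d n (n + 1) = 0 := by
    ext y
    exact y.2
  have hnext : (ComplexShape.up ℕ).next n = n + 1 := CochainComplex.next ℕ n
  let lift := L.liftCycles k (n + 1) hnext hk
  have hlift : ∀ y, (L.iCycles n).hom (lift.hom y) = y.1 := fun y =>
    congrArg (fun g => g.hom y) (L.liftCycles_i k (n + 1) hnext hk)
  have hinj : Function.Injective (L.iCycles n).hom :=
    (AddCommGrpCat.mono_iff_injective _).1 inferInstance
  have hker : ∀ z, (L.homologyπ n).hom z = 0 ↔
      (L.iCycles n).hom z ∈ coboundarySubgroup Φ I.cocomplex n := by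
    intro z
    have hex : ∀ i (hi : (ComplexShape.up ℕ).prev n = i), (L.homologyπ n).hom z = 0 ↔
        ∃ w, (L.d i n).hom w = (L.iCycles n).hom z := by
      intro i hi
      have h1 := ShortComplex.exact_of_g_is_cokernel
        (ShortComplex.mk _ _ (L.toCycles_comp_homologyπ i n)) (L.homologyIsCokernel i n hi)
      rw [ShortComplex.ab_exact_iff] at h1
      constructor
      · intro h
        obtain ⟨w, hw⟩ := h1 z h
        exact ⟨w, (congrArg (fun g => g.hom w) (L.toCycles_i i n)).symm.trans
          (congrArg (L.iCycles n).hom hw)⟩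
      · rintro ⟨w, hw⟩
        have h2 : (L.toCycles i n).hom w = z :=
          hinj ((congrArg (fun g => g.hom w) (L.toCycles_i i n)).trans hw)
        rw [← h2]
        exact congrArg (fun g => g.hom w) (L.toCycles_comp_homologyπ i n)
    cases n with
    | zero =>
      rw [hex 0 (CochainComplex.prev_nat_zero)]
      have h0 : L.d 0 0 = 0 := L.shape _ _ (by simp)
      rw [h0]
      constructor
      · rintro ⟨w, hw⟩
        exact hw.symm
      · intro h
        exact ⟨0, h.symm⟩
    | succ n =>
      rw [hex n (CochainComplex.prev_nat_succ n)]
      exact Iff.rfl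
  let iso : (Φ.rightDerived n).obj A ≅ L.homology n := I.isoRightDerivedObj Φ n
  have hisoinj : Function.Injective iso.inv.hom :=
    (AddCommGrpCat.mono_iff_injective _).1 inferInstance
  refine ⟨(lift ≫ L.homologyπ n ≫ iso.inv).hom, ?_, fun y => ?_, fun σ φ hφ y y' hy => ?_⟩
  · intro x
    obtain ⟨h, rfl⟩ := (AddCommGrpCat.epi_iff_surjective iso.inv).1 inferInstance x
    obtain ⟨z, hz⟩ := (AddCommGrpCat.epi_iff_surjective (L.homologyπ n)).1 inferInstance h
    have hd : (L.d n (n + 1)).hom ((L.iCycles n).hom z) = 0 :=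
      congrArg (fun g => g.hom z) (L.iCycles_d n (n + 1))
    refine ⟨⟨(L.iCycles n).hom z, hd⟩, ?_⟩
    have h2 : lift.hom ⟨(L.iCycles n).hom z, hd⟩ = z := hinj (hlift _)
    exact congrArg iso.inv.hom ((congrArg (L.homologyπ n).hom h2).trans hz)
  · have h := hker (lift.hom y)
    rw [hlift y] at h
    exact (map_eq_zero_iff iso.inv.hom hisoinj).trans h
  · have h1 := I.isoRightDerivedObj_inv_naturality σ I φ hφ Φ n
    let ψ : L ⟶ L := (Φ.mapHomologicalComplex (ComplexShape.up ℕ)).map φ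
    have h2 : (HomologicalComplex.cyclesMap ψ n).hom (lift.hom y) = lift.hom y' := by
      apply hinj
      refine (congrArg (fun g => g.hom (lift.hom y)) (HomologicalComplex.cyclesMap_i ψ n)).trans ?_
      refine (congrArg (Φ.map (φ.f n)).hom (hlift y)).trans ?_
      rw [hlift y', hy]
    refine (congrArg (fun g => g.hom ((L.homologyπ n).hom (lift.hom y))) h1).trans ?_
    refine congrArg iso.inv.hom ?_
    refine (congrArg (fun g => g.hom (lift.hom y))
      (HomologicalComplex.homologyπ_naturality ψ n)).trans ?_
    exact congrArg (L.homologyπ n).hom h2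

open Abelian in
/-- In degree `0` there are no coboundaries: a cocycle `Z ⟶ I⁰` that represents zero in `Ext⁰` is
zero. -/
theorem extMk_zero_eq_zero_iff [HasExt.{u} C] {Z A : C} (I : InjectiveResolution A)
    (f : Z ⟶ I.cocomplex.X 0) (hf : f ≫ I.cocomplex.d 0 1 = 0) :
    I.extMk f 1 rfl hf = 0 ↔ f = 0 := by
  refine ⟨fun h => ?_, fun h => by subst h; exact I.extMk_zero 1 rfl⟩
  rw [← I.extEquivCohomologyClass.apply_eq_iff_eq,
    InjectiveResolution.extEquivCohomologyClass_extMk,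
    InjectiveResolution.extEquivCohomologyClass_zero,
    CochainComplex.HomComplex.CohomologyClass.mk_eq_zero_iff,
    CochainComplex.HomComplex.Cocycle.fromSingleMk_mem_coboundaries_iff _ _ _ _ _ (-1)
      (by simp)] at h
  obtain ⟨g, hg⟩ := h
  have hz : IsZero (I.cochainComplex.X (-1)) := I.cochainComplex.isZero_of_isStrictlyGE 0 (-1)
  rw [hz.eq_of_tgt g 0, zero_comp] at hg
  rw [← cancel_mono (I.cochainComplexXIso 0 0 rfl).inv, zero_comp]
  exact hg.symm

open Abelian in
/-- If `Φ` is represented by `Z`, the functors `Ext Z` are computed by `Φ`. -/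
theorem exists_cls_ext [HasExt.{u} C] {Z : C} (e : ∀ B, (Z ⟶ B) ≃+ Φ.obj B)
    (he : ∀ {B B'} (f : B ⟶ B') (g : Z ⟶ B), e B' (g ≫ f) = (Φ.map f).hom (e B g)) (n : ℕ) {A : C}
    (I : InjectiveResolution A) :
    ∃ cls : (Φ.map (I.cocomplex.d n (n + 1))).hom.ker →+ Ext Z A n,
      Function.Surjective cls ∧
      (∀ y, cls y = 0 ↔ y.1 ∈ coboundarySubgroup Φ I.cocomplex n) ∧
      ∀ (σ : A ⟶ A) (φ : I.cocomplex ⟶ I.cocomplex),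
        I.toCoresolution.ι ≫ φ.f 0 = σ ≫ I.toCoresolution.ι → ∀ y y',
          y'.1 = (Φ.map (φ.f n)).hom y.1 →
            (cls y).comp (Ext.mk₀ σ) (add_zero n) = cls y' := by
  have he' : ∀ {B B' : C} (f : B ⟶ B') (y : Φ.obj B),
      (e B').symm ((Φ.map f).hom y) = (e B).symm y ≫ f := by
    intro B B' f y
    rw [AddEquiv.symm_apply_eq, he, AddEquiv.apply_symm_apply]
  have hd : ∀ y : (Φ.map (I.cocomplex.d n (n + 1))).hom.ker,
      (e _).symm y.1 ≫ I.cocomplex.d n (n + 1) = 0 := by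
    intro y
    rw [← he', (show (Φ.map (I.cocomplex.d n (n + 1))).hom y.1 = 0 from y.2), map_zero]
  refine ⟨AddMonoidHom.mk' (fun y => I.extMk ((e _).symm y.1) (n + 1) rfl (hd y)) ?_,
    ?_, fun y => ?_, fun σ φ hφ y y' hy => ?_⟩
  · intro y y'
    rw [InjectiveResolution.add_extMk]
    congr 1
    exact map_add (e _).symm y.1 y'.1
  · intro α
    obtain ⟨f, hf, rfl⟩ := I.extMk_surjective α (n + 1) rfl
    refine ⟨⟨e _ f, ?_⟩, ?_⟩
    · change (Φ.map _).hom _ = 0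
      rw [← he, hf, map_zero]
    · have h : (e _).symm (e _ f) = f := (e _).symm_apply_apply f
      change I.extMk ((e _).symm (e _ f)) (n + 1) rfl (by rw [h, hf]) = _
      congr 1
  · change I.extMk ((e _).symm y.1) (n + 1) rfl (hd y) = 0 ↔ _
    cases n with
    | zero =>
      rw [extMk_zero_eq_zero_iff]
      exact (map_eq_zero_iff (e _).symm (e _).symm.injective)
    | succ n =>
      rw [I.extMk_eq_zero_iff _ _ _ _ n rfl]
      constructor
      · rintro ⟨g, hg⟩
        refine ⟨e _ g, ?_⟩
        rw [← he, hg, AddEquiv.apply_symm_apply]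
      · rintro ⟨z, hz⟩
        refine ⟨(e _).symm z, ?_⟩
        rw [← he', ← hz]
  · let ψ : InjectiveResolution.Hom I I σ :=
      ⟨φ, by rw [CochainComplex.single₀_map_f_zero]; exact hφ⟩
    refine (InjectiveResolution.extMk_comp_mk₀ _ _ rfl (hd y) ψ).trans ?_
    have h : (e _).symm y.1 ≫ φ.f n = (e _).symm y'.1 := by rw [hy, he']
    change I.extMk ((e _).symm y.1 ≫ φ.f n) (n + 1) rfl (by rw [h]; exact hd y') =
      I.extMk ((e _).symm y'.1) (n + 1) rfl (hd y')
    congr 1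

variable {Φ R}

/-- Cohomology can be computed with resolutions by objects of an adapted class, compatibly with
endomorphisms of the object that lift to the resolution. -/
theorem IsAdapted.exists_cls {P : C → Prop} [Φ.Additive] [HasInjectiveResolutions C]
    (hP : IsAdapted Φ P) {n : ℕ} (hR : ComputedBy Φ R n) {A : C} (K : Coresolution A)
    (hK : ∀ n, P (K.cx.X n)) :
    ∃ cls : (Φ.map (K.cx.d n (n + 1))).hom.ker →+ R.obj A,
      Function.Surjective cls ∧
      (∀ y, cls y = 0 ↔ y.1 ∈ coboundarySubgroup Φ K.cx n) ∧
      ∀ (σ : A ⟶ A) (ψ : K.cx ⟶ K.cx), K.ι ≫ ψ.f 0 = σ ≫ K.ι → ∀ y y',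
          y'.1 = (Φ.map (ψ.f n)).hom y.1 → (R.map σ).hom (cls y) = cls y' := by
  let I := injectiveResolution A
  obtain ⟨f, hf⟩ := K.exists_desc I
  obtain ⟨cls, hsurj, hker, hnat⟩ := hR I
  have hmem : ∀ y : (Φ.map (K.cx.d n (n + 1))).hom.ker,
      (Φ.map (f.f n)).hom y.1 ∈ (Φ.map (I.cocomplex.d n (n + 1))).hom.ker := by
    intro y
    change (Φ.map _).hom _ = 0
    rw [← map_comp_hom_apply, f.comm, map_comp_hom_apply,
      (show (Φ.map (K.cx.d n (n + 1))).hom y.1 = 0 from y.2), map_zero]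
  let F : (Φ.map (K.cx.d n (n + 1))).hom.ker →+ (Φ.map (I.cocomplex.d n (n + 1))).hom.ker :=
    AddMonoidHom.mk' (fun y => ⟨(Φ.map (f.f n)).hom y.1, hmem y⟩)
      fun y y' => Subtype.ext (map_add (Φ.map (f.f n)).hom y.1 y'.1)
  refine ⟨cls.comp F, fun r => ?_, fun y => ?_, fun σ ψ hψ y y' hy => ?_⟩
  · obtain ⟨z, rfl⟩ := hsurj r
    obtain ⟨x, hx, hxz⟩ := hP.exists_sub_mem hf hK n z.1 z.2
    refine ⟨⟨x, hx⟩, ?_⟩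
    have := (hker (F ⟨x, hx⟩ - z)).2 hxz
    rwa [map_sub, sub_eq_zero] at this
  · refine (hker (F y)).trans ?_
    change (Φ.map (f.f n)).hom y.1 ∈ _ ↔ _
    cases n with
    | zero =>
      constructor
      · intro h
        exact hP.eq_zero_of_map_eq_zero hf y.1 y.2 h
      · intro h
        have h0 : y.1 = 0 := h
        rw [h0, map_zero]
        exact zero_mem _
    | succ n =>
      constructor
      · rintro ⟨w, hw⟩
        exact hP.exists_of_map_eq hf hK n y.1 y.2 w hw.symm
      · rintro ⟨w, hw⟩
        refine ⟨(Φ.map (f.f n)).hom w, ?_⟩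
        rw [← map_comp_hom_apply, f.comm, map_comp_hom_apply, hw]
  · let φ := InjectiveResolution.desc σ I I
    have hφ : I.toCoresolution.ι ≫ φ.f 0 = σ ≫ I.toCoresolution.ι :=
      InjectiveResolution.desc_commutes_zero σ I I
    have hz : K.ι ≫ (f ≫ φ - ψ ≫ f).f 0 = 0 := by
      have h1 : K.ι ≫ f.f 0 ≫ φ.f 0 = σ ≫ I.toCoresolution.ι := by
        rw [← Category.assoc, hf]
        exact hφ
      have h2 : K.ι ≫ ψ.f 0 ≫ f.f 0 = σ ≫ I.toCoresolution.ι := by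
        rw [← Category.assoc, hψ, Category.assoc]
        exact congrArg (σ ≫ ·) hf
      rw [HomologicalComplex.sub_f_apply, HomologicalComplex.comp_f, HomologicalComplex.comp_f,
        Preadditive.comp_sub]
      exact sub_eq_zero.2 (h1.trans h2.symm)
    -- `f ≫ φ` and `ψ ≫ f` both extend `σ`, so they are homotopic and agree on cohomology.
    obtain ⟨h⟩ := K.exists_homotopy_zero I _ hz
    have hmφ : (Φ.map (φ.f n)).hom (F y).1 ∈ (Φ.map (I.cocomplex.d n (n + 1))).hom.ker := by
      change (Φ.map _).hom _ = 0
      rw [← map_comp_hom_apply, φ.comm, map_comp_hom_apply,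
        (show (Φ.map (I.cocomplex.d n (n + 1))).hom (F y).1 = 0 from (F y).2), map_zero]
    refine (hnat σ φ hφ (F y) ⟨_, hmφ⟩ rfl).trans ?_
    rw [← sub_eq_zero]
    refine (map_sub cls _ (F y')).symm.trans ((hker _).2 ?_)
    have e : (Φ.map (φ.f n)).hom (F y).1 - (F y').1 =
        (Φ.map ((f ≫ φ - ψ ≫ f).f n)).hom y.1 := by
      rw [HomologicalComplex.sub_f_apply, HomologicalComplex.comp_f, HomologicalComplex.comp_f,
        map_sub_hom_apply, map_comp_hom_apply, map_comp_hom_apply, ← hy]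
      rfl
    change (Φ.map (φ.f n)).hom (F y).1 - (F y').1 ∈ _
    rw [e, h.comm n, HomologicalComplex.zero_f, add_zero, map_add_hom_apply,
      dNext_eq h.hom (show (ComplexShape.up ℕ).Rel n (n + 1) from rfl), map_comp_hom_apply,
      (show (Φ.map (K.cx.d n (n + 1))).hom y.1 = 0 from y.2), map_zero, zero_add]
    cases n with
    | zero =>
      rw [Homotopy.prevD_zero_cochainComplex, map_zero_hom_apply]
      exact zero_mem _
    | succ n =>
      rw [Homotopy.prevD_succ_cochainComplex, map_comp_hom_apply]
      exact ⟨_, rfl⟩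

variable (Φ) in
/-- The images of the maps `Φ(D)`, for a sequence of morphisms `D`, and zero in degree `0`. -/
def imageSubgroup {B : ℕ → C} (D : ∀ n, B n ⟶ B (n + 1)) : ∀ n, AddSubgroup (Φ.obj (B n))
  | 0 => ⊥
  | n + 1 => (Φ.map (D n)).hom.range

/-- A form of `IsAdapted.exists_cls` in which the differentials may be replaced by propositionally
equal morphisms. -/
theorem IsAdapted.exists_cls_of_d_eq {P : C → Prop} [Φ.Additive] [HasInjectiveResolutions C]
    (hP : IsAdapted Φ P) {n : ℕ} (hR : ComputedBy Φ R n) {A : C} (K : Coresolution A)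
    (hK : ∀ n, P (K.cx.X n)) (D : ∀ n, K.cx.X n ⟶ K.cx.X (n + 1))
    (hD : ∀ n, K.cx.d n (n + 1) = D n) :
    ∃ cls : (Φ.map (D n)).hom.ker →+ R.obj A,
      Function.Surjective cls ∧
      (∀ y, cls y = 0 ↔ y.1 ∈ imageSubgroup Φ D n) ∧
      ∀ (σ : A ⟶ A) (ψ : ∀ n, K.cx.X n ⟶ K.cx.X n), (∀ n, ψ n ≫ D n = D n ≫ ψ (n + 1)) →
        K.ι ≫ ψ 0 = σ ≫ K.ι → ∀ y y', y'.1 = (Φ.map (ψ n)).hom y.1 →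
          (R.map σ).hom (cls y) = cls y' := by
  obtain rfl : D = fun n => K.cx.d n (n + 1) := funext fun n => (hD n).symm
  obtain ⟨cls, hsurj, hker, hnat⟩ := hP.exists_cls hR K hK
  refine ⟨cls, hsurj, fun y => (hker y).trans ?_, fun σ ψ hψ hι y y' hy => ?_⟩
  · cases n <;> exact Iff.rfl
  · exact hnat σ ⟨ψ, by rintro n _ rfl; exact hψ n⟩ hι y y' hy

/-- A form of `IsAdapted.exists_cls` for a resolution given by a sequence of morphisms. -/
theorem IsAdapted.exists_cls_of_exact {P : C → Prop} [Φ.Additive] [HasInjectiveResolutions C]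
    (hP : IsAdapted Φ P) {n : ℕ} (hR : ComputedBy Φ R n) {A : C} (B : ℕ → C)
    (D : ∀ n, B n ⟶ B (n + 1)) (w : ∀ n, D n ≫ D (n + 1) = 0) (ι : A ⟶ B 0) (hι : Mono ι)
    (w₀ : ι ≫ D 0 = 0) (h₀ : (ShortComplex.mk ι (D 0) w₀).Exact)
    (h : ∀ n, (ShortComplex.mk (D n) (D (n + 1)) (w n)).Exact) (hB : ∀ n, P (B n)) :
    ∃ cls : (Φ.map (D n)).hom.ker →+ R.obj A,
      Function.Surjective cls ∧
      (∀ y, cls y = 0 ↔ y.1 ∈ imageSubgroup Φ D n) ∧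
      ∀ (σ : A ⟶ A) (ψ : ∀ n, B n ⟶ B n), (∀ n, ψ n ≫ D n = D n ≫ ψ (n + 1)) →
        ι ≫ ψ 0 = σ ≫ ι → ∀ y y', y'.1 = (Φ.map (ψ n)).hom y.1 →
          (R.map σ).hom (cls y) = cls y' := by
  have hD : ∀ n, (CochainComplex.of B D w).d n (n + 1) = D n := fun n =>
    CochainComplex.of_d B D n
  let K : Coresolution A :=
    { cx := CochainComplex.of B D w
      ι := ι
      mono := hι
      zero := by
        rw [hD]
        exact w₀
      exact_zero := by
        convert h₀ using 2
        exact hD 0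
      exact_succ := fun n => by
        convert h n using 2
        · exact hD n
        · exact hD (n + 1) }
  exact hP.exists_cls_of_d_eq hR K hB D hD

end Computation

/-! ### Sheaf cohomology and soft sheaves -/

section SheafCohomology

open Limits

/-- The functor of global sections. -/
def globalSections (X : TopCat.{u}) :
    TopCat.Sheaf AddCommGrpCat.{u} X ⥤ AddCommGrpCat.{u} where
  obj A := A.obj.obj (op ⊤)
  map f := f.hom.app (op ⊤)

instance (X : TopCat.{u}) : (globalSections X).Additive where
  map_add := rfl

/-- Sheaf cohomology, which is defined as `Ext` from the constant sheaf `ℤ`, is computed by global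
sections, since that sheaf represents them. -/
theorem computedBy_sheafCohomology (X : TopCat.{u}) (n : ℕ) :
    ComputedBy (globalSections X) (sheafCohomology X n) n := by
  intro A I
  have hT : IsTerminal (⊤ : Opens X) := isTerminalTop
  let Z : Sheaf (Opens.grothendieckTopology X) AddCommGrpCat.{u} :=
    (constantSheaf (Opens.grothendieckTopology X) AddCommGrpCat.{u}).obj
      (AddCommGrpCat.of (ULift ℤ))
  let Φ : Sheaf (Opens.grothendieckTopology X) AddCommGrpCat.{u} ⥤ AddCommGrpCat.{u} :=
    globalSections X
  let e : ∀ B : Sheaf (Opens.grothendieckTopology X) AddCommGrpCat.{u}, (Z ⟶ B) ≃+ Φ.obj B :=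
    fun B => ((constantSheafAdj (Opens.grothendieckTopology X) AddCommGrpCat hT).homAddEquiv
      _ B).trans (AddCommGrpCat.uliftZMultiplesAddEquiv _)
  exact exists_cls_ext Φ (Z := Z) e (fun f g => rfl) n I

variable {X : TopCat.{u}}

theorem IsSoft.biprod {A B : TopCat.Sheaf AddCommGrpCat.{u} X} (hA : IsSoft A) (hB : IsSoft B) :
    IsSoft (A ⊞ B) := by
  intro K U hK hKU s
  obtain ⟨a, N, hN, hKN, ha⟩ := hA K U hK hKU (secMap (biprod.fst : A ⊞ B ⟶ A) U s)
  obtain ⟨b, N', hN', hKN', hb⟩ := hB K U hK hKU (secMap (biprod.snd : A ⊞ B ⟶ B) U s)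
  refine ⟨secMap (biprod.inl : A ⟶ A ⊞ B) ⊤ a + secMap (biprod.inr : B ⟶ A ⊞ B) ⊤ b, N ⊓ N',
    inf_le_left.trans hN, Set.subset_inter hKN hKN', ?_⟩
  have ha' := congrArg (secRes A (inf_le_left : N ⊓ N' ≤ N)) ha
  have hb' := congrArg (secRes B (inf_le_right : N ⊓ N' ≤ N')) hb
  simp only [secRes_secRes, secRes_secMap] at ha' hb'
  rw [map_add, secRes_secMap, secRes_secMap, ha', hb', ← secMap_comp, ← secMap_comp,
    ← secMap_add, biprod.total, secMap_id]

variable [LocallyCompactSpace X] [SecondCountableTopology X] [T2Space X]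

/-- On a locally compact second countable Hausdorff space, soft sheaves are adapted to global
sections. -/
theorem isAdapted_globalSections : IsAdapted (globalSections X) (IsSoft (X := X)) where
  of_injective _ h := have := h; IsSoft.of_injective
  biprod _ _ := IsSoft.biprod
  of_shortExact _ hS := IsSoft.of_shortExact hS
  surjective _ hS h₁ := h₁.secMap_surjective hS ⊤
  injective f _ := secMap_injective_of_mono f ⊤
  exact _ hS := exists_secMap_eq hS

/-- On a locally compact second countable Hausdorff space, soft sheaves are adapted to sections with
compact support. -/
theorem isAdapted_compactSections : IsAdapted (compactSections X) (IsSoft (X := X)) where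
  of_injective _ h := have := h; IsSoft.of_injective
  biprod _ _ := IsSoft.biprod
  of_shortExact _ hS := IsSoft.of_shortExact hS
  surjective _ hS h₁ := h₁.compactSections_surjective hS
  injective f _ := fun x y h =>
    Subtype.ext (secMap_injective_of_mono f ⊤ (congrArg Subtype.val h))
  exact S hS := by
    rintro ⟨x, U, hU, hx⟩ h
    obtain ⟨y, rfl⟩ := exists_secMap_eq hS x (congrArg Subtype.val h)
    refine ⟨⟨y, U, hU, ?_⟩, rfl⟩
    have := hS.mono_f
    refine secMap_injective_of_mono S.f U ?_
    rw [map_zero]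
    exact (secRes_secMap S.f (le_top : U ≤ ⊤) y).symm.trans hx

end SheafCohomology

/-! ### Sheaves of sections and local operators -/

section LocalOperators

open Limits

variable {X : TopCat.{u}}

/-- A complex of sheaves is exact if every section killed by the second map lifts locally. -/
theorem exact_of_exists_lift (S : ShortComplex (TopCat.Sheaf AddCommGrpCat.{u} X))
    (h : ∀ (U : Opens X) (s : Sec S.X₂ U), secMap S.g U s = 0 → ∀ x ∈ U,
      ∃ (V : Opens X) (hV : V ≤ U) (t : Sec S.X₁ V), x ∈ V ∧ secMap S.f V t = secRes S.X₂ hV s) :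
    S.Exact := by
  rw [ShortComplex.exact_iff_epi_kernel_lift]
  let κ : S.X₁ ⟶ kernel S.g := kernel.lift S.g S.f S.zero
  have hκ : κ ≫ kernel.ι S.g = S.f := kernel.lift_ι _ _ _
  refine (TopCat.Sheaf.isLocallySurjective_iff_epi κ).mp ?_
  refine (TopCat.Presheaf.isLocallySurjective_iff κ.hom).mpr fun U c x hx => ?_
  have h0 : secMap S.g U (secMap (kernel.ι S.g) U c) = 0 := by
    rw [← secMap_comp, kernel.condition, secMap_zero]
  obtain ⟨V, hV, t, hxV, ht⟩ := h U _ h0 x hx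
  refine ⟨V, hV, ⟨t, ?_⟩, hxV⟩
  refine secMap_injective_of_mono (kernel.ι S.g) V ?_
  refine Eq.trans (b := secMap (κ ≫ kernel.ι S.g) V t) rfl ?_
  rw [hκ, ht]
  exact secRes_secMap (kernel.ι S.g) hV c

/-- A morphism of sheaves that is injective on sections is a monomorphism. -/
theorem mono_of_secMap_injective {A B : TopCat.Sheaf AddCommGrpCat.{u} X} (f : A ⟶ B)
    (h : ∀ U, Function.Injective (secMap f U)) : Mono f := by
  refine ⟨fun {Z} a b hab => ?_⟩
  apply CategoryTheory.ObjectProperty.hom_ext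
  ext U s
  exact h U.unop (congrArg (fun g => secMap g U.unop s) hab)

/-- The space `Ω`, seen as a space of sections of the family of vector spaces `T`, consists of all
the sections that agree locally with elements of `Ω`, and is a module over enough functions to
cut off sections. -/
structure SectionSpace (T : X → Type u) [∀ x, AddCommGroup (T x)] [∀ x, Module ℝ (T x)]
    (Ω : Type*) [AddCommGroup Ω] [Module ℝ Ω] where
  /-- The value of a section at a point. -/
  ev : ∀ x, Ω →ₗ[ℝ] T x
  ext : ∀ g, (∀ x, ev x g = 0) → g = 0
  glue : ∀ s : ∀ x, T x, (∀ x, ∃ g, ∀ᶠ y in 𝓝 x, ev y g = s y) → ∃ g, ∀ x, ev x g = s x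
  cutoff : ∀ K U : Set X, IsCompact K → IsOpen U → K ⊆ U → ∃ ρ : X → ℝ,
    (∀ᶠ x in 𝓝ˢ K, ρ x = 1) ∧ (∀ x ∉ U, ∀ᶠ y in 𝓝 x, ρ y = 0) ∧
      ∀ g, ∃ g', ∀ x, ev x g' = ρ x • ev x g

theorem eventually_nhds_coe {U : Opens X} (x : U) (P : X → Prop) :
    (∀ᶠ y : U in 𝓝 x, P y) ↔ ∀ᶠ y in 𝓝 x.1, P y := by
  rw [← U.isOpenEmbedding'.map_nhds_eq x, Filter.eventually_map]

namespace SectionSpace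

variable {T : X → Type u} [∀ x, AddCommGroup (T x)] [∀ x, Module ℝ (T x)]
  {Ω : Type*} [AddCommGroup Ω] [Module ℝ Ω] (S : SectionSpace T Ω)

/-- The sections that agree locally with elements of `Ω`. -/
def germs : LinearLocalPredicate T where
  pred {U} s := ∀ x : U, ∃ g, ∀ᶠ y : U in 𝓝 x, S.ev y.1 g = s y
  res {U U'} i s hs x := by
    obtain ⟨g, hg⟩ := hs ⟨x.1, i.le x.2⟩
    exact ⟨g, (eventually_nhds_opens i.le x (fun y => S.ev y.1 g = s y)).1 hg⟩
  locality {U} s hs x := by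
    obtain ⟨U', hx, i, h⟩ := hs x
    obtain ⟨g, hg⟩ := h ⟨x, hx⟩
    exact ⟨g, (eventually_nhds_opens i.le ⟨x.1, hx⟩ (fun y => S.ev y.1 g = s y)).2 hg⟩
  zero_mem U x := ⟨0, Filter.Eventually.of_forall fun _ => map_zero _⟩
  add_mem U s s' hs hs' x := by
    obtain ⟨g, hg⟩ := hs x
    obtain ⟨g', hg'⟩ := hs' x
    refine ⟨g + g', ?_⟩
    filter_upwards [hg, hg'] with y hy hy'
    rw [map_add, hy, hy']
  smul_mem U c s hs x := by
    obtain ⟨g, hg⟩ := hs x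
    refine ⟨c • g, ?_⟩
    filter_upwards [hg] with y hy
    rw [map_smul, hy]

/-- An element of `Ω` as a global section. -/
def toGlobal : Ω →+ Sec S.germs.sheaf ⊤ where
  toFun g := ⟨fun x => S.ev x.1 g, fun _ => ⟨g, Filter.Eventually.of_forall fun _ => rfl⟩⟩
  map_zero' := Subtype.ext (funext fun x => map_zero (S.ev x.1))
  map_add' g g' := Subtype.ext (funext fun x => map_add (S.ev x.1) g g')

theorem toGlobal_injective : Function.Injective S.toGlobal := by
  refine (injective_iff_map_eq_zero _).2 fun g hg => S.ext g fun x => ?_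
  exact congrFun (congrArg Subtype.val hg) ⟨x, trivial⟩

theorem exists_of_eventually_opens {U : Opens X} (s : Sec S.germs.sheaf U) (x : X) (hx : x ∈ U) :
    ∃ g, ∀ᶠ y in 𝓝 x, ∀ hy : y ∈ U, S.ev y g = s.1 ⟨y, hy⟩ := by
  obtain ⟨g, hg⟩ := s.2 ⟨x, hx⟩
  refine ⟨g, (eventually_nhds_coe ⟨x, hx⟩ _).1 ?_⟩
  filter_upwards [hg] with y hy _
  exact hy

/-- Together with `toGlobal_injective`: the global sections of the sheaf `S.germs` are the elements
of `Ω`. -/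
theorem toGlobal_surjective : Function.Surjective S.toGlobal := by
  intro s
  obtain ⟨g, hg⟩ := S.glue (fun x => s.1 ⟨x, trivial⟩) fun x => by
    obtain ⟨g, hg⟩ := S.exists_of_eventually_opens s x trivial
    exact ⟨g, hg.mono fun y hy => hy trivial⟩
  exact ⟨g, Subtype.ext (funext fun x => hg x.1)⟩

open scoped Classical in
/-- The sheaf of sections that agree locally with elements of `Ω` is soft: multiply a section over a
neighbourhood of a compact set by a cutoff function and extend it by zero. -/
theorem isSoft_germs : IsSoft S.germs.sheaf := by
  intro K U hK hKU s
  obtain ⟨ρ, h1, h0, hρ⟩ := S.cutoff K U hK U.isOpen hKU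
  obtain ⟨t, ht⟩ := S.glue (fun x => if hx : x ∈ U then ρ x • s.1 ⟨x, hx⟩ else 0) fun x => by
    by_cases hx : x ∈ U
    · obtain ⟨g, hg⟩ := S.exists_of_eventually_opens s x hx
      obtain ⟨g', hg'⟩ := hρ g
      refine ⟨g', ?_⟩
      filter_upwards [hg, U.isOpen.mem_nhds hx] with y hy hyU
      rw [hg', hy hyU, dif_pos (show y ∈ U from hyU)]
    · refine ⟨0, ?_⟩
      filter_upwards [h0 x hx] with y hy
      rw [hy, map_zero]
      split_ifs <;> simp
  obtain ⟨N, hN, hKN, hN1⟩ := mem_nhdsSet_iff_exists.1 h1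
  refine ⟨S.toGlobal t, ⟨N, hN⟩ ⊓ U, inf_le_right, Set.subset_inter hKN hKU, ?_⟩
  refine Subtype.ext (funext fun x => ?_)
  change S.ev x.1 t = s.1 ⟨x.1, x.2.2⟩
  have : ρ x.1 = 1 := hN1 x.2.1
  rw [ht, dif_pos (show x.1 ∈ U from x.2.2), this, one_smul]

variable {T' : X → Type u} [∀ x, AddCommGroup (T' x)] [∀ x, Module ℝ (T' x)]
  {Ω' : Type*} [AddCommGroup Ω'] [Module ℝ Ω'] (S' : SectionSpace T' Ω')

/-- A linear map between spaces of sections is a local operator if it does not increase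
supports. -/
def IsLocalOperator (d : Ω →ₗ[ℝ] Ω') : Prop :=
  ∀ g x, (∀ᶠ y in 𝓝 x, S.ev y g = 0) → S'.ev x (d g) = 0

variable {S S'} {d : Ω →ₗ[ℝ] Ω'}

theorem IsLocalOperator.eq_of_eventually (hd : IsLocalOperator S S' d) {g g' : Ω} {x : X}
    (h : ∀ᶠ y in 𝓝 x, S.ev y g = S.ev y g') : S'.ev x (d g) = S'.ev x (d g') := by
  rw [← sub_eq_zero, ← map_sub, ← map_sub]
  refine hd _ _ (h.mono fun y hy => ?_)
  rw [map_sub, hy, sub_self]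

/-- The action of a local operator on the sections over an open set. -/
noncomputable def IsLocalOperator.onSections (_ : IsLocalOperator S S' d) {U : Opens X}
    (s : S.germs.sections U) (x : U) : T' x.1 :=
  S'.ev x.1 (d (s.2 x).choose)

theorem IsLocalOperator.onSections_eq (hd : IsLocalOperator S S' d) {U : Opens X}
    (s : S.germs.sections U) (x : U) (g : Ω) (hg : ∀ᶠ y : U in 𝓝 x, S.ev y.1 g = s.1 y) :
    hd.onSections s x = S'.ev x.1 (d g) := by
  refine hd.eq_of_eventually ?_
  rw [← eventually_nhds_coe x]
  filter_upwards [hg, (s.2 x).choose_spec] with y hy hy'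
  rw [hy, hy']

theorem IsLocalOperator.eventually_onSections_eq (hd : IsLocalOperator S S' d) {U : Opens X}
    (s : S.germs.sections U) (x : U) (g : Ω) (hg : ∀ᶠ y : U in 𝓝 x, S.ev y.1 g = s.1 y) :
    ∀ᶠ y : U in 𝓝 x, S'.ev y.1 (d g) = hd.onSections s y := by
  filter_upwards [hg.eventually_nhds] with y hy
  exact (hd.onSections_eq s y g hy).symm

/-- The morphism of sheaves given by a local operator. -/
noncomputable def IsLocalOperator.sheafMap (hd : IsLocalOperator S S' d) :
    S.germs.sheaf ⟶ S'.germs.sheaf :=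
  CategoryTheory.ObjectProperty.homMk
    { app := fun U => AddCommGrpCat.ofHom (AddMonoidHom.mk'
        (fun s : S.germs.sections U.unop => (⟨hd.onSections s, fun x =>
          ⟨_, hd.eventually_onSections_eq s x _ (s.2 x).choose_spec⟩⟩ : S'.germs.sections U.unop))
        fun s t => Subtype.ext (funext fun x => by
          obtain ⟨g, hg⟩ := s.2 x
          obtain ⟨g', hg'⟩ := t.2 x
          change hd.onSections (s + t) x = hd.onSections s x + hd.onSections t x
          rw [hd.onSections_eq s x g hg, hd.onSections_eq t x g' hg',
            hd.onSections_eq (s + t) x (g + g') ?_, map_add, map_add]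
          filter_upwards [hg, hg'] with y hy hy'
          rw [map_add, hy, hy']
          rfl))
      naturality := fun U V i => by
        ext s
        refine Subtype.ext (funext fun x => ?_)
        obtain ⟨g, hg⟩ := s.2 ⟨x.1, i.unop.le x.2⟩
        refine (hd.onSections_eq _ x g ?_).trans (hd.onSections_eq s _ g hg).symm
        exact (eventually_nhds_opens i.unop.le x (fun y => S.ev y.1 g = s.1 y)).1 hg }

theorem IsLocalOperator.secMap_sheafMap_eq (hd : IsLocalOperator S S' d) {U : Opens X}
    (s : Sec S.germs.sheaf U) (x : U) (g : Ω) (hg : ∀ᶠ y : U in 𝓝 x, S.ev y.1 g = s.1 y) :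
    (secMap hd.sheafMap U s).1 x = S'.ev x.1 (d g) :=
  hd.onSections_eq s x g hg

theorem IsLocalOperator.secMap_toGlobal (hd : IsLocalOperator S S' d) (g : Ω) :
    secMap hd.sheafMap ⊤ (S.toGlobal g) = S'.toGlobal (d g) :=
  Subtype.ext (funext fun x =>
    hd.onSections_eq (S.toGlobal g) x g (Filter.Eventually.of_forall fun _ => rfl))

end SectionSpace

end LocalOperators

/-! ### Cohomology of a sheaf resolved by local operators -/

section LocalResolution

open Limits

variable {X : TopCat.{u}} {T : ℕ → X → Type u} [∀ n x, AddCommGroup (T n x)]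
  [∀ n x, Module ℝ (T n x)] {Ω : ℕ → Type*} [∀ n, AddCommGroup (Ω n)] [∀ n, Module ℝ (Ω n)]
  {T' : X → Type u} [∀ x, AddCommGroup (T' x)] [∀ x, Module ℝ (T' x)]

/-- A resolution of the sheaf given by `P` by a complex of local operators
`d : Ω⁰ ⟶ Ω¹ ⟶ ⋯` that is locally exact in positive degrees, and whose local solutions of `d g = 0`
in degree `0` are the sections satisfying `P`. -/
structure LocalResolution (S : ∀ n, SectionSpace (T n) (Ω n)) (d : ∀ n, Ω n →ₗ[ℝ] Ω (n + 1))
    (P : LinearLocalPredicate T') where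
  local_d : ∀ n, SectionSpace.IsLocalOperator (S n) (S (n + 1)) (d n)
  d_d : ∀ n g, d (n + 1) (d n g) = 0
  exact : ∀ n g x, (∀ᶠ y in 𝓝 x, (S (n + 2)).ev y (d (n + 1) g) = 0) →
    ∃ h, ∀ᶠ y in 𝓝 x, (S (n + 1)).ev y (d n h) = (S (n + 1)).ev y g
  /-- The identification of the coefficients in degree `0`. -/
  j : ∀ x, T' x ≃ₗ[ℝ] T 0 x
  pred_iff : ∀ (U : Opens X) (s : ∀ x : U, T' x), P.pred s ↔ ∀ x : U, ∃ g,
    (∀ᶠ y : U in 𝓝 x, (S 0).ev y.1 g = j y.1 (s y)) ∧ ∀ᶠ y in 𝓝 x.1, (S 1).ev y (d 0 g) = 0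

namespace LocalResolution

variable {S : ∀ n, SectionSpace (T n) (Ω n)} {d : ∀ n, Ω n →ₗ[ℝ] Ω (n + 1)}
  {P : LinearLocalPredicate T'} (L : LocalResolution S d P)

/-- The differentials as morphisms of sheaves. -/
noncomputable abbrev diff (n : ℕ) : (S n).germs.sheaf ⟶ (S (n + 1)).germs.sheaf :=
  (L.local_d n).sheafMap

theorem diff_comp_diff (n : ℕ) : L.diff n ≫ L.diff (n + 1) = 0 := by
  apply CategoryTheory.ObjectProperty.hom_ext
  ext U s
  refine Subtype.ext (funext fun x => ?_)
  change (secMap (L.diff (n + 1)) U.unop (secMap (L.diff n) U.unop s)).1 x = 0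
  obtain ⟨g, hg⟩ := Subtype.property s x
  rw [(L.local_d (n + 1)).secMap_sheafMap_eq _ x (d n g), L.d_d, map_zero]
  exact (L.local_d n).eventually_onSections_eq _ x g hg

/-- The augmentation. -/
noncomputable def augmentation : P.sheaf ⟶ (S 0).germs.sheaf :=
  CategoryTheory.ObjectProperty.homMk
    { app := fun U => AddCommGrpCat.ofHom (AddMonoidHom.mk'
        (fun s : P.sections U.unop => (⟨fun x => L.j x.1 (s.1 x), fun x => by
          obtain ⟨g, hg, -⟩ := (L.pred_iff _ _).1 s.2 x
          exact ⟨g, hg⟩⟩ : (S 0).germs.sections U.unop))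
        fun s t => Subtype.ext (funext fun x => map_add (L.j x.1) (s.1 x) (t.1 x)))
      naturality := fun _ _ _ => rfl }

theorem augmentation_comp_diff : L.augmentation ≫ L.diff 0 = 0 := by
  apply CategoryTheory.ObjectProperty.hom_ext
  ext U s
  refine Subtype.ext (funext fun x => ?_)
  obtain ⟨g, hg, h0⟩ := (L.pred_iff _ _).1 (Subtype.property s) x
  refine Eq.trans ((L.local_d 0).secMap_sheafMap_eq
    (secMap L.augmentation U.unop s) x g hg) h0.self_of_nhds

instance : Mono L.augmentation := by
  refine mono_of_secMap_injective _ fun U s t h => ?_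
  refine Subtype.ext (funext fun x => (L.j x.1).injective ?_)
  exact congrFun (congrArg Subtype.val h) x

/-- A local representative of a section killed by the differential is closed near the point. -/
theorem eventually_diff_eq_zero {n : ℕ} {U : Opens X} {s : Sec (S n).germs.sheaf U}
    (h : secMap (L.diff n) U s = 0) (x : U) (g : Ω n)
    (hg : ∀ᶠ y : U in 𝓝 x, (S n).ev y.1 g = s.1 y) :
    ∀ᶠ y in 𝓝 x.1, (S (n + 1)).ev y (d n g) = 0 := by
  rw [← eventually_nhds_coe x]
  filter_upwards [(L.local_d n).eventually_onSections_eq s x g hg] with y hy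
  exact hy.trans (congrFun (congrArg Subtype.val h) y)

theorem augmentation_exact :
    (ShortComplex.mk L.augmentation (L.diff 0) L.augmentation_comp_diff).Exact := by
  refine exact_of_exists_lift _ fun U s hs x hx => ⟨U, le_rfl,
    ⟨fun y => (L.j y.1).symm (s.1 y), (L.pred_iff _ _).2 fun y => ?_⟩, hx, ?_⟩
  · obtain ⟨g, hg⟩ := s.2 y
    refine ⟨g, ?_, L.eventually_diff_eq_zero hs y g hg⟩
    filter_upwards [hg] with z hz
    rw [LinearEquiv.apply_symm_apply, hz]
  · refine Subtype.ext (funext fun y => ?_)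
    exact (L.j y.1).apply_symm_apply (s.1 y)

theorem diff_exact (n : ℕ) :
    (ShortComplex.mk (L.diff n) (L.diff (n + 1)) (L.diff_comp_diff n)).Exact := by
  refine exact_of_exists_lift _ fun U s hs x hx => ?_
  obtain ⟨g, hg⟩ := s.2 ⟨x, hx⟩
  obtain ⟨h, hh⟩ := L.exact n g x (L.eventually_diff_eq_zero hs ⟨x, hx⟩ g hg)
  have h1 : ∀ᶠ y : U in 𝓝 ⟨x, hx⟩, (S (n + 1)).ev y.1 (d n h) = s.1 y := by
    filter_upwards [hg, (eventually_nhds_coe (U := U) ⟨x, hx⟩ _).2 hh] with y hy hy'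
    rw [hy', hy]
  rw [eventually_nhds_iff] at h1
  obtain ⟨N, hN, hNo, hxN⟩ := h1
  let V : Opens X := ⟨Subtype.val '' N, U.isOpen.isOpenMap_subtype_val N hNo⟩
  have hV : V ≤ U := by
    rintro _ ⟨y, -, rfl⟩
    exact y.2
  refine ⟨V, hV, ⟨fun y => (S n).ev y.1 h, fun y => ⟨h, Filter.Eventually.of_forall fun _ => rfl⟩⟩,
    ⟨⟨x, hx⟩, hxN, rfl⟩, ?_⟩
  refine Subtype.ext (funext fun y => ?_)
  obtain ⟨y, ⟨z, hz, rfl⟩⟩ := y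
  refine ((L.local_d n).secMap_sheafMap_eq _ _ h
    (Filter.Eventually.of_forall fun _ => rfl)).trans ?_
  exact hN z hz

/-- The differentials commute with multiplication by a scalar. Together with
`augmentation_comp_scalar` this makes the comparison of cohomology groups linear. -/
theorem scalar_comp_diff (c : ℝ) (n : ℕ) :
    (S n).germs.scalar c ≫ L.diff n = L.diff n ≫ (S (n + 1)).germs.scalar c := by
  apply CategoryTheory.ObjectProperty.hom_ext
  ext U s
  refine Subtype.ext (funext fun x => ?_)
  obtain ⟨g, hg⟩ := Subtype.property s x
  refine ((L.local_d n).secMap_sheafMap_eq _ x (c • g) ?_).trans ?_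
  · filter_upwards [hg] with y hy
    rw [map_smul, hy]
    rfl
  · rw [map_smul, map_smul]
    exact congrArg (c • ·) ((L.local_d n).secMap_sheafMap_eq s x g hg).symm

theorem augmentation_comp_scalar (c : ℝ) :
    L.augmentation ≫ (S 0).germs.scalar c = P.scalar c ≫ L.augmentation := by
  apply CategoryTheory.ObjectProperty.hom_ext
  ext U s
  exact Subtype.ext (funext fun x => (map_smul (L.j x.1) c _).symm)

/-- The boundaries in degree `n` of the subcomplex `A`. -/
def boundaries (d : ∀ n, Ω n →ₗ[ℝ] Ω (n + 1)) (A : ∀ n, Submodule ℝ (Ω n)) :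
    ∀ n, Submodule ℝ (Ω n)
  | 0 => ⊥
  | n + 1 => (A n).map (d n)

include L in
/-- If `Φ(B)` is, naturally in `B`, a group of global sections of `B`, then the functors that are
computed by `Φ` are given at the sheaf `P` by the cohomology of the complex of those elements of
`Ω` that belong to `Φ`. -/
theorem exists_linear_cls [LocallyCompactSpace X] [SecondCountableTopology X] [T2Space X]
    {Φ R : TopCat.Sheaf AddCommGrpCat.{u} X ⥤ AddCommGrpCat.{u}} [Φ.Additive] [R.Additive]
    (hΦ : IsAdapted Φ (IsSoft (X := X))) {n : ℕ} (hR : ComputedBy Φ R n)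
    (θ : ∀ B, Φ.obj B →+ Sec B ⊤) (hθ : ∀ B, Function.Injective (θ B))
    (hnat : ∀ {B B'} (f : B ⟶ B') (x : Φ.obj B), θ B' ((Φ.map f).hom x) = secMap f ⊤ (θ B x))
    (A : ∀ n, Submodule ℝ (Ω n))
    (hA : ∀ n g, g ∈ A n ↔ ∃ x : Φ.obj (S n).germs.sheaf, θ _ x = (S n).toGlobal g) :
    ∃ cls : ↥(A n ⊓ LinearMap.ker (d n)) →ₗ[ℝ] P.Value R,
      Function.Surjective cls ∧ ∀ y, cls y = 0 ↔ y.1 ∈ boundaries d A n := by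
  obtain ⟨cls, hsurj, hker, hscal⟩ := hΦ.exists_cls_of_exact hR (fun n => (S n).germs.sheaf) L.diff
    L.diff_comp_diff L.augmentation inferInstance L.augmentation_comp_diff L.augmentation_exact
    L.diff_exact fun n => (S n).isSoft_germs
  have hd : ∀ (m : ℕ) (x : Φ.obj (S m).germs.sheaf) (g : Ω m), θ _ x = (S m).toGlobal g →
      θ _ ((Φ.map (L.diff m)).hom x) = (S (m + 1)).toGlobal (d m g) := fun m x g h =>
    (hnat _ x).trans ((congrArg _ h).trans ((L.local_d m).secMap_toGlobal g))
  choose e he using fun (m : ℕ) (g : A m) => (hA m g).1 g.2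
  have hcyc : ∀ y : ↥(A n ⊓ LinearMap.ker (d n)),
      (Φ.map (L.diff n)).hom (e n ⟨y.1, y.2.1⟩) = 0 := by
    intro y
    refine hθ _ ((hd n _ y.1 (he n ⟨y.1, y.2.1⟩)).trans ?_)
    rw [map_zero, (show d n y.1 = 0 from y.2.2), map_zero]
  refine ⟨⟨⟨fun y => cls ⟨e n ⟨y.1, y.2.1⟩, hcyc y⟩, fun y y' => ?_⟩, fun c y => ?_⟩,
    fun r => ?_, fun y => ?_⟩
  · refine Eq.trans (congrArg cls (Subtype.ext (hθ _ ?_))) (map_add cls _ _)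
    refine (he n _).trans ?_
    rw [AddSubgroup.coe_add, map_add]
    exact (map_add (S n).toGlobal y.1 y'.1).trans
      (congrArg₂ (· + ·) (he n ⟨y.1, y.2.1⟩) (he n ⟨y'.1, y'.2.1⟩)).symm
  · refine (hscal (P.scalar c) (fun n => (S n).germs.scalar c) (L.scalar_comp_diff c)
      (L.augmentation_comp_scalar c) _ _ ?_).symm
    refine hθ _ ((he n _).trans ?_)
    refine Eq.trans ?_ (hnat _ _).symm
    refine Eq.trans ?_ (congrArg (secMap ((S n).germs.scalar c) ⊤) (he n ⟨y.1, y.2.1⟩)).symm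
    exact Subtype.ext (funext fun x => map_smul ((S n).ev x.1) c y.1)
  · obtain ⟨⟨z, hz⟩, rfl⟩ := hsurj r
    obtain ⟨g, hg⟩ := (S n).toGlobal_surjective (θ _ z)
    have hgA : g ∈ A n := (hA n g).2 ⟨z, hg.symm⟩
    have hgd : d n g = 0 := by
      refine (S (n + 1)).toGlobal_injective ((hd n z g hg.symm).symm.trans ?_)
      rw [show (Φ.map (L.diff n)).hom z = 0 from hz, map_zero, map_zero]
    refine ⟨⟨g, hgA, hgd⟩, congrArg cls (Subtype.ext (hθ _ ?_))⟩
    exact (he n ⟨g, hgA⟩).trans hg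
  · refine (hker _).trans ?_
    change e n ⟨y.1, y.2.1⟩ ∈ _ ↔ _
    have hy := he n ⟨y.1, y.2.1⟩
    generalize e n ⟨y.1, y.2.1⟩ = z at hy
    change θ _ z = (S n).toGlobal y.1 at hy
    cases n with
    | zero =>
      change z = 0 ↔ y.1 = 0
      rw [← map_eq_zero_iff _ (hθ _), hy, map_eq_zero_iff _ (S 0).toGlobal_injective]
    | succ n =>
      constructor
      · rintro ⟨w, hw⟩
        obtain ⟨g, hg⟩ := (S n).toGlobal_surjective (θ _ w)
        refine ⟨g, (hA n g).2 ⟨w, hg.symm⟩, (S (n + 1)).toGlobal_injective ?_⟩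
        rw [← hd n w g hg.symm, ← hy]
        exact congrArg _ hw
      · rintro ⟨g, hgA, hg⟩
        refine ⟨e n ⟨g, hgA⟩, hθ _ ?_⟩
        refine (hd n _ g (he n ⟨g, hgA⟩)).trans ?_
        rw [hg]
        exact hy.symm

variable [LocallyCompactSpace X] [SecondCountableTopology X] [T2Space X]
include L

/-- Sheaf cohomology is the cohomology of the complex `Ω`. -/
theorem exists_sheafCohomology_cls (n : ℕ) :
    ∃ cls : ↥((⊤ : Submodule ℝ (Ω n)) ⊓ LinearMap.ker (d n)) →ₗ[ℝ]
        P.Value (sheafCohomology X n),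
      Function.Surjective cls ∧ ∀ y, cls y = 0 ↔ y.1 ∈ boundaries d (fun _ => ⊤) n :=
  L.exists_linear_cls (isAdapted_globalSections (X := X)) (computedBy_sheafCohomology X n)
    (fun B => AddMonoidHom.id (Sec B ⊤)) (fun _ => Function.injective_id) (fun _ _ => rfl)
    (fun _ => ⊤) fun n g => ⟨fun _ => ⟨(S n).toGlobal g, rfl⟩, fun _ => trivial⟩

/-- Sheaf cohomology with compact support is the cohomology of the subcomplex of compactly supported
elements of `Ω`. -/
theorem exists_compactSheafCohomology_cls (A : ∀ n, Submodule ℝ (Ω n))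
    (hA : ∀ n g, g ∈ A n ↔ ∃ K : Set X, IsCompact K ∧ ∀ x ∉ K, (S n).ev x g = 0) (n : ℕ) :
    ∃ cls : ↥(A n ⊓ LinearMap.ker (d n)) →ₗ[ℝ] P.Value (compactSheafCohomology X n),
      Function.Surjective cls ∧ ∀ y, cls y = 0 ↔ y.1 ∈ boundaries d A n := by
  refine L.exists_linear_cls (R := compactSheafCohomology X n) (isAdapted_compactSections (X := X))
    (computedBy_rightDerived (compactSections X) n)
    (fun B => (compactSectionsSubgroup B).subtype) (fun _ => Subtype.val_injective)
    (fun _ _ => rfl) A fun n g => (hA n g).trans ⟨?_, ?_⟩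
  · rintro ⟨K, hK, h⟩
    refine ⟨⟨(S n).toGlobal g, ⟨Kᶜ, hK.isClosed.isOpen_compl⟩, ?_, ?_⟩, rfl⟩
    · rwa [Opens.coe_mk, compl_compl]
    · exact Subtype.ext (funext fun x => h x.1 x.2)
  · rintro ⟨⟨s, U, hU, hs⟩, rfl⟩
    exact ⟨_, hU, fun x hx => congrFun (congrArg Subtype.val hs) ⟨x, not_not.1 hx⟩⟩

end LocalResolution

end LocalResolution

/-! ### The Banach space of continuous curves -/

section Curves

open Set

/-- The unit interval, as an index space for curves. -/
local notation "𝕀" => Icc (0 : ℝ) 1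

/-- The space of continuous curves `[0, 1] → G`. (A copy of `C([0, 1], G)` that carries only the
topology of its norm.) -/
def Curve (G : Type*) [NormedAddCommGroup G] : Type _ := C(𝕀, G)

instance {G : Type*} [NormedAddCommGroup G] : FunLike (Curve G) 𝕀 G :=
  inferInstanceAs (FunLike C(𝕀, G) 𝕀 G)

variable {Λ G : Type*} [NormedAddCommGroup Λ] [NormedSpace ℝ Λ] [NormedAddCommGroup G]
  [NormedSpace ℝ G]

noncomputable instance : NormedAddCommGroup (Curve G) :=
  inferInstanceAs (NormedAddCommGroup C(𝕀, G))

noncomputable instance : NormedSpace ℝ (Curve G) := inferInstanceAs (NormedSpace ℝ C(𝕀, G))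

instance [CompleteSpace G] : CompleteSpace (Curve G) := inferInstanceAs (CompleteSpace C(𝕀, G))

namespace Curve

/-- The curve given by a continuous function. -/
def mk (u : 𝕀 → G) (hu : Continuous u) : Curve G := (⟨u, hu⟩ : C(𝕀, G))

omit [NormedSpace ℝ G] in
@[fun_prop]
theorem continuous (u : Curve G) : Continuous u := ContinuousMap.continuous (u : C(𝕀, G))

omit [NormedSpace ℝ G] in
theorem ext {u v : Curve G} (h : ∀ t, u t = v t) : u = v := DFunLike.ext _ _ h

omit [NormedSpace ℝ G] in
theorem norm_le {u : Curve G} {c : ℝ} (hc : 0 ≤ c) : ‖u‖ ≤ c ↔ ∀ t, ‖u t‖ ≤ c :=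
  ContinuousMap.norm_le (u : C(𝕀, G)) hc

omit [NormedSpace ℝ G] in
theorem norm_coe_le_norm (u : Curve G) (t : 𝕀) : ‖u t‖ ≤ ‖u‖ :=
  ContinuousMap.norm_coe_le_norm (u : C(𝕀, G)) t

omit [NormedSpace ℝ G] in
theorem add_apply (u v : Curve G) (t : 𝕀) : (u + v) t = u t + v t := rfl

omit [NormedSpace ℝ G] in
theorem sub_apply (u v : Curve G) (t : 𝕀) : (u - v) t = u t - v t := rfl

variable (G) in
/-- The value of a curve at a point. -/
noncomputable def evalCLM (t : 𝕀) : Curve G →L[ℝ] G :=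
  LinearMap.mkContinuous ⟨⟨fun u => u t, fun _ _ => rfl⟩, fun _ _ => rfl⟩ 1 fun u => by
    rw [one_mul]
    exact u.norm_coe_le_norm t

variable (Λ G) in
/-- A curve of linear maps as a linear map to curves. -/
noncomputable def flip : Curve (Λ →L[ℝ] G) →L[ℝ] Λ →L[ℝ] Curve G :=
  LinearMap.mkContinuous₂ (LinearMap.mk₂ ℝ
    (fun (φ : Curve (Λ →L[ℝ] G)) (v : Λ) => mk (fun t => φ t v) (by fun_prop))
    (fun _ _ _ => rfl) (fun _ _ _ => rfl) (fun φ v w => ext fun t => (φ t).map_add v w)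
    (fun c φ v => ext fun t => (φ t).map_smul c v)) 1 fun φ v => by
      rw [one_mul, norm_le (by positivity)]
      exact fun t => ((φ t).le_opNorm v).trans
        (mul_le_mul_of_nonneg_right (φ.norm_coe_le_norm t) (norm_nonneg v))

theorem flip_apply (φ : Curve (Λ →L[ℝ] G)) (v : Λ) (t : 𝕀) : flip Λ G φ v t = φ t v := rfl

/-- A family of curves that is jointly `C¹` is a differentiable family of points of the Banach
space of curves. -/
theorem hasFDerivAt_of_hasFDerivAt {F : Λ → Curve G} {f : Λ → 𝕀 → G} (hF : ∀ l t, F l t = f l t)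
    {F' : Λ → Curve (Λ →L[ℝ] G)} (hF' : Continuous F')
    (h : ∀ l t, HasFDerivAt (fun l => f l t) (F' l t) l) (l : Λ) :
    HasFDerivAt F (flip Λ G (F' l)) l := by
  rw [hasFDerivAt_iff_isLittleO, Asymptotics.isLittleO_iff]
  intro ε hε
  obtain ⟨δ, hδ, hF'δ⟩ := Metric.continuous_iff.1 hF' l ε hε
  filter_upwards [Metric.ball_mem_nhds l hδ] with m hm
  rw [norm_le (by positivity)]
  intro t
  have := (convex_ball l δ).norm_image_sub_le_of_norm_hasFDerivWithin_le' (φ := F' l t)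
    (C := ε) (fun x _ => (h x t).hasFDerivWithinAt) (fun x hx => ?_) (Metric.mem_ball_self hδ) hm
  · simpa only [sub_apply, hF, flip_apply] using this
  · rw [← sub_apply]
    exact ((F' x - F' l).norm_coe_le_norm t).trans (dist_eq_norm (F' x) (F' l) ▸ (hF'δ x hx).le)

omit [NormedSpace ℝ Λ] [NormedSpace ℝ G] in
theorem continuous_family {F : Λ → Curve G} {f : Λ × ℝ → G}
    (hF : ∀ l (t : 𝕀), F l t = f (l, t)) (hf : Continuous f) : Continuous F := by
  refine ContinuousMap.continuous_of_continuous_uncurry (X := Λ) (Y := 𝕀) (Z := G) F ?_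
  have h : Function.uncurry (fun x y => F x y) = fun z : Λ × 𝕀 => f (z.1, (z.2 : ℝ)) := by
    ext1 z
    exact hF z.1 z.2
  change Continuous (Function.uncurry (fun x y => F x y))
  rw [h]
  fun_prop

/-- The derivative in the parameter of a family of curves. -/
noncomputable def paramDeriv (f : Λ × ℝ → G) (z : Λ × ℝ) : Λ →L[ℝ] G :=
  (fderiv ℝ f z).comp (.inl ℝ Λ ℝ)

theorem contDiff_paramDeriv {f : Λ × ℝ → G} {m n : ℕ∞ω} (hf : ContDiff ℝ n f) (hm : m + 1 ≤ n) :
    ContDiff ℝ m (paramDeriv f) :=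
  (hf.fderiv_right hm).clm_comp contDiff_const

theorem hasFDerivAt_paramDeriv {f : Λ × ℝ → G} (hf : ContDiff ℝ 1 f) (l : Λ) (t : ℝ) :
    HasFDerivAt (fun l => f (l, t)) (paramDeriv f (l, t)) l :=
  ((hf.differentiable (by simp)) (l, t)).hasFDerivAt.comp l (hasFDerivAt_prodMk_left l t)

/-- The derivative in the parameter of a smooth family of curves, as a curve. -/
noncomputable def deriv {f : Λ × ℝ → G} (hf : ContDiff ℝ 1 f) (l : Λ) : Curve (Λ →L[ℝ] G) :=
  mk (fun t => paramDeriv f (l, t)) (by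
    have := (contDiff_paramDeriv (m := 0) hf (by simp)).continuous
    fun_prop)

theorem deriv_apply {f : Λ × ℝ → G} (hf : ContDiff ℝ 1 f) (l : Λ) (t : 𝕀) :
    deriv hf l t = paramDeriv f (l, t) := rfl

theorem hasFDerivAt_family {F : Λ → Curve G} {f : Λ × ℝ → G}
    (hF : ∀ l (t : 𝕀), F l t = f (l, t)) (hf : ContDiff ℝ 1 f) (l : Λ) :
    HasFDerivAt F (flip Λ G (deriv hf l)) l :=
  hasFDerivAt_of_hasFDerivAt (f := fun l t => f (l, t)) hF
    (continuous_family (f := paramDeriv f) (fun _ _ => rfl)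
      (contDiff_paramDeriv (m := 0) hf (by simp)).continuous)
    (fun l t => hasFDerivAt_paramDeriv hf l t) l

universe v

/-- A jointly smooth family of curves is a smooth family of points of the Banach space of
curves. -/
theorem contDiff_family {Λ : Type} [NormedAddCommGroup Λ] [NormedSpace ℝ Λ] {G : Type v}
    [NormedAddCommGroup G] [NormedSpace ℝ G] {F : Λ → Curve G} {f : Λ × ℝ → G}
    (hF : ∀ l (t : 𝕀), F l t = f (l, t)) (hf : ContDiff ℝ ∞ f) : ContDiff ℝ ∞ F := by
  rw [contDiff_infty]
  intro n
  induction n generalizing G with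
  | zero => exact contDiff_zero.2 (continuous_family hF hf.continuous)
  | succ n ih =>
    have hf1 : ContDiff ℝ 1 f := hf.of_le (by simp)
    exact contDiff_succ_iff_hasFDerivAt.2 ⟨fun l => flip Λ G (deriv hf1 l),
      (flip Λ G).contDiff.comp (ih (F := fun l => deriv hf1 l) (f := paramDeriv f)
        (fun _ _ => rfl) (contDiff_paramDeriv hf (by simp))), hasFDerivAt_family hF hf1⟩

/-- The extension of a curve by constants. -/
noncomputable abbrev extend (u : Curve G) : ℝ → G := IccExtend zero_le_one u

omit [NormedSpace ℝ G] in
theorem continuous_extend (u : Curve G) : Continuous u.extend := u.continuous.Icc_extend'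

omit [NormedSpace ℝ G] in
theorem extend_apply (u : Curve G) (t : 𝕀) : u.extend t = u t := IccExtend_val _ _ t

variable [CompleteSpace G]

theorem hasDerivAt_integral_extend (u : Curve G) (t : ℝ) :
    HasDerivAt (fun t => ∫ s in (0 : ℝ)..t, u.extend s) (u.extend t) t :=
  intervalIntegral.integral_hasDerivAt_right (u.continuous_extend.intervalIntegrable _ _)
    (u.continuous_extend.stronglyMeasurableAtFilter _ _) u.continuous_extend.continuousAt

variable (G) in
/-- The operator `(J u)(t) = ∫₀ᵗ u`. -/
noncomputable def volterra : Curve G →L[ℝ] Curve G :=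
  LinearMap.mkContinuous
    { toFun := fun u => mk (fun t => ∫ s in (0 : ℝ)..t, u.extend s) <| by
        have : Continuous fun t => ∫ s in (0 : ℝ)..t, u.extend s :=
          continuous_iff_continuousAt.2 fun t => (u.hasDerivAt_integral_extend t).continuousAt
        fun_prop
      map_add' := fun u v => ext fun t =>
        intervalIntegral.integral_add (u.continuous_extend.intervalIntegrable _ _)
          (v.continuous_extend.intervalIntegrable _ _)
      map_smul' := fun c u => ext fun t => intervalIntegral.integral_smul c _ } 1 fun u => by
      rw [norm_le (by positivity)]
      intro t
      refine (intervalIntegral.norm_integral_le_of_norm_le_const (C := ‖u‖) fun s _ =>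
        u.norm_coe_le_norm _).trans ?_
      rw [sub_zero, abs_of_nonneg t.2.1, one_mul]
      exact mul_le_of_le_one_right (norm_nonneg u) t.2.2

theorem volterra_apply (u : Curve G) (t : 𝕀) :
    volterra G u t = ∫ s in (0 : ℝ)..t, u.extend s := rfl

/-- The fundamental theorem of calculus. -/
theorem volterra_eq {u : Curve G} {U : ℝ → G} (h0 : U 0 = 0)
    (h : ∀ t : 𝕀, HasDerivAt U (u t) t) (t : 𝕀) : volterra G u t = U t := by
  rw [volterra_apply, intervalIntegral.integral_eq_sub_of_hasDerivAt (f := U) (fun s hs => ?_)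
    (u.continuous_extend.intervalIntegrable _ _), h0, sub_zero]
  rw [uIcc_of_le t.2.1] at hs
  have hs' : s ∈ 𝕀 := ⟨hs.1, hs.2.trans t.2.2⟩
  rw [extend, IccExtend_of_mem _ _ hs']
  exact h ⟨s, hs'⟩

/-- The integral `I l = ∫₀¹ f(l, t) dt` of a smooth function `f` depends smoothly on `l`, and can be
differentiated under the integral sign. The image of its derivative under a linear map `L` is
characterised by the fundamental theorem of calculus. -/
theorem exists_contDiff_integral {Λ : Type} [NormedAddCommGroup Λ] [NormedSpace ℝ Λ] {G : Type v}
    [NormedAddCommGroup G] [NormedSpace ℝ G] [CompleteSpace G] {G' : Type*} [NormedAddCommGroup G']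
    [NormedSpace ℝ G'] [CompleteSpace G'] {f : Λ × ℝ → G} (hf : ContDiff ℝ ∞ f)
    (L : (Λ →L[ℝ] G) →L[ℝ] G') :
    ∃ I : Λ → G, ContDiff ℝ ∞ I ∧
      ∀ l (U : ℝ → G'), U 0 = 0 → (∀ t ∈ 𝕀, HasDerivAt U (L (paramDeriv f (l, t))) t) →
        L (fderiv ℝ I l) = U 1 := by
  let F : Λ → Curve G := fun l => mk (fun t => f (l, t)) (by have := hf.continuous; fun_prop)
  let one : 𝕀 := ⟨1, by simp⟩
  let J : Curve G →L[ℝ] G := (evalCLM G one).comp (volterra G)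
  have hf1 : ContDiff ℝ 1 f := hf.of_le (by simp)
  refine ⟨fun l => J (F l), J.contDiff.comp (contDiff_family (fun _ _ => rfl) hf),
    fun l U h0 hU => ?_⟩
  rw [(show HasFDerivAt (fun l => J (F l)) _ l from
    J.hasFDerivAt.comp l (hasFDerivAt_family (F := F) (fun _ _ => rfl) hf1 l)).fderiv]
  have hint := (deriv hf1 l).continuous_extend.intervalIntegrable (μ := MeasureTheory.volume) 0 1
  have hD : J.comp (flip Λ G (deriv hf1 l)) = ∫ s in (0 : ℝ)..1, (deriv hf1 l).extend s := by
    ext v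
    rw [ContinuousLinearMap.intervalIntegral_apply hint]
    rfl
  rw [hD, ← L.intervalIntegral_comp_comm hint]
  exact volterra_eq (u := mk (fun t => L (deriv hf1 l t)) (by fun_prop)) h0
    (fun t => hU t t.2) one

end Curve

end Curves

/-! ### Flat frames of a flat connection form with parameters -/

section FlatFrames

open Set

universe v

variable {𝔸 : Type v} [NormedRing 𝔸] [NormedAlgebra ℝ 𝔸]

namespace Curve

variable (𝔸) in
/-- The pointwise product of curves in a normed algebra. -/
noncomputable def mulCLM : Curve 𝔸 →L[ℝ] Curve 𝔸 →L[ℝ] Curve 𝔸 :=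
  LinearMap.mkContinuous₂ (LinearMap.mk₂ ℝ
    (fun (u v : Curve 𝔸) => mk (fun t => u t * v t) (by fun_prop))
    (fun _ _ _ => ext fun _ => add_mul _ _ _) (fun _ _ _ => ext fun _ => smul_mul_assoc _ _ _)
    (fun _ _ _ => ext fun _ => mul_add _ _ _) (fun _ _ _ => ext fun _ => mul_smul_comm _ _ _)) 1
    fun u v => by
      rw [one_mul, norm_le (by positivity)]
      exact fun t => (norm_mul_le _ _).trans (mul_le_mul (u.norm_coe_le_norm t)
        (v.norm_coe_le_norm t) (norm_nonneg _) (norm_nonneg _))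

theorem mulCLM_apply (u v : Curve 𝔸) (t : Icc (0 : ℝ) 1) : mulCLM 𝔸 u v t = u t * v t := rfl

variable [CompleteSpace 𝔸]

variable (𝔸) in
/-- The operator `u ↦ (t ↦ ∫₀ᵗ u a)`, depending on the curve `a`. -/
noncomputable def odeOperator : Curve 𝔸 →L[ℝ] Curve 𝔸 →L[ℝ] Curve 𝔸 :=
  (ContinuousLinearMap.compL ℝ (Curve 𝔸) (Curve 𝔸) (Curve 𝔸) (volterra 𝔸)).comp (mulCLM 𝔸).flip

theorem odeOperator_apply (a u : Curve 𝔸) : odeOperator 𝔸 a u = volterra 𝔸 (mulCLM 𝔸 u a) := rfl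

/-- The solution of `u' = u a`, `u(0) = 1`, as a fixed point; it is only meaningful if
`odeOperator a` has norm less than `1`. -/
noncomputable def odeSolution (a : Curve 𝔸) : Curve 𝔸 :=
  Ring.inverse (1 - odeOperator 𝔸 a) (mk (fun _ => 1) continuous_const)

/-- The integral equation `u = 1 + ∫ u a` of the initial value problem `u' = u a`, `u(0) = 1`. -/
theorem odeSolution_eq {a : Curve 𝔸} (ha : ‖odeOperator 𝔸 a‖ < 1) :
    odeSolution a = mk (fun _ => 1) continuous_const + odeOperator 𝔸 a (odeSolution a) := by
  have h : IsUnit (1 - odeOperator 𝔸 a) := isUnit_one_sub_of_norm_lt_one ha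
  have := congrArg (fun T : Curve 𝔸 →L[ℝ] Curve 𝔸 => T (mk (fun _ => 1) continuous_const))
    (Ring.mul_inverse_cancel _ h)
  exact eq_add_of_sub_eq this

/-- The solution depends smoothly on `a`, as inversion in a Banach algebra is smooth. -/
theorem contDiffAt_odeSolution {a : Curve 𝔸} (ha : ‖odeOperator 𝔸 a‖ < 1) {n : ℕ∞ω} :
    ContDiffAt ℝ n (odeSolution (𝔸 := 𝔸)) a := by
  obtain ⟨w, hw⟩ : IsUnit (1 - odeOperator 𝔸 a) := isUnit_one_sub_of_norm_lt_one ha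
  have h1 : ContDiffAt ℝ n (Ring.inverse : (Curve 𝔸 →L[ℝ] Curve 𝔸) → _) (1 - odeOperator 𝔸 a) :=
    hw ▸ contDiffAt_ringInverse ℝ w
  exact (h1.comp a (contDiff_const.sub (odeOperator 𝔸).contDiff).contDiffAt).clm_apply
    contDiffAt_const

end Curve

open Curve

variable [CompleteSpace 𝔸] {P Q : Type} [NormedAddCommGroup P] [NormedSpace ℝ P]
  [NormedAddCommGroup Q] [NormedSpace ℝ Q]

/-- The point with parameter `t` on the segment from `(x₀, y)` to `z = (x, y)`. -/
def radial (x₀ : P) (z : P × Q) (t : ℝ) : P × Q := (x₀ + t • (z.1 - x₀), z.2)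

omit [NormedAddCommGroup Q] [NormedSpace ℝ Q] in
theorem radial_one (x₀ : P) (z : P × Q) : radial x₀ z 1 = z := by simp [radial]

omit [NormedSpace ℝ Q] in
theorem radial_mem_ball {z₀ z : P × Q} {r : ℝ} (hz : z ∈ Metric.ball z₀ r) {t : ℝ}
    (ht : t ∈ Icc (0 : ℝ) 1) : radial z₀.1 z t ∈ Metric.ball z₀ r := by
  rw [mem_ball_iff_norm, Prod.norm_def, max_lt_iff] at hz ⊢
  refine ⟨?_, hz.2⟩
  simp only [radial, Prod.fst_sub, add_sub_cancel_left, norm_smul, Real.norm_eq_abs,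
    abs_of_nonneg ht.1]
  exact (mul_le_of_le_one_left (norm_nonneg _) ht.2).trans_lt hz.1

theorem contDiff_radial (x₀ : P) {n : ℕ∞ω} :
    ContDiff ℝ n fun w : (P × Q) × ℝ => radial x₀ w.1 w.2 := by
  unfold radial
  fun_prop

theorem hasDerivAt_radial (x₀ : P) (z : P × Q) (t : ℝ) :
    HasDerivAt (radial x₀ z) (z.1 - x₀, 0) t := by
  have h : HasDerivAt (fun t : ℝ => x₀ + t • (z.1 - x₀)) ((1 : ℝ) • (z.1 - x₀)) t :=
    ((hasDerivAt_id t).smul_const _).const_add x₀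
  rw [one_smul] at h
  exact h.prodMk (hasDerivAt_const t z.2)

theorem hasFDerivAt_radial (x₀ : P) (z : P × Q) (t : ℝ) :
    HasFDerivAt (fun z : P × Q => radial x₀ z t)
      ((t • ContinuousLinearMap.fst ℝ P Q).prod (ContinuousLinearMap.snd ℝ P Q)) z :=
  (((hasFDerivAt_fst.sub_const x₀).const_smul t).const_add x₀).prodMk hasFDerivAt_snd

/-- A flat connection form `A` in the directions of `P`, depending on parameters in `Q`, has a
frame `S` with `dS = S A` in the directions of `P`. -/
theorem exists_flat_frame {A : P × Q → P →L[ℝ] 𝔸} (hA : ContDiff ℝ ∞ A) (z₀ : P × Q) {r : ℝ}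
    (hr : 0 < r) (hflat : ∀ z ∈ Metric.ball z₀ r, ∀ v v' : P,
      fderiv ℝ A z (v, 0) v' - fderiv ℝ A z (v', 0) v + A z v * A z v' - A z v' * A z v = 0) :
    ∃ S : P × Q → 𝔸, ∃ r' > 0, r' ≤ r ∧ ∀ z ∈ Metric.ball z₀ r', ContDiffAt ℝ ∞ S z ∧
      IsUnit (S z) ∧ ∀ v : P, fderiv ℝ S z (v, 0) = S z * A z v := by
  set x₀ := z₀.1 with hx₀
  let f : (P × Q) × ℝ → 𝔸 := fun w => A (radial x₀ w.1 w.2) (w.1.1 - x₀)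
  have hf : ContDiff ℝ ∞ f := (hA.comp (contDiff_radial x₀)).clm_apply (by fun_prop)
  let a : P × Q → Curve 𝔸 := fun z => mk (fun t => f (z, t)) (by have := hf.continuous; fun_prop)
  have ha : ContDiff ℝ ∞ a := contDiff_family (fun _ _ => rfl) hf
  have haf := hasFDerivAt_family (F := a) (fun _ _ => rfl) (hf.of_le (by simp))
  have hKc : Continuous fun z => odeOperator 𝔸 (a z) :=
    (odeOperator 𝔸).continuous.comp ha.continuous
  -- The radial direction vanishes at the centre, so the operator is small near `z₀`.
  have hK0 : odeOperator 𝔸 (a z₀) = 0 := by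
    have : a z₀ = 0 := Curve.ext fun t => by
      change A _ (z₀.1 - x₀) = 0
      rw [hx₀, sub_self, map_zero]
    rw [this, map_zero]
  let one : Icc (0 : ℝ) 1 := ⟨1, by simp⟩
  let S : P × Q → 𝔸 := fun z => odeSolution (a z) one
  have hS : ∀ z, ‖odeOperator 𝔸 (a z)‖ < 1 → ContDiffAt ℝ ∞ S z := fun z hz =>
    (evalCLM 𝔸 one).contDiff.contDiffAt.comp z ((contDiffAt_odeSolution hz).comp z ha.contDiffAt)
  have hz₀ : ‖odeOperator 𝔸 (a z₀)‖ < 1 := by rw [hK0, norm_zero]; exact one_pos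
  have hS0 : S z₀ = 1 := by
    have h := congrArg (fun u : Curve 𝔸 => u one) (odeSolution_eq hz₀)
    rw [hK0] at h
    exact h.trans (add_zero _)
  have hnorm : ∀ᶠ z in 𝓝 z₀, ‖odeOperator 𝔸 (a z)‖ < 1 :=
    (hKc.norm.tendsto z₀).eventually_lt_const hz₀
  have hunit : ∀ᶠ z in 𝓝 z₀, IsUnit (S z) :=
    (hS z₀ hz₀).continuousAt.eventually (by rw [hS0]; exact Units.nhds (1 : 𝔸ˣ))
  obtain ⟨r', hr', h⟩ := Metric.eventually_nhds_iff_ball.1 (hnorm.and hunit)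
  refine ⟨S, min r r', lt_min hr hr', min_le_left _ _, fun z hz => ?_⟩
  have hzr : z ∈ Metric.ball z₀ r := Metric.ball_subset_ball (min_le_left _ _) hz
  obtain ⟨hKz, hSz⟩ := h z (Metric.ball_subset_ball (min_le_right _ _) hz)
  refine ⟨hS z hKz, hSz, fun v => ?_⟩
  -- The derivative `Du` of the solution `u` in the direction `v`.
  have hud : DifferentiableAt ℝ (fun z => odeSolution (a z)) z :=
    ((contDiffAt_odeSolution (n := ∞) hKz).comp z ha.contDiffAt).differentiableAt (by simp)
  set u : Curve 𝔸 := odeSolution (a z) with hu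
  set Du : Curve 𝔸 := fderiv ℝ (fun z => odeSolution (a z)) z (v, 0) with hDu
  set Da : Curve 𝔸 := fderiv ℝ a z (v, 0) with hDa
  -- Differentiation of the integral equation for `u`.
  have hDuE : Du = volterra 𝔸 (mulCLM 𝔸 Du (a z) + mulCLM 𝔸 u Da) := by
    have hev : (fun z => odeSolution (a z)) =ᶠ[𝓝 z] fun z =>
        mk (fun _ => 1) continuous_const + odeOperator 𝔸 (a z) (odeSolution (a z)) := by
      filter_upwards [(hKc.norm.tendsto z).eventually_lt_const hKz] with z' hz'
      exact odeSolution_eq hz'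
    have hder := ((((odeOperator 𝔸).hasFDerivAt.comp z (ha.differentiable (by simp) z).hasFDerivAt
      ).clm_apply hud.hasFDerivAt).const_add
        (mk (fun _ => 1) continuous_const)).congr_of_eventuallyEq hev
    have := congrArg (fun T => T ((v, 0) : P × Q)) hder.fderiv
    refine this.trans ?_
    rw [map_add]
    rfl
  have hAd : ∀ z, HasFDerivAt A (fderiv ℝ A z) z := fun z =>
    (hA.differentiable (by simp) z).hasFDerivAt
  have hDaE : ∀ t : Icc (0 : ℝ) 1, Da t = t.1 • fderiv ℝ A (radial x₀ z t) (v, 0) (z.1 - x₀) +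
      A (radial x₀ z t) v := by
    intro t
    have h1 := (((hAd (radial x₀ z t)).comp z (hasFDerivAt_radial x₀ z t)).clm_apply
      ((hasFDerivAt_fst (𝕜 := ℝ) (E := P) (F := Q) (p := z)).sub_const x₀))
    have h2 := (hasFDerivAt_paramDeriv (hf.of_le (by simp)) z t.1).unique h1
    rw [hDa, (haf z).fderiv, flip_apply, deriv_apply, h2]
    have h3 : (t.1 • v, (0 : Q)) = t.1 • (v, 0) := by simp
    simp only [_root_.add_apply, ContinuousLinearMap.comp_apply,
      ContinuousLinearMap.flip_apply, ContinuousLinearMap.prod_apply,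
      _root_.smul_apply, ContinuousLinearMap.coe_fst', ContinuousLinearMap.coe_snd',
      Function.comp_apply, h3, map_smul]
    rw [add_comm]
  -- `U` extends `u` to the real line. The curve `H t = t • (U t * A (z_t) v)`, where `z_t` is the
  -- point with parameter `t` on the segment, is to be compared with `Du`.
  let U : ℝ → 𝔸 := fun t => 1 + ∫ s in (0 : ℝ)..t, (mulCLM 𝔸 u (a z)).extend s
  have hU : ∀ t : Icc (0 : ℝ) 1, u t = U t := fun t =>
    congrArg (fun u : Curve 𝔸 => u t) (odeSolution_eq hKz)
  have hU' : ∀ t : Icc (0 : ℝ) 1, HasDerivAt U (u t * A (radial x₀ z t) (z.1 - x₀)) t := by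
    intro t
    have := ((mulCLM 𝔸 u (a z)).hasDerivAt_integral_extend t).const_add 1
    rwa [extend_apply] at this
  have hAv : ∀ t : ℝ, HasDerivAt (fun t => A (radial x₀ z t) v)
      (fderiv ℝ A (radial x₀ z t) (z.1 - x₀, 0) v) t := fun t =>
    (ContinuousLinearMap.apply ℝ 𝔸 v).hasFDerivAt.comp_hasDerivAt t
      ((hAd _).comp_hasDerivAt t (hasDerivAt_radial x₀ z t))
  let H : ℝ → 𝔸 := fun t => t • (U t * A (radial x₀ z t) v)
  have hHc : Continuous fun t : Icc (0 : ℝ) 1 => H t := continuous_iff_continuousAt.2 fun t =>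
    (((hasDerivAt_id t.1).smul ((hU' t).mul (hAv t))).continuousAt).comp
      continuous_subtype_val.continuousAt
  set Hc : Curve 𝔸 := mk (fun t => H t) hHc with hHcdef
  -- By the structure equation `H' = H a + u Da` on the segment, where `a` is the value of `A` on
  -- the radial direction. As `Du` satisfies the same integral equation, the difference is a fixed
  -- point of an operator of norm less than `1`, and vanishes.
  have hB : Du - Hc = odeOperator 𝔸 (a z) (Du - Hc) := by
    have key : volterra 𝔸 (mulCLM 𝔸 Du (a z) + mulCLM 𝔸 u Da - mulCLM 𝔸 (Du - Hc) (a z)) = Hc := by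
      refine Curve.ext fun t => volterra_eq (U := H) (zero_smul _ _) (fun t => ?_) t
      refine ((hasDerivAt_id t.1).smul ((hU' t).mul (hAv t))).congr_deriv ?_
      have hfl := hflat _ (radial_mem_ball hzr t.2) v (z.1 - x₀)
      have ha' : a z t = A (radial x₀ z t) (z.1 - x₀) := rfl
      have hH' : Hc t = t.1 • (U t * A (radial x₀ z t) v) := rfl
      have hfl' : fderiv ℝ A (radial x₀ z t) (v, 0) (z.1 - x₀) =
          fderiv ℝ A (radial x₀ z t) (z.1 - x₀, 0) v - A (radial x₀ z t) v *
            A (radial x₀ z t) (z.1 - x₀) + A (radial x₀ z t) (z.1 - x₀) * A (radial x₀ z t) v := by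
        rw [← sub_eq_zero, ← hfl]
        abel
      simp only [Curve.sub_apply, Curve.add_apply, mulCLM_apply, ha', hH', hDaE, hU, id, hfl',
        one_smul, mul_add, mul_sub, sub_mul, smul_mul_assoc, mul_smul_comm, smul_add, smul_sub,
        mul_assoc]
      abel
    refine (congrArg₂ (· - ·) hDuE key.symm).trans ?_
    rw [odeOperator_apply]
    rw [← map_sub, sub_sub_cancel]
  have hB0 : Du - Hc = 0 := by
    have h1 := (odeOperator 𝔸 (a z)).le_opNorm (Du - Hc)
    rw [← hB] at h1
    by_contra h0
    have h2 := mul_lt_mul_of_pos_right hKz (norm_pos_iff.2 h0)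
    rw [one_mul] at h2
    exact h1.not_gt h2
  have hfin : fderiv ℝ S z (v, 0) = Du one := by
    have := ((evalCLM 𝔸 one).hasFDerivAt.comp z hud.hasFDerivAt).fderiv
    exact congrArg (fun T => T ((v, 0) : P × Q)) this
  rw [hfin, sub_eq_zero.1 hB0]
  have h1 : Hc one = (1 : ℝ) • (U 1 * A (radial x₀ z 1) v) := rfl
  rw [h1, one_smul, radial_one]
  exact congrArg (· * A z v) (hU one).symm

end FlatFrames

/-! ### The Poincaré lemma with parameters -/

section Poincare

universe v

set_option synthInstance.maxHeartbeats 200000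

open Set ContinuousAlternatingMap Curve

variable {P Q : Type} [NormedAddCommGroup P] [NormedSpace ℝ P]
  [NormedAddCommGroup Q] [NormedSpace ℝ Q] {W : Type*} [NormedAddCommGroup W] [NormedSpace ℝ W]

/-- The radial homotopy operator, for an abstract operator `D` on derivatives (which stands for the
alternation of `P → Λᵏ` to `Λᵏ⁺¹`) and an abstract contraction `C`. -/
theorem exists_contDiff_homotopy {G : Type v} [NormedAddCommGroup G] [NormedSpace ℝ G]
    [CompleteSpace G] {G' : Type*} [NormedAddCommGroup G'] [NormedSpace ℝ G'] [CompleteSpace G']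
    {k : ℕ} (D : (P →L[ℝ] G) →L[ℝ] G') (C : G' →L[ℝ] P →L[ℝ] G)
    (hDC : ∀ a, D (C a) = (k + 1 : ℝ) • a) {θ : P × Q → G'} (hθ : ContDiff ℝ ∞ θ) (z₀ : P × Q)
    {r : ℝ} (hclosed : ∀ z ∈ Metric.ball z₀ r, ∀ ξ,
      D ((C.flip ξ).comp ((fderiv ℝ θ z).comp (.inl ℝ P Q))) = fderiv ℝ θ z (ξ, 0)) :
    ∃ η : P × Q → G, ContDiff ℝ ∞ η ∧
      ∀ z ∈ Metric.ball z₀ r, D ((fderiv ℝ η z).comp (.inl ℝ P Q)) = θ z := by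
  set x₀ := z₀.1
  -- The integrand is `t ^ k` times the contraction of `θ` with the radial field. The alternation of
  -- its derivative in `z` is the derivative in `t` of `t ^ (k + 1) • θ` along the segment.
  let f : (P × Q) × ℝ → G := fun w => w.2 ^ k • C (θ (radial x₀ w.1 w.2)) (w.1.1 - x₀)
  have hf : ContDiff ℝ ∞ f :=
    (contDiff_snd.pow k).smul (((C.contDiff.comp (hθ.comp (contDiff_radial x₀)))).clm_apply
      (contDiff_fst.fst.sub contDiff_const))
  let L : (P × Q →L[ℝ] G) →L[ℝ] G' :=
    D.comp ((ContinuousLinearMap.compL ℝ P (P × Q) G).flip (.inl ℝ P Q))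
  obtain ⟨η, hη, h⟩ := exists_contDiff_integral hf L
  refine ⟨η, hη, fun z hz => ?_⟩
  change L (fderiv ℝ η z) = θ z
  rw [h z (fun t => t ^ (k + 1) • θ (radial x₀ z t)) (by simp) fun t ht => ?_]
  · rw [one_pow, one_smul, radial_one]
  have hθd : ∀ z, HasFDerivAt θ (fderiv ℝ θ z) z := fun z =>
    (hθ.differentiable (by simp) z).hasFDerivAt
  set ξ := z.1 - x₀
  set ζ := radial x₀ z t
  have hpd : (paramDeriv f (z, t)).comp (.inl ℝ P Q) =
      t ^ (k + 1) • (C.flip ξ).comp ((fderiv ℝ θ ζ).comp (.inl ℝ P Q)) + t ^ k • C (θ ζ) := by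
    ext v
    have h1 := ((C.hasFDerivAt.comp z ((hθd ζ).comp z (hasFDerivAt_radial x₀ z t))).clm_apply
      ((hasFDerivAt_fst (𝕜 := ℝ) (E := P) (F := Q) (p := z)).sub_const x₀)).const_smul (t ^ k)
    have h2 := (hasFDerivAt_paramDeriv (hf.of_le (by simp)) z t).unique h1
    rw [h2]
    have h3 : (t • v, (0 : Q)) = t • (v, 0) := by simp
    change t ^ k • (C (θ ζ) v + C (fderiv ℝ θ ζ (t • v, 0)) ξ) =
      t ^ (k + 1) • C (fderiv ℝ θ ζ (v, 0)) ξ + t ^ k • C (θ ζ) v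
    rw [h3, map_smul, map_smul, smul_add, add_comm, _root_.smul_apply, smul_smul, ← pow_succ]
  have hL : L (paramDeriv f (z, t)) =
      t ^ (k + 1) • fderiv ℝ θ ζ (ξ, 0) + t ^ k • (k + 1 : ℝ) • θ ζ := by
    change D ((paramDeriv f (z, t)).comp (.inl ℝ P Q)) = _
    rw [hpd, map_add, map_smul, map_smul, hDC, hclosed ζ (radial_mem_ball hz ht)]
  rw [hL]
  refine ((hasDerivAt_pow (k + 1) t).smul
    ((hθd ζ).comp_hasDerivAt t (hasDerivAt_radial x₀ z t))).congr_deriv ?_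
  simp [ζ, ξ, smul_smul, mul_comm]

/-- The exterior derivative along `P × {y}` of a family of forms on `P` with parameters in `Q`. -/
noncomputable def sliceExtDeriv {k : ℕ} (θ : P × Q → P [⋀^Fin k]→L[ℝ] W) (z : P × Q) :
    P [⋀^Fin (k + 1)]→L[ℝ] W :=
  extDeriv (fun x => θ (x, z.2)) z.1

/-- The exterior derivative along the slices is the alternation of the total derivative restricted
to `P`. -/
theorem sliceExtDeriv_eq {k : ℕ} {θ : P × Q → P [⋀^Fin k]→L[ℝ] W} {z : P × Q}
    (hθ : DifferentiableAt ℝ θ z) :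
    sliceExtDeriv θ z = alternatizeUncurryFin ((fderiv ℝ θ z).comp (.inl ℝ P Q)) :=
  congrArg _ ((show HasFDerivAt θ (fderiv ℝ θ z) (z.1, z.2) from hθ.hasFDerivAt).comp z.1
    (hasFDerivAt_prodMk_left z.1 z.2)).fderiv

theorem sliceExtDeriv_sliceExtDeriv {k : ℕ} {θ : P × Q → P [⋀^Fin k]→L[ℝ] W} {z : P × Q}
    (hθ : ContDiffAt ℝ ∞ θ z) : sliceExtDeriv (sliceExtDeriv θ) z = 0 :=
  extDeriv_extDeriv_apply (show ContDiffAt ℝ ∞ (fun x => θ (x, z.2)) z.1 from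
    ContDiffAt.comp (g := θ) (f := fun x => (x, z.2)) z.1 hθ (by fun_prop)) (by
      rw [minSmoothness_of_isRCLikeNormedField]; exact ENat.LEInfty.out)

omit [NormedSpace ℝ Q] in
theorem Filter.EventuallyEq.sliceExtDeriv {k : ℕ} {θ θ' : P × Q → P [⋀^Fin k]→L[ℝ] W} {z : P × Q}
    (h : θ =ᶠ[𝓝 z] θ') : sliceExtDeriv θ =ᶠ[𝓝 z] sliceExtDeriv θ' := by
  filter_upwards [h.eventuallyEq_nhds] with z' hz'
  refine Filter.EventuallyEq.extDeriv_eq ?_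
  exact (show Filter.Tendsto (fun x => (x, z'.2)) (𝓝 z'.1) (𝓝 (z'.1, z'.2)) from
    Continuous.tendsto (by fun_prop) _).eventually hz'

/-- The Poincaré lemma for families of forms on a ball of `P` with parameters in `Q`. -/
theorem exists_sliceExtDeriv_eq [CompleteSpace W] {k : ℕ} {θ : P × Q → P [⋀^Fin (k + 1)]→L[ℝ] W}
    (hθ : ContDiff ℝ ∞ θ) (z₀ : P × Q) {r : ℝ}
    (hclosed : ∀ z ∈ Metric.ball z₀ r, sliceExtDeriv θ z = 0) :
    ∃ η : P × Q → P [⋀^Fin k]→L[ℝ] W, ContDiff ℝ ∞ η ∧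
      ∀ z ∈ Metric.ball z₀ r, sliceExtDeriv η z = θ z := by
  have hcl : ∀ z ∈ Metric.ball z₀ r, ∀ ξ, alternatizeUncurryFinCLM ℝ P W
      (((curryLeftLI (n := k) (𝕜 := ℝ) (E := P) (F := W)).toContinuousLinearMap.flip ξ).comp
        ((fderiv ℝ θ z).comp (.inl ℝ P Q))) = fderiv ℝ θ z (ξ, 0) := by
    intro z hz ξ
    ext w
    have h1 := hclosed z hz
    rw [sliceExtDeriv_eq (hθ.differentiable (by simp) z)] at h1
    have h2 := congrArg (fun a => a (Matrix.vecCons ξ w)) h1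
    simp only [alternatizeUncurryFin_apply, Fin.sum_univ_succ (n := k + 1)] at h2
    refine (alternatizeUncurryFin_apply _ w).trans ?_
    simp only [Fin.val_zero, pow_zero, one_smul, Fin.val_succ, pow_succ, mul_neg_one,
      neg_smul, Finset.sum_neg_distrib] at h2
    refine Eq.trans ?_ (neg_add_eq_zero.1 ((add_comm _ _).trans h2))
    refine Finset.sum_congr rfl fun i _ => ?_
    refine congrArg (fun a : W => (-1 : ℤ) ^ (i : ℕ) • a) ?_
    change fderiv ℝ θ z (w i, 0) (Matrix.vecCons ξ (i.removeNth w)) =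
      fderiv ℝ θ z (w i, 0) (i.succ.removeNth (Matrix.vecCons ξ w))
    refine congrArg _ (funext fun j => ?_)
    cases j using Fin.cases <;> simp [Fin.removeNth]
  obtain ⟨η, hη, h⟩ := exists_contDiff_homotopy (k := k) (alternatizeUncurryFinCLM ℝ P W)
    curryLeftLI.toContinuousLinearMap (fun a => (alternatizeUncurryFin_curryLeft a).trans (by
      rw [← Nat.cast_smul_eq_nsmul ℝ, Nat.cast_add, Nat.cast_one])) hθ z₀ hcl
  exact ⟨η, hη, fun z hz => (sliceExtDeriv_eq (hη.differentiable (by simp) z)).trans (h z hz)⟩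

end Poincare

/-! ### Cutting off sections of bundles -/

section Cutoff

variable {E : Type*} [NormedAddCommGroup E] [NormedSpace ℝ E] [FiniteDimensional ℝ E]
  {M : Type*} [TopologicalSpace M] [T2Space M] [SecondCountableTopology M] [ChartedSpace E M]
  [IsManifold 𝓘(ℝ, E) ∞ M]

/-- Smooth cutoff functions for a compact subset of a manifold. -/
theorem exists_cutoff {K U : Set M} (hK : IsCompact K) (hU : IsOpen U) (hKU : K ⊆ U) :
    ∃ ρ : C^∞⟮𝓘(ℝ, E), M; ℝ⟯, (∀ᶠ x in 𝓝ˢ K, ρ x = 1) ∧ tsupport ρ ⊆ U := by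
  have : LocallyCompactSpace M := Manifold.locallyCompact_of_finiteDimensional 𝓘(ℝ, E)
  obtain ⟨L, hL, hKL, hLU⟩ := exists_compact_between hK hU hKU
  obtain ⟨ρ, h1, h0, -⟩ := exists_contMDiffMap_one_nhds_of_subset_interior (n := ⊤) 𝓘(ℝ, E)
    hK.isClosed hKL
  refine ⟨ρ, h1, (closure_minimal (fun x hx => ?_) hL.isClosed).trans hLU⟩
  by_contra hxL
  exact hx (h0 x hxL)

theorem exists_cutoff_nhds {x : M} {U : Set M} (hU : IsOpen U) (hx : x ∈ U) :
    ∃ ρ : C^∞⟮𝓘(ℝ, E), M; ℝ⟯, (∀ᶠ y in 𝓝 x, ρ y = 1) ∧ tsupport ρ ⊆ U := by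
  obtain ⟨ρ, h, h'⟩ := exists_cutoff (E := E) isCompact_singleton hU
    (Set.singleton_subset_iff.2 hx)
  exact ⟨ρ, by rwa [nhdsSet_singleton] at h, h'⟩

variable {W : Type*} [NormedAddCommGroup W] [NormedSpace ℝ W] {V : M → Type*}
  [TopologicalSpace (TotalSpace W V)] [∀ x, TopologicalSpace (V x)] [FiberBundle W V]
  [∀ x, AddCommGroup (V x)] [∀ x, Module ℝ (V x)] [VectorBundle ℝ W V]

/-- A section that is smooth on an open set, multiplied by a smooth function with support in it. -/
noncomputable def cutSection (ρ : C^∞⟮𝓘(ℝ, E), M; ℝ⟯) (s : ∀ x, V x) {U : Set M} (hU : IsOpen U)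
    (hρ : tsupport ρ ⊆ U)
    (hs : ContMDiffOn 𝓘(ℝ, E) (𝓘(ℝ, E).prod 𝓘(ℝ, W)) ∞ (fun x => TotalSpace.mk' W x (s x)) U) :
    Cₛ^∞⟮𝓘(ℝ, E); W, V⟯ :=
  ⟨fun x => ρ x • s x, ContMDiffOn.smul_section_of_tsupport ρ.contMDiff.contMDiffOn hU hρ hs⟩

omit [FiniteDimensional ℝ E] [T2Space M] [SecondCountableTopology M]
  [IsManifold 𝓘(ℝ, E) ∞ M] in
/-- A vector-valued function that is smooth on an open set, multiplied by a smooth function with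
support in it. -/
theorem contMDiff_cutoff_smul {G : Type*} [NormedAddCommGroup G] [NormedSpace ℝ G]
    (ρ : C^∞⟮𝓘(ℝ, E), M; ℝ⟯) {f : M → G} {U : Set M} (hU : IsOpen U) (hρ : tsupport ρ ⊆ U)
    (hf : ContMDiffOn 𝓘(ℝ, E) 𝓘(ℝ, G) ∞ f U) :
    ContMDiff 𝓘(ℝ, E) 𝓘(ℝ, G) ∞ fun x => ρ x • f x := by
  refine contMDiff_of_tsupport fun x hx => ?_
  exact (ρ.contMDiff x).smul
    (hf.contMDiffAt (hU.mem_nhds (hρ (tsupport_smul_subset_left ρ f hx))))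

end Cutoff

/-! ### Derivatives along vector fields -/

section DirDeriv

variable {E : Type*} [NormedAddCommGroup E] [NormedSpace ℝ E]
  {M : Type*} [TopologicalSpace M] [ChartedSpace E M] [IsManifold 𝓘(ℝ, E) ∞ M]
  {G : Type*} [NormedAddCommGroup G] [NormedSpace ℝ G]

/-- The derivative of a smooth function in the direction of a smooth field is smooth. -/
theorem contMDiffOn_dirDeriv (X : SmoothFields E M) {f : M → G} {U : Set M} (hU : IsOpen U)
    (hf : ContMDiffOn 𝓘(ℝ, E) 𝓘(ℝ, G) ∞ f U) :
    ContMDiffOn 𝓘(ℝ, E) 𝓘(ℝ, G) ∞ (dirDeriv X f) U := by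
  have h1 := (hf.contMDiffOn_tangentMapWithin (m := ∞) (by simp) hU.uniqueMDiffOn).comp
    X.contMDiff.contMDiffOn (s := U) (fun x hx => hx)
  refine ((contMDiff_snd_tangentBundle_modelSpace G 𝓘(ℝ, G)).comp_contMDiffOn h1).congr
    fun x hx => ?_
  change mfderiv 𝓘(ℝ, E) 𝓘(ℝ, G) f x (X x) = mfderivWithin 𝓘(ℝ, E) 𝓘(ℝ, G) f U x (X x)
  rw [mfderivWithin_of_isOpen hU hx]

omit [IsManifold 𝓘(ℝ, E) ∞ M] in
theorem Filter.EventuallyEq.dirDeriv_eq {X : ∀ x : M, TangentSpace 𝓘(ℝ, E) x} {f g : M → G} {x : M}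
    (h : f =ᶠ[𝓝 x] g) : dirDeriv X f x = dirDeriv X g x := by
  exact congrArg (fun A : E →L[ℝ] G => A (X x)) h.mfderiv_eq

end DirDeriv

/-! ### Foliated charts -/

/-- The Euclidean space of dimension `n`. -/
abbrev Euc (n : ℕ) : Type := EuclideanSpace ℝ (Fin n)

namespace IsFoliatedChart

variable {E : Type*} [NormedAddCommGroup E] [NormedSpace ℝ E]
  {M : Type*} [TopologicalSpace M] [ChartedSpace E M] {p q : ℕ}
  {T : ∀ x : M, Submodule ℝ (TangentSpace 𝓘(ℝ, E) x)}
  {φ : OpenPartialHomeomorph M (Euc p × Euc q)} (hφ : IsFoliatedChart T φ)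

include hφ

theorem contMDiffAt {x : M} (hx : x ∈ φ.source) :
    ContMDiffAt 𝓘(ℝ, E) 𝓘(ℝ, Euc p × Euc q) ∞ φ x :=
  hφ.contMDiffOn.contMDiffAt (φ.open_source.mem_nhds hx)

theorem mdifferentiable : φ.MDifferentiable 𝓘(ℝ, E) 𝓘(ℝ, Euc p × Euc q) :=
  ⟨hφ.contMDiffOn.mdifferentiableOn (by simp), hφ.contMDiffOn_symm.mdifferentiableOn (by simp)⟩

theorem isInvertible_mfderiv {x : M} (hx : x ∈ φ.source) :
    (mfderiv 𝓘(ℝ, E) 𝓘(ℝ, Euc p × Euc q) φ x).IsInvertible :=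
  ⟨hφ.mdifferentiable.mfderiv hx, rfl⟩

theorem mfderiv_fst {x : M} (hx : x ∈ φ.source) (w : TangentSpace 𝓘(ℝ, E) x) :
    mfderiv 𝓘(ℝ, E) 𝓘(ℝ, Euc p) (fun y => (φ y).1) x w =
      ((mfderiv 𝓘(ℝ, E) 𝓘(ℝ, Euc p × Euc q) φ x w : Euc p × Euc q)).1 := by
  have h := (hφ.mdifferentiable.mdifferentiableAt hx).hasMFDerivAt
  have h2 := HasMFDerivAt.comp x (hasFDerivAt_fst (𝕜 := ℝ) (p := φ x)).hasMFDerivAt h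
  exact congrArg (fun A : E →L[ℝ] Euc p => A w) h2.mfderiv

theorem mfderiv_snd {x : M} (hx : x ∈ φ.source) (w : TangentSpace 𝓘(ℝ, E) x) :
    mfderiv 𝓘(ℝ, E) 𝓘(ℝ, Euc q) (fun y => (φ y).2) x w =
      ((mfderiv 𝓘(ℝ, E) 𝓘(ℝ, Euc p × Euc q) φ x w : Euc p × Euc q)).2 := by
  have h := (hφ.mdifferentiable.mdifferentiableAt hx).hasMFDerivAt
  have h2 := HasMFDerivAt.comp x (hasFDerivAt_snd (𝕜 := ℝ) (p := φ x)).hasMFDerivAt h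
  exact congrArg (fun A : E →L[ℝ] Euc q => A w) h2.mfderiv

theorem contMDiffOn_fst : ContMDiffOn 𝓘(ℝ, E) 𝓘(ℝ, Euc p) ∞ (fun y => (φ y).1) φ.source :=
  contDiff_fst.contMDiff.comp_contMDiffOn hφ.contMDiffOn

omit hφ in
variable (φ) in
/-- The value at `x` of the vector field along the leaves that is constantly `v` in the foliated
chart `φ`, as a linear function of `v`. -/
noncomputable def _root_.leafField (x : M) : Euc p →ₗ[ℝ] TangentSpace 𝓘(ℝ, E) x :=
  (mfderiv 𝓘(ℝ, E) 𝓘(ℝ, Euc p × Euc q) φ x).inverse.toLinearMap ∘ₗ LinearMap.inl ℝ (Euc p) (Euc q)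

theorem mfderiv_leafField {x : M} (hx : x ∈ φ.source) (v : Euc p) :
    mfderiv 𝓘(ℝ, E) 𝓘(ℝ, Euc p × Euc q) φ x (leafField φ x v) = ((v, 0) : Euc p × Euc q) := by
  obtain ⟨A, hA⟩ := hφ.isInvertible_mfderiv hx
  have h : (leafField φ x v : TangentSpace 𝓘(ℝ, E) x) = A.symm ((v, 0) : Euc p × Euc q) := by
    change (mfderiv 𝓘(ℝ, E) 𝓘(ℝ, Euc p × Euc q) φ x).inverse ((v, 0) : Euc p × Euc q) = _
    rw [← hA, ContinuousLinearMap.inverse_equiv]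
    rfl
  rw [h, ← hA]
  exact A.apply_symm_apply _

/-- The fields `leafField φ · v` are tangent to the leaves. -/
theorem leafField_mem {x : M} (hx : x ∈ φ.source) (v : Euc p) : leafField φ x v ∈ T x :=
  (hφ.mem_iff x hx _).2
    ((hφ.mfderiv_snd hx _).trans (congrArg Prod.snd (hφ.mfderiv_leafField hx v)))

/-- A vector tangent to a leaf is determined by its first component in a foliated chart. -/
theorem eq_leafField {x : M} (hx : x ∈ φ.source) {w : TangentSpace 𝓘(ℝ, E) x} (hw : w ∈ T x)
    {v : Euc p} (hv : mfderiv 𝓘(ℝ, E) 𝓘(ℝ, Euc p) (fun y => (φ y).1) x w = v) :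
    w = leafField φ x v := by
  refine hφ.mdifferentiable.mfderiv_injective hx (Eq.trans ?_ (hφ.mfderiv_leafField hx v).symm)
  exact Prod.ext ((hφ.mfderiv_fst hx w).symm.trans hv)
    ((hφ.mfderiv_snd hx w).symm.trans ((hφ.mem_iff x hx w).1 hw))

variable [CompleteSpace E] [IsManifold 𝓘(ℝ, E) ∞ M]

theorem contMDiffOn_leafField (v : Euc p) :
    ContMDiffOn 𝓘(ℝ, E) (𝓘(ℝ, E).prod 𝓘(ℝ, E)) ∞
      (fun x => TotalSpace.mk' E (E := (TangentSpace 𝓘(ℝ, E) : M → Type _)) x (leafField φ x v))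
      φ.source := by
  intro x hx
  have : IsManifold 𝓘(ℝ, E) (((⊤ : ℕ∞) : ℕ∞ω) + 1) M := ‹IsManifold 𝓘(ℝ, E) ∞ M›
  have hV : ContMDiffAt 𝓘(ℝ, Euc p × Euc q) (𝓘(ℝ, Euc p × Euc q).prod 𝓘(ℝ, Euc p × Euc q)) ∞
      (fun z => TotalSpace.mk' (Euc p × Euc q)
        (E := (TangentSpace 𝓘(ℝ, Euc p × Euc q) : Euc p × Euc q → Type _)) z
        ((v, 0) : Euc p × Euc q)) (φ x) :=
    contMDiffAt_vectorSpace_iff_contDiffAt.2 contDiffAt_const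
  exact (ContMDiffAt.mpullback_vectorField_preimage (m := ∞) (n := ∞) hV (hφ.contMDiffAt hx)
    (hφ.isInvertible_mfderiv hx) (by simp)).contMDiffWithinAt

omit [CompleteSpace E] [IsManifold 𝓘(ℝ, E) ∞ M]

/-- Derivatives along leaves can be computed in a foliated chart. -/
theorem dirDeriv_eq {G : Type*} [NormedAddCommGroup G] [NormedSpace ℝ G] {x : M}
    (hx : x ∈ φ.source) {X : ∀ x : M, TangentSpace 𝓘(ℝ, E) x} (hX : X x ∈ T x) {g : M → G}
    (hg : MDifferentiableAt 𝓘(ℝ, E) 𝓘(ℝ, G) g x) {v : Euc p}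
    (hv : dirDeriv X (fun y => (φ y).1) x = v) :
    dirDeriv X g x = fderiv ℝ (g ∘ φ.symm) (φ x) (v, 0) := by
  have hs := hφ.mdifferentiable.mdifferentiableAt_symm (φ.map_source hx)
  have hg' : MDifferentiableAt 𝓘(ℝ, E) 𝓘(ℝ, G) g (φ.symm (φ x)) := by rwa [φ.left_inv hx]
  have h1 : HasMFDerivAt 𝓘(ℝ, E) 𝓘(ℝ, G) ((g ∘ φ.symm) ∘ φ) x _ :=
    HasMFDerivAt.comp x (hg'.comp (φ x) hs).hasMFDerivAt
      (hφ.mdifferentiable.mdifferentiableAt hx).hasMFDerivAt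
  have h2 : dirDeriv X g x = dirDeriv X ((g ∘ φ.symm) ∘ φ) x := by
    refine Filter.EventuallyEq.dirDeriv_eq ?_
    filter_upwards [φ.open_source.mem_nhds hx] with y hy
    simp only [Function.comp_apply, φ.left_inv hy]
  have h3 : mfderiv 𝓘(ℝ, E) 𝓘(ℝ, Euc p × Euc q) φ x (X x) = ((v, 0) : Euc p × Euc q) := by
    rw [hφ.eq_leafField hx hX hv, hφ.mfderiv_leafField hx]
  refine h2.trans ((congrArg (fun A : E →L[ℝ] G => A (X x)) h1.mfderiv).trans ?_)
  exact (congrArg (mfderiv 𝓘(ℝ, Euc p × Euc q) 𝓘(ℝ, G) (g ∘ φ.symm) (φ x)) h3).trans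
    (congrArg (fun A : Euc p × Euc q →L[ℝ] G => A (v, 0)) mfderiv_eq_fderiv)

omit hφ in
variable (φ) in
/-- The leafwise components of a vector field in a foliated chart. -/
noncomputable def _root_.leafCoord (X : ∀ x : M, TangentSpace 𝓘(ℝ, E) x) (z : Euc p × Euc q) :
    Euc p :=
  dirDeriv X (fun y => (φ y).1) (φ.symm z)

omit hφ in
theorem leafCoord_apply {x : M} (hx : x ∈ φ.source) (X : ∀ x : M, TangentSpace 𝓘(ℝ, E) x) :
    leafCoord φ X (φ x) = dirDeriv X (fun y => (φ y).1) x := by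
  rw [leafCoord, φ.left_inv hx]

theorem eq_leafField_leafCoord {x : M} (hx : x ∈ φ.source)
    {X : ∀ x : M, TangentSpace 𝓘(ℝ, E) x} (hX : X x ∈ T x) :
    X x = leafField φ x (leafCoord φ X (φ x)) :=
  hφ.eq_leafField hx hX (leafCoord_apply hx X).symm

theorem leafCoord_eq_of_eq_leafField {x : M} (hx : x ∈ φ.source)
    {X : ∀ x : M, TangentSpace 𝓘(ℝ, E) x} {v : Euc p} (hX : X x = leafField φ x v) :
    leafCoord φ X (φ x) = v := by
  rw [leafCoord_apply hx]
  refine (hφ.mfderiv_fst hx (X x)).trans ?_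
  rw [hX]
  exact congrArg Prod.fst (hφ.mfderiv_leafField hx v)

/-- Derivatives along leaves, in terms of the leafwise components of the field. -/
theorem dirDeriv_eq_fderiv {G : Type*} [NormedAddCommGroup G] [NormedSpace ℝ G] {x : M}
    (hx : x ∈ φ.source) {X : ∀ x : M, TangentSpace 𝓘(ℝ, E) x} (hX : X x ∈ T x) {g : M → G}
    (hg : MDifferentiableAt 𝓘(ℝ, E) 𝓘(ℝ, G) g x) :
    dirDeriv X g x = fderiv ℝ (g ∘ φ.symm) (φ x) (leafCoord φ X (φ x), 0) :=
  hφ.dirDeriv_eq hx hX hg (leafCoord_apply hx X).symm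

/-- Smooth functions near a point read in a chart. -/
theorem contDiffAt_comp_symm {G : Type*} [NormedAddCommGroup G] [NormedSpace ℝ G] {f : M → G}
    {z : Euc p × Euc q} (hz : z ∈ φ.target) (hf : ContMDiffAt 𝓘(ℝ, E) 𝓘(ℝ, G) ∞ f (φ.symm z)) :
    ContDiffAt ℝ ∞ (f ∘ φ.symm) z :=
  contMDiffAt_iff_contDiffAt.1 (ContMDiffAt.comp z hf
    (hφ.contMDiffOn_symm.contMDiffAt (φ.open_target.mem_nhds hz)))

theorem contMDiffAt_comp {G : Type*} [NormedAddCommGroup G] [NormedSpace ℝ G]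
    {f : Euc p × Euc q → G} {x : M} (hx : x ∈ φ.source) (hf : ContDiffAt ℝ ∞ f (φ x)) :
    ContMDiffAt 𝓘(ℝ, E) 𝓘(ℝ, G) ∞ (f ∘ φ) x :=
  ContMDiffAt.comp x hf.contMDiffAt (hφ.contMDiffAt hx)

variable [IsManifold 𝓘(ℝ, E) ∞ M]

/-- The leafwise components of a smooth field are smooth. -/
theorem contDiffAt_leafCoord (X : SmoothFields E M) {z : Euc p × Euc q} (hz : z ∈ φ.target) :
    ContDiffAt ℝ ∞ (leafCoord φ X) z :=
  hφ.contDiffAt_comp_symm hz ((contMDiffOn_dirDeriv X φ.open_source hφ.contMDiffOn_fst).contMDiffAt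
    (φ.open_source.mem_nhds (φ.map_target hz)))

/-- In a foliated chart the bracket of fields along the leaves is the bracket of their leafwise
components, on each plaque. -/
theorem leafCoord_mlieBracket [FiniteDimensional ℝ E] (X Y : SmoothFields E M)
    (hX : ∀ x, X x ∈ T x) (hY : ∀ x, Y x ∈ T x) {z : Euc p × Euc q} (hz : z ∈ φ.target) :
    leafCoord φ (mlieBracket 𝓘(ℝ, E) X Y) z =
      lieBracket ℝ (fun a => leafCoord φ X (a, z.2)) (fun a => leafCoord φ Y (a, z.2)) z.1 := by
  set x := φ.symm z with hxz
  have hx : x ∈ φ.source := φ.map_target hz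
  have hz' : φ x = z := φ.right_inv hz
  have key : ∀ X Y : SmoothFields E M, (∀ x, X x ∈ T x) →
      dirDeriv X (dirDeriv Y (fun y => (φ y).1)) x =
        fderiv ℝ (fun a => leafCoord φ Y (a, z.2)) z.1 (leafCoord φ X z) := by
    intro X Y hX
    have hY' := (contMDiffOn_dirDeriv Y φ.open_source hφ.contMDiffOn_fst).contMDiffAt
      (φ.open_source.mem_nhds hx)
    rw [hφ.dirDeriv_eq_fderiv hx (hX x) (hY'.mdifferentiableAt (by simp)), hz']
    have h := (HasFDerivAt.comp (f := fun a => (a, z.2)) z.1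
      ((hφ.contDiffAt_leafCoord Y hz).differentiableAt (by simp)).hasFDerivAt
      (hasFDerivAt_prodMk_left (𝕜 := ℝ) z.1 z.2)).fderiv
    exact (congrArg (fun A => A (leafCoord φ X z)) h).symm
  have hf : ContMDiffAt 𝓘(ℝ, E) 𝓘(ℝ, Euc p) ∞ (fun y => (φ y).1) x :=
    hφ.contMDiffOn_fst.contMDiffAt (φ.open_source.mem_nhds hx)
  refine (dirDeriv_mlieBracket X.contMDiff Y.contMDiff (hf.of_le ENat.LEInfty.out)).trans ?_
  rw [key X Y hX, key Y X hY]
  rfl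

end IsFoliatedChart

/-! ### Locality of the connection -/

noncomputable section Locality

variable {E : Type*} [NormedAddCommGroup E] [NormedSpace ℝ E] [FiniteDimensional ℝ E]
  {M : Type*} [TopologicalSpace M] [T2Space M] [SecondCountableTopology M] [ChartedSpace E M]
  [IsManifold 𝓘(ℝ, E) ∞ M]

/-- The value of a smooth section at a point, as a linear map. -/
def evalSection {E : Type*} [NormedAddCommGroup E] [NormedSpace ℝ E] {M : Type*}
    [TopologicalSpace M] [ChartedSpace E M] {W : Type*} [NormedAddCommGroup W] [NormedSpace ℝ W]
    {V : M → Type*} [TopologicalSpace (TotalSpace W V)] [∀ x, TopologicalSpace (V x)]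
    [FiberBundle W V] [∀ x, AddCommGroup (V x)] [∀ x, Module ℝ (V x)] [VectorBundle ℝ W V]
    (x : M) : Cₛ^∞⟮𝓘(ℝ, E); W, V⟯ →ₗ[ℝ] V x where
  toFun s := s x
  map_add' _ _ := rfl
  map_smul' _ _ := rfl

omit [FiniteDimensional ℝ E] [T2Space M] [SecondCountableTopology M] [IsManifold 𝓘(ℝ, E) ∞ M] in
theorem dirDeriv_clm_comp {G G' : Type*} [NormedAddCommGroup G] [NormedSpace ℝ G]
    [NormedAddCommGroup G'] [NormedSpace ℝ G'] (l : G →L[ℝ] G')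
    (X : ∀ x : M, TangentSpace 𝓘(ℝ, E) x) {f : M → G} {x : M}
    (hf : MDifferentiableAt 𝓘(ℝ, E) 𝓘(ℝ, G) f x) :
    dirDeriv X (fun y => l (f y)) x = l (dirDeriv X f x) :=
  congrArg (fun A : E →L[ℝ] G' => A (X x))
    (HasMFDerivAt.comp x l.hasFDerivAt.hasMFDerivAt hf.hasMFDerivAt).mfderiv

variable {p q : ℕ} {F : Foliation E M p q} {W : Type*} [NormedAddCommGroup W] [NormedSpace ℝ W]
  {V : M → Type*} [TopologicalSpace (TotalSpace W V)] [∀ x, TopologicalSpace (V x)]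
  [FiberBundle W V] [∀ x, AddCommGroup (V x)] [∀ x, Module ℝ (V x)] [VectorBundle ℝ W V]
  (D : FlatConnection F W V)

namespace FlatConnection

/-- `∇` is local in the section. -/
theorem nabla_congr_right (X : F.fields) {s t : Cₛ^∞⟮𝓘(ℝ, E); W, V⟯} {x : M}
    (h : ∀ᶠ y in 𝓝 x, s y = t y) : D.nabla X s x = D.nabla X t x := by
  obtain ⟨U, hUs, hU, hx⟩ := eventually_nhds_iff.1 h
  obtain ⟨ρ, hρ, hρU⟩ := exists_cutoff_nhds (E := E) hU hx
  have h0 : funSMul ρ s = funSMul ρ t := by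
    ext y
    change ρ y • s y = ρ y • t y
    by_cases hy : y ∈ U
    · rw [hUs y hy]
    · rw [image_eq_zero_of_notMem_tsupport fun h => hy (hρU h), zero_smul, zero_smul]
  have h1 := congrArg (evalSection x) (congrArg (D.nabla X) h0)
  rw [D.nabla_funSMul_right, D.nabla_funSMul_right] at h1
  change ρ x • D.nabla X s x + lieDeriv X.1 ρ x • s x =
    ρ x • D.nabla X t x + lieDeriv X.1 ρ x • t x at h1
  rwa [hρ.self_of_nhds, one_smul, one_smul, hUs x hx, add_left_inj] at h1

/-- `∇` is local in the vector field. -/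
theorem nabla_congr_left {X Y : F.fields} (s : Cₛ^∞⟮𝓘(ℝ, E); W, V⟯) {x : M}
    (h : ∀ᶠ y in 𝓝 x, X.1 y = Y.1 y) : D.nabla X s x = D.nabla Y s x := by
  obtain ⟨U, hUs, hU, hx⟩ := eventually_nhds_iff.1 h
  obtain ⟨ρ, hρ, hρU⟩ := exists_cutoff_nhds (E := E) hU hx
  have h0 : Foliation.fieldSMul ρ X = Foliation.fieldSMul ρ Y := by
    refine Subtype.ext (ContMDiffSection.ext fun y => ?_)
    change ρ y • X.1 y = ρ y • Y.1 y
    by_cases hy : y ∈ U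
    · rw [hUs y hy]
    · rw [image_eq_zero_of_notMem_tsupport fun h => hy (hρU h), zero_smul, zero_smul]
  have h1 := congrArg (evalSection x) (congrArg (fun Z => D.nabla Z s) h0)
  simp only [D.nabla_funSMul_left] at h1
  change ρ x • D.nabla X s x = ρ x • D.nabla Y s x at h1
  rwa [hρ.self_of_nhds, one_smul, one_smul] at h1

end FlatConnection

section LeafFields

variable {φ : OpenPartialHomeomorph M (Euc p × Euc q)} (hφ : IsFoliatedChart F.tangent φ)
  (ρ : C^∞⟮𝓘(ℝ, E), M; ℝ⟯) (hρ : tsupport ρ ⊆ φ.source)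

include hφ hρ

/-- The fields that are constant in a foliated chart, cut off by the function `ρ`. -/
noncomputable def cutLeafField : Euc p →ₗ[ℝ] F.fields where
  toFun v := ⟨cutSection ρ (fun x => leafField φ x v) φ.open_source hρ
      (hφ.contMDiffOn_leafField v), fun x => by
    by_cases hx : x ∈ φ.source
    · exact (F.tangent x).smul_mem _ (hφ.leafField_mem hx v)
    · have : ρ x = 0 := image_eq_zero_of_notMem_tsupport fun h => hx (hρ h)
      change ρ x • leafField φ x v ∈ _
      rw [this, zero_smul]
      exact (F.tangent x).zero_mem⟩
  map_add' v w := Subtype.ext (ContMDiffSection.ext fun x => by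
    change ρ x • leafField φ x (v + w) = ρ x • leafField φ x v + ρ x • leafField φ x w
    rw [map_add, smul_add])
  map_smul' c v := Subtype.ext (ContMDiffSection.ext fun x => by
    change ρ x • leafField φ x (c • v) = c • ρ x • leafField φ x v
    rw [map_smul, smul_comm])

omit [T2Space M] [SecondCountableTopology M] in
theorem cutLeafField_apply (v : Euc p) (x : M) :
    (cutLeafField hφ ρ hρ v).1 x = ρ x • leafField φ x v := rfl

/-- `∇` depends only on the value of the vector field at the point. -/
theorem FlatConnection.nabla_eq_nabla_cutLeafField (X : F.fields) (s : Cₛ^∞⟮𝓘(ℝ, E); W, V⟯) {x : M}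
    (hx : ∀ᶠ y in 𝓝 x, ρ y = 1) :
    D.nabla X s x = D.nabla (cutLeafField hφ ρ hρ (leafCoord φ X.1 (φ x))) s x := by
  have hxs : x ∈ φ.source := hρ (subset_tsupport _ (by
    rw [Function.mem_support, hx.self_of_nhds]; exact one_ne_zero))
  have hcoord : ContMDiffOn 𝓘(ℝ, E) 𝓘(ℝ, Euc p) ∞ (fun y => leafCoord φ X.1 (φ y)) φ.source :=
    fun y hy => (hφ.contMDiffAt_comp hy
      (hφ.contDiffAt_leafCoord X.1 (φ.map_source hy))).contMDiffWithinAt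
  -- Near `x` the field is a combination of cut off coordinate fields, with coefficients `h j`.
  let h : Fin p → C^∞⟮𝓘(ℝ, E), M; ℝ⟯ := fun j =>
    ⟨fun y => ρ y • (leafCoord φ X.1 (φ y)) j, contMDiff_cutoff_smul ρ φ.open_source hρ
      ((EuclideanSpace.proj (𝕜 := ℝ) j).contDiff.contMDiff.comp_contMDiffOn hcoord)⟩
  let b := (EuclideanSpace.basisFun (Fin p) ℝ).toBasis
  have hb : ∀ v : Euc p, ∑ j, v j • b j = v := fun v => by
    simpa [b] using b.sum_repr v
  have h1 : D.nabla X s x =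
      D.nabla (∑ j, Foliation.fieldSMul (h j) (cutLeafField hφ ρ hρ (b j))) s x := by
    refine D.nabla_congr_left s ?_
    filter_upwards [hx, φ.open_source.mem_nhds hxs] with y hy hys
    have h2 : (∑ j, Foliation.fieldSMul (h j) (cutLeafField hφ ρ hρ (b j))).1 y =
        ∑ j, (ρ y • (leafCoord φ X.1 (φ y)) j) • ρ y • leafField φ y (b j) := by
      refine (map_sum ((evalSection y).comp F.fields.subtype) _ _).trans ?_
      rfl
    rw [h2, hφ.eq_leafField_leafCoord hys (X.2 y)]
    simp only [hy, one_smul, ← map_smul, ← map_sum, hb]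
  rw [h1]
  refine (congrArg (evalSection x) ?_ : _ = evalSection x (∑ j,
    funSMul (h j) (D.nabla (cutLeafField hφ ρ hρ (b j)) s))).trans ?_
  · rw [map_sum, LinearMap.sum_apply]
    exact Finset.sum_congr rfl fun j _ => D.nabla_funSMul_left _ _ _
  · rw [map_sum]
    change ∑ j, (ρ x • (leafCoord φ X.1 (φ x)) j) • evalSection x (D.nabla _ s) = _
    simp only [hx.self_of_nhds, one_smul]
    have h3 : ∀ j, (leafCoord φ X.1 (φ x)) j • evalSection x
        (D.nabla (cutLeafField hφ ρ hρ (b j)) s) = (evalSection x ∘ₗ D.nabla.flip s ∘ₗ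
          cutLeafField hφ ρ hρ) ((leafCoord φ X.1 (φ x)) j • b j) := fun j => by
      rw [map_smul]; rfl
    simp only [h3]
    rw [← map_sum, hb]
    rfl

end LeafFields

end Locality

theorem fderiv_clm_apply_apply {Z P W G : Type*} [NormedAddCommGroup Z] [NormedSpace ℝ Z]
    [NormedAddCommGroup P] [NormedSpace ℝ P] [NormedAddCommGroup W] [NormedSpace ℝ W]
    [NormedAddCommGroup G] [NormedSpace ℝ G] {A : Z → P →L[ℝ] W →L[ℝ] G} {z : Z}
    (hA : DifferentiableAt ℝ A z) (v : P) (w : W) (u : Z) :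
    fderiv ℝ (fun z => A z v w) z u = fderiv ℝ A z u v w := by
  rw [((hA.hasFDerivAt.clm_apply (hasFDerivAt_const v z)).clm_apply
    (hasFDerivAt_const w z)).fderiv]
  simp

/-! ### The connection form and flat charts -/

noncomputable section Frames

variable {E : Type*} [NormedAddCommGroup E] [NormedSpace ℝ E] [FiniteDimensional ℝ E]
  {M : Type*} [TopologicalSpace M] [T2Space M] [SecondCountableTopology M] [ChartedSpace E M]
  [IsManifold 𝓘(ℝ, E) ∞ M] {p q : ℕ} {F : Foliation E M p q}
  {W : Type*} [NormedAddCommGroup W] [NormedSpace ℝ W] [FiniteDimensional ℝ W]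
  {V : M → Type*} [TopologicalSpace (TotalSpace W V)] [∀ x, TopologicalSpace (V x)]
  [FiberBundle W V] [∀ x, AddCommGroup (V x)] [∀ x, Module ℝ (V x)] [VectorBundle ℝ W V]
  [ContMDiffVectorBundle ∞ W V 𝓘(ℝ, E)] (D : FlatConnection F W V)
  (e : Trivialization W (TotalSpace.proj : TotalSpace W V → M)) [MemTrivializationAtlas e]

omit [FiniteDimensional ℝ E] [T2Space M] [SecondCountableTopology M] [IsManifold 𝓘(ℝ, E) ∞ M]
  [FiniteDimensional ℝ W] in
theorem contMDiffOn_symm_const (w : W) :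
    ContMDiffOn 𝓘(ℝ, E) (𝓘(ℝ, E).prod 𝓘(ℝ, W)) ∞
      (fun x => TotalSpace.mk' W x (e.symmₗ ℝ x w)) e.baseSet := by
  rw [e.contMDiffOn_section_baseSet_iff]
  refine (contMDiffOn_const (c := w)).congr fun x hx => ?_
  rw [e.symmₗ_apply hx, e.apply_mk_symm hx]

omit [FiniteDimensional ℝ E] [T2Space M] [SecondCountableTopology M] [IsManifold 𝓘(ℝ, E) ∞ M]
  [FiniteDimensional ℝ W] in
/-- A section is smooth if and only if it is smooth in a trivialization. -/
theorem contMDiffAt_section_iff_linearMapAt (s : ∀ x, V x) {x : M} (hx : x ∈ e.baseSet) :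
    ContMDiffAt 𝓘(ℝ, E) (𝓘(ℝ, E).prod 𝓘(ℝ, W)) ∞ (fun x => TotalSpace.mk' W x (s x)) x ↔
      ContMDiffAt 𝓘(ℝ, E) 𝓘(ℝ, W) ∞ (fun y => e.linearMapAt ℝ y (s y)) x := by
  rw [e.contMDiffAt_section_iff hx]
  refine Filter.EventuallyEq.contMDiffAt_iff ?_
  filter_upwards [e.open_baseSet.mem_nhds hx] with y hy
  rw [e.linearMapAt_apply, if_pos hy]

variable (ρ : C^∞⟮𝓘(ℝ, E), M; ℝ⟯)

/-- The sections that are constant in a trivialization, cut off by the function `ρ`. -/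
def cutFrame (hρ : tsupport ρ ⊆ e.baseSet) : W →ₗ[ℝ] Cₛ^∞⟮𝓘(ℝ, E); W, V⟯ where
  toFun w := cutSection ρ (fun x => e.symmₗ ℝ x w) e.open_baseSet hρ (contMDiffOn_symm_const e w)
  map_add' v w := ContMDiffSection.ext fun x => by
    change ρ x • e.symmₗ ℝ x (v + w) = ρ x • e.symmₗ ℝ x v + ρ x • e.symmₗ ℝ x w
    rw [map_add, smul_add]
  map_smul' c v := ContMDiffSection.ext fun x => by
    change ρ x • e.symmₗ ℝ x (c • v) = c • ρ x • e.symmₗ ℝ x v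
    rw [map_smul, smul_comm]

omit [FiniteDimensional ℝ E] [T2Space M] [SecondCountableTopology M] [IsManifold 𝓘(ℝ, E) ∞ M]
  [FiniteDimensional ℝ W] in
theorem linearMapAt_cutFrame (hρ : tsupport ρ ⊆ e.baseSet) (w : W) {x : M} (hx : ρ x = 1) :
    e.linearMapAt ℝ x (cutFrame e ρ hρ w x) = w := by
  have hxe : x ∈ e.baseSet := hρ (subset_tsupport _ (by
    rw [Function.mem_support, hx]; exact one_ne_zero))
  change e.linearMapAt ℝ x (ρ x • e.symmₗ ℝ x w) = w
  rw [hx, one_smul, e.linearMapAt_symmₗ hxe]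

variable {φ : OpenPartialHomeomorph M (Euc p × Euc q)} (hφ : IsFoliatedChart F.tangent φ)

/-- The connection form in a foliated chart and a trivialization, cut off by the function `ρ`. -/
def connectionForm (hρφ : tsupport ρ ⊆ φ.source) (hρe : tsupport ρ ⊆ e.baseSet) (x : M) :
    Euc p →ₗ[ℝ] W →ₗ[ℝ] W :=
  ((D.nabla ∘ₗ cutLeafField hφ ρ hρφ).compl₂ (cutFrame e ρ hρe)).compr₂
    (e.linearMapAt ℝ x ∘ₗ evalSection x)

omit [T2Space M] [SecondCountableTopology M] [FiniteDimensional ℝ W] in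
theorem connectionForm_apply (hρφ : tsupport ρ ⊆ φ.source) (hρe : tsupport ρ ⊆ e.baseSet) (x : M)
    (v : Euc p) (w : W) : connectionForm D e ρ hφ hρφ hρe x v w =
      e.linearMapAt ℝ x (D.nabla (cutLeafField hφ ρ hρφ v) (cutFrame e ρ hρe w) x) := rfl

/-- The connection in a foliated chart and a trivialization. -/
theorem linearMapAt_nabla (hρφ : tsupport ρ ⊆ φ.source) (hρe : tsupport ρ ⊆ e.baseSet)
    (X : F.fields) (s : Cₛ^∞⟮𝓘(ℝ, E); W, V⟯) {x : M} (hx : ∀ᶠ y in 𝓝 x, ρ y = 1) :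
    e.linearMapAt ℝ x (D.nabla X s x) = dirDeriv X.1 (fun y => e.linearMapAt ℝ y (s y)) x +
      connectionForm D e ρ hφ hρφ hρe x (leafCoord φ X.1 (φ x)) (e.linearMapAt ℝ x (s x)) := by
  have hmem : ∀ y, ρ y = 1 → y ∈ e.baseSet := fun y hy => hρe (subset_tsupport _ (by
    rw [Function.mem_support, hy]; exact one_ne_zero))
  have hes : ContMDiffOn 𝓘(ℝ, E) 𝓘(ℝ, W) ∞ (fun y => e.linearMapAt ℝ y (s y)) e.baseSet :=
    fun y hy => ((contMDiffAt_section_iff_linearMapAt e s hy).1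
      (s.contMDiff y)).contMDiffWithinAt
  set f : M → W := fun y => e.linearMapAt ℝ y (s y) with hf
  let b := Module.finBasis ℝ W
  let l : ∀ i, W →L[ℝ] ℝ := fun i => (b.coord i).toContinuousLinearMap
  have hb : ∀ w : W, ∑ i, l i w • b i = w := b.sum_repr
  -- Near `x` the section is a combination of cut off frame sections, with coefficients `c i`.
  let c : Fin (Module.finrank ℝ W) → C^∞⟮𝓘(ℝ, E), M; ℝ⟯ := fun i =>
    ⟨fun y => ρ y • l i (f y), contMDiff_cutoff_smul ρ e.open_baseSet hρe
      ((l i).contDiff.contMDiff.comp_contMDiffOn hes)⟩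
  have h1 : D.nabla X s x = D.nabla X (∑ i, funSMul (c i) (cutFrame e ρ hρe (b i))) x := by
    refine D.nabla_congr_right X ?_
    filter_upwards [hx] with y hy
    have h2 : (∑ i, funSMul (c i) (cutFrame e ρ hρe (b i))) y =
        ∑ i, (ρ y • l i (f y)) • ρ y • e.symmₗ ℝ y (b i) := map_sum (evalSection y) _ _
    rw [h2]
    simp only [hy, one_smul, ← map_smul, ← map_sum, hb]
    exact (e.symmₗ_linearMapAt (hmem y hy) (s y)).symm
  have h3 : D.nabla X s x = ∑ i, (ρ x • l i (f x)) • D.nabla X (cutFrame e ρ hρe (b i)) x +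
      ∑ i, dirDeriv X.1 (c i) x • cutFrame e ρ hρe (b i) x := by
    rw [h1, map_sum, ← Finset.sum_add_distrib]
    refine (map_sum (evalSection x) _ _).trans (Finset.sum_congr rfl fun i _ => ?_)
    rw [D.nabla_funSMul_right]
    rfl
  have h4 : ∀ i, dirDeriv X.1 (c i) x = l i (dirDeriv X.1 f x) := by
    intro i
    rw [← dirDeriv_clm_comp (l i) X.1 ((hes.contMDiffAt (e.open_baseSet.mem_nhds
      (hmem x hx.self_of_nhds))).mdifferentiableAt (by simp))]
    refine Filter.EventuallyEq.dirDeriv_eq ?_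
    filter_upwards [hx] with y hy
    change ρ y • l i (f y) = _
    rw [hy, one_smul]
  have h5 : ∀ i, D.nabla X (cutFrame e ρ hρe (b i)) x =
      D.nabla (cutLeafField hφ ρ hρφ (leafCoord φ X.1 (φ x))) (cutFrame e ρ hρe (b i)) x :=
    fun i => D.nabla_eq_nabla_cutLeafField hφ ρ hρφ X _ hx
  rw [h3, map_add, map_sum, map_sum, add_comm]
  simp only [h4, h5, map_smul, linearMapAt_cutFrame e ρ hρe _ hx.self_of_nhds, hb,
    hx.self_of_nhds, one_smul, ← connectionForm_apply]
  refine congrArg (dirDeriv X.1 f x + ·) ?_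
  change _ = connectionForm D e ρ hφ hρφ hρe x _ (f x)
  conv_rhs => rw [← hb (f x)]
  simp only [map_sum, map_smul]

/-- The connection form of a flat connection satisfies the structure equation. -/
theorem connectionForm_flat (hρφ : tsupport ρ ⊆ φ.source) (hρe : tsupport ρ ⊆ e.baseSet) {x : M}
    (hx : ∀ᶠ y in 𝓝 x, ρ y = 1) (v v' : Euc p) (w : W) :
    dirDeriv (cutLeafField hφ ρ hρφ v).1
        (fun y => connectionForm D e ρ hφ hρφ hρe y v' w) x -
      dirDeriv (cutLeafField hφ ρ hρφ v').1
        (fun y => connectionForm D e ρ hφ hρφ hρe y v w) x +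
      connectionForm D e ρ hφ hρφ hρe x v (connectionForm D e ρ hφ hρφ hρe x v' w) -
      connectionForm D e ρ hφ hρφ hρe x v' (connectionForm D e ρ hφ hρφ hρe x v w) = 0 := by
  have hmem : ∀ y, ρ y = 1 → y ∈ φ.source := fun y hy => hρφ (subset_tsupport _ (by
    rw [Function.mem_support, hy]; exact one_ne_zero))
  have hxφ := hmem x hx.self_of_nhds
  have hcoord : ∀ v y, ρ y = 1 → leafCoord φ (cutLeafField hφ ρ hρφ v).1 (φ y) = v :=
    fun v y hy => hφ.leafCoord_eq_of_eq_leafField (hmem y hy) (by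
      rw [cutLeafField_apply, hy, one_smul])
  have h1 := congrArg (fun s => e.linearMapAt ℝ x (s x)) (D.flat (cutLeafField hφ ρ hρφ v)
    (cutLeafField hφ ρ hρφ v') (cutFrame e ρ hρe w))
  -- Coordinate fields commute.
  have hbr : leafCoord φ (Foliation.bracket (cutLeafField hφ ρ hρφ v)
      (cutLeafField hφ ρ hρφ v')).1 (φ x) = 0 := by
    refine (hφ.leafCoord_mlieBracket _ _ (cutLeafField hφ ρ hρφ v).2 (cutLeafField hφ ρ hρφ v').2
      (φ.map_source hxφ)).trans ?_
    have hconst : ∀ v, (fun a => leafCoord φ (cutLeafField hφ ρ hρφ v).1 (a, (φ x).2))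
        =ᶠ[𝓝 (φ x).1] fun _ => v := by
      intro v
      have h2 : ∀ᶠ z in 𝓝 (φ x), leafCoord φ (cutLeafField hφ ρ hρφ v).1 z = v := by
        have h3 := (φ.symm.continuousAt (φ.map_source hxφ)).eventually
          (by rwa [φ.left_inv hxφ] : ∀ᶠ y in 𝓝 (φ.symm (φ x)), ρ y = 1)
        filter_upwards [h3, φ.open_target.mem_nhds (φ.map_source hxφ)] with z hz hzt
        rw [← φ.right_inv hzt]
        exact hcoord v _ hz
      exact (show Filter.Tendsto (fun a => (a, (φ x).2)) (𝓝 (φ x).1) (𝓝 ((φ x).1, (φ x).2)) from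
        Continuous.tendsto (by fun_prop) _).eventually h2
    rw [lieBracket, (hconst v).fderiv_eq, (hconst v').fderiv_eq]
    simp
  have hL : ∀ v v', e.linearMapAt ℝ x (D.nabla (cutLeafField hφ ρ hρφ v)
      (D.nabla (cutLeafField hφ ρ hρφ v') (cutFrame e ρ hρe w)) x) =
      dirDeriv (cutLeafField hφ ρ hρφ v).1 (fun y => connectionForm D e ρ hφ hρφ hρe y v' w) x +
      connectionForm D e ρ hφ hρφ hρe x v (connectionForm D e ρ hφ hρφ hρe x v' w) := by
    intro v v'
    rw [linearMapAt_nabla D e ρ hφ hρφ hρe _ _ hx, hcoord v x hx.self_of_nhds]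
    rfl
  have h0 : e.linearMapAt ℝ x (D.nabla (Foliation.bracket (cutLeafField hφ ρ hρφ v)
      (cutLeafField hφ ρ hρφ v')) (cutFrame e ρ hρe w) x) = 0 := by
    rw [D.nabla_eq_nabla_cutLeafField hφ ρ hρφ _ _ hx, hbr]
    simp only [map_zero, LinearMap.zero_apply]
    exact map_zero _
  rw [h0] at h1
  change 0 = e.linearMapAt ℝ x (D.nabla _ _ x - D.nabla _ _ x) at h1
  rw [map_sub, hL, hL] at h1
  rw [h1]
  abel

/-- A foliated chart together with a frame of the bundle for which the connection is the
derivative of functions along the leaves. -/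
structure FlatChart (D : FlatConnection F W V) where
  /-- The foliated chart. -/
  chart : OpenPartialHomeomorph M (Euc p × Euc q)
  isFoliatedChart : IsFoliatedChart F.tangent chart
  /-- The open set on which the frame is defined. -/
  dom : Set M
  isOpen_dom : IsOpen dom
  dom_subset : dom ⊆ chart.source
  /-- The coordinates of a vector in the frame. -/
  frame : ∀ x, V x →ₗ[ℝ] W
  bijective : ∀ x ∈ dom, Function.Bijective (frame x)
  contMDiffAt_iff : ∀ (s : ∀ x, V x), ∀ x ∈ dom,
    ContMDiffAt 𝓘(ℝ, E) (𝓘(ℝ, E).prod 𝓘(ℝ, W)) ∞ (fun x => TotalSpace.mk' W x (s x)) x ↔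
      ContMDiffAt 𝓘(ℝ, E) 𝓘(ℝ, W) ∞ (fun y => frame y (s y)) x
  frame_nabla : ∀ (X : F.fields) (s : Cₛ^∞⟮𝓘(ℝ, E); W, V⟯), ∀ x ∈ dom,
    frame x (D.nabla X s x) = dirDeriv X.1 (fun y => frame y (s y)) x

/-- Every foliated bundle is locally trivial as a foliated bundle: each point lies in the domain of
a flat chart. The frame of a trivialization is transformed by the solution of `dS = S A`, where `A`
is the connection form, into one that is constant for the connection. -/
theorem FlatChart.exists_mem_dom (m : M) : ∃ c : FlatChart D, m ∈ c.dom := by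
  obtain ⟨φ, hmφ, hφ⟩ := F.exists_chart m
  let e := trivializationAt W V m
  have hme : m ∈ e.baseSet := mem_baseSet_trivializationAt W V m
  set U := φ.source ∩ e.baseSet
  have hU : IsOpen U := φ.open_source.inter e.open_baseSet
  obtain ⟨ρ, hρ1, hρU⟩ := exists_cutoff_nhds (E := E) hU ⟨hmφ, hme⟩
  have hρφ : tsupport ρ ⊆ φ.source := hρU.trans Set.inter_subset_left
  have hρe : tsupport ρ ⊆ e.baseSet := hρU.trans Set.inter_subset_right
  let B : M → Euc p →ₗ[ℝ] W →ₗ[ℝ] W := connectionForm D e ρ hφ hρφ hρe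
  -- The connection form in coordinates, and a global smooth function that agrees with it near `m`.
  let A₀ : Euc p × Euc q → Euc p →L[ℝ] W →L[ℝ] W := fun z =>
    (LinearMap.toContinuousLinearMap (LinearMap.toContinuousLinearMap.toLinearMap ∘ₗ B (φ.symm z)))
  set Uz := φ.target ∩ φ.symm ⁻¹' U
  have hUz : IsOpen Uz := φ.isOpen_inter_preimage_symm hU
  have hBs : ∀ v w, ∀ x ∈ e.baseSet, ContMDiffAt 𝓘(ℝ, E) 𝓘(ℝ, W) ∞ (fun y => B y v w) x :=
    fun v w x hx => (contMDiffAt_section_iff_linearMapAt e _ hx).1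
      ((D.nabla (cutLeafField hφ ρ hρφ v) (cutFrame e ρ hρe w)).contMDiff x)
  have hA₀ : ContDiffOn ℝ ∞ A₀ Uz := by
    refine contDiffOn_clm_apply.2 fun v => contDiffOn_clm_apply.2 fun w z hz => ?_
    exact (hφ.contDiffAt_comp_symm hz.1 (hBs v w _ hz.2.2)).contDiffWithinAt
  have hmz : φ m ∈ Uz := ⟨φ.map_source hmφ, by
    rw [Set.mem_preimage, φ.left_inv hmφ]; exact ⟨hmφ, hme⟩⟩
  obtain ⟨χ, hχ1, hχU⟩ := exists_cutoff_nhds (E := Euc p × Euc q) hUz hmz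
  let A : Euc p × Euc q → Euc p →L[ℝ] W →L[ℝ] W := fun z => χ z • A₀ z
  have hA : ContDiff ℝ ∞ A :=
    contMDiff_iff_contDiff.1 (contMDiff_cutoff_smul χ hUz hχU hA₀.contMDiffOn)
  have hρz : ∀ᶠ z in 𝓝 (φ m), ∀ᶠ y in 𝓝 (φ.symm z), ρ y = 1 :=
    (φ.symm.continuousAt (φ.map_source hmφ)).eventually
      (by rw [φ.left_inv hmφ]; exact hρ1.eventually_nhds)
  obtain ⟨r, hr, hball⟩ := Metric.eventually_nhds_iff_ball.1
    ((hρz.and hχ1.eventually_nhds).and (hUz.mem_nhds hmz))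
  have hAB : ∀ z ∈ Metric.ball (φ m) r, ∀ v w, A z v w = B (φ.symm z) v w := by
    intro z hz v w
    change (χ z • A₀ z) v w = _
    rw [(hball z hz).1.2.self_of_nhds, one_smul]
    rfl
  have hflat : ∀ z ∈ Metric.ball (φ m) r, ∀ v v' : Euc p,
      fderiv ℝ A z (v, 0) v' - fderiv ℝ A z (v', 0) v + A z v * A z v' - A z v' * A z v = 0 := by
    intro z hz v v'
    obtain ⟨⟨hρz, hχz⟩, hzU⟩ := hball z hz
    have hx : φ.symm z ∈ φ.source := φ.map_target hzU.1
    have hd : ∀ v v' w, dirDeriv (cutLeafField hφ ρ hρφ v).1 (fun y => B y v' w) (φ.symm z) =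
        fderiv ℝ A z (v, 0) v' w := by
      intro v v' w
      rw [hφ.dirDeriv_eq hx ((cutLeafField hφ ρ hρφ v).2 _)
        ((hBs v' w _ hzU.2.2).mdifferentiableAt (by simp)) (v := v) ?_, φ.right_inv hzU.1]
      · have h1 : (fun y => B y v' w) ∘ φ.symm =ᶠ[𝓝 z] fun z => A z v' w := by
          filter_upwards [Metric.isOpen_ball.mem_nhds hz] with z' hz'
          exact (hAB z' hz' v' w).symm
        rw [h1.fderiv_eq, fderiv_clm_apply_apply (hA.differentiable (by simp) z)]
      · rw [← IsFoliatedChart.leafCoord_apply hx]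
        exact hφ.leafCoord_eq_of_eq_leafField hx (by
          rw [cutLeafField_apply, hρz.self_of_nhds, one_smul])
    ext w
    have := connectionForm_flat D e ρ hφ hρφ hρe hρz v v' w
    rw [← show B = connectionForm D e ρ hφ hρφ hρe from rfl] at this
    rw [hd, hd] at this
    simp only [← hAB z hz] at this
    exact this
  obtain ⟨S, r', hr', hrr', hS⟩ := exists_flat_frame hA (φ m) hr hflat
  have hdomo : IsOpen (φ.source ∩ φ ⁻¹' Metric.ball (φ m) r') :=
    φ.isOpen_inter_preimage Metric.isOpen_ball
  have hdome : ∀ x ∈ φ.source ∩ φ ⁻¹' Metric.ball (φ m) r', x ∈ e.baseSet ∧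
      ∀ᶠ y in 𝓝 x, ρ y = 1 := by
    intro x hx
    have := hball (φ x) (Metric.ball_subset_ball hrr' hx.2)
    rw [φ.left_inv hx.1] at this
    refine ⟨?_, this.1.1⟩
    have h := this.2.2.2
    rwa [φ.left_inv hx.1] at h
  refine ⟨⟨φ, hφ, φ.source ∩ φ ⁻¹' Metric.ball (φ m) r', hdomo, Set.inter_subset_left,
    fun x => (S (φ x)).toLinearMap ∘ₗ e.linearMapAt ℝ x, fun x hx => ?_, fun s x hx => ?_,
    fun X s x hx => ?_⟩, hmφ, Metric.mem_ball_self hr'⟩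
  · have h1 : Function.Bijective (S (φ x)) := by
      obtain ⟨u, hu⟩ := (hS _ hx.2).2.1
      rw [← hu]
      exact Function.bijective_iff_has_inverse.2 ⟨(↑u⁻¹ : W →L[ℝ] W),
        fun w => congrArg (fun T : W →L[ℝ] W => T w) u.inv_mul,
        fun w => congrArg (fun T : W →L[ℝ] W => T w) u.mul_inv⟩
    refine h1.comp ?_
    rw [e.linearMapAt_def_of_mem (hdome x hx).1]
    exact (e.linearEquivAt ℝ x _).bijective
  · have hSx := hS _ hx.2
    rw [contMDiffAt_section_iff_linearMapAt e s (hdome x hx).1]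
    refine ⟨fun h => (hφ.contMDiffAt_comp hx.1 hSx.1).clm_apply h, fun h => ?_⟩
    obtain ⟨u, hu⟩ := hSx.2.1
    have hinv' : ContDiffAt ℝ ∞ (Ring.inverse : (W →L[ℝ] W) → W →L[ℝ] W) (S (φ x)) :=
      hu ▸ contDiffAt_ringInverse ℝ u
    have hinv : ContDiffAt ℝ ∞ (fun z => Ring.inverse (S z)) (φ x) := hinv'.comp (φ x) hSx.1
    refine ((hφ.contMDiffAt_comp hx.1 hinv).clm_apply h).congr_of_eventuallyEq ?_
    filter_upwards [hdomo.mem_nhds hx] with y hy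
    exact (congrArg (fun T : W →L[ℝ] W => T (e.linearMapAt ℝ y (s y)))
      (Ring.inverse_mul_cancel _ (hS _ hy.2).2.1)).symm
  · have hSx := hS _ hx.2
    have hf : ContMDiffAt 𝓘(ℝ, E) 𝓘(ℝ, W) ∞ (fun y => e.linearMapAt ℝ y (s y)) x :=
      (contMDiffAt_section_iff_linearMapAt e s (hdome x hx).1).1 (s.contMDiff x)
    have hf' := hφ.contDiffAt_comp_symm (φ.map_source hx.1) (by rwa [φ.left_inv hx.1])
    change S (φ x) (e.linearMapAt ℝ x (D.nabla X s x)) = _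
    rw [linearMapAt_nabla D e ρ hφ hρφ hρe X s (hdome x hx).2,
      hφ.dirDeriv_eq_fderiv hx.1 (X.2 x) (hf.mdifferentiableAt (by simp))]
    refine Eq.trans ?_ (hφ.dirDeriv_eq_fderiv (g := fun y => S (φ y) (e.linearMapAt ℝ y (s y)))
      hx.1 (X.2 x) (((hφ.contMDiffAt_comp hx.1 hSx.1).clm_apply hf).mdifferentiableAt
        (by simp))).symm
    have h1 : (fun y => S (φ y) (e.linearMapAt ℝ y (s y))) ∘ φ.symm =ᶠ[𝓝 (φ x)]
        fun z => S z (((fun y => e.linearMapAt ℝ y (s y)) ∘ φ.symm) z) := by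
      filter_upwards [φ.open_target.mem_nhds (φ.map_source hx.1)] with z hz
      simp only [Function.comp_apply, φ.right_inv hz]
    have h2 := ((hSx.1.differentiableAt (by simp)).hasFDerivAt.clm_apply
      (hf'.differentiableAt (by simp)).hasFDerivAt).fderiv
    have h3 := congrArg (fun T => T (leafCoord φ X.1 (φ x), (0 : Euc q)))
      (h1.fderiv_eq.trans h2)
    refine Eq.trans ?_ h3.symm
    have h4 := hSx.2.2 (leafCoord φ X.1 (φ x))
    have h5 := hAB _ (Metric.ball_subset_ball hrr' hx.2) (leafCoord φ X.1 (φ x))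
      (e.linearMapAt ℝ x (s x))
    rw [φ.left_inv hx.1] at h5
    change _ = S (φ x) _ + fderiv ℝ S (φ x) (leafCoord φ X.1 (φ x), 0)
      (e.linearMapAt ℝ (φ.symm (φ x)) (s (φ.symm (φ x))))
    rw [h4, φ.left_inv hx.1, map_add]
    exact congrArg (S (φ x) _ + S (φ x) ·) h5.symm

end Frames

/-! ### Smooth families of alternating maps -/

section AlternatingMaps

variable {p k : ℕ} {W : Type*} [NormedAddCommGroup W] [NormedSpace ℝ W]

/-- A multilinear map on a Euclidean space, expanded in coordinates. -/
theorem MultilinearMap.apply_eq_sum_euclidean {W : Type*} [AddCommGroup W] [Module ℝ W]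
    (f : MultilinearMap ℝ (fun _ : Fin k => Euc p) W) (v : Fin k → Euc p) :
    f v = ∑ r : Fin k → Fin p,
      (∏ i, v i (r i)) • f (fun i => EuclideanSpace.basisFun (Fin p) ℝ (r i)) := by
  let b := EuclideanSpace.basisFun (Fin p) ℝ
  conv_lhs => rw [show v = fun i => ∑ j, v i j • b j from
    funext fun i => (by simpa [b] using (b.toBasis.sum_repr (v i)).symm)]
  rw [f.map_sum]
  exact Finset.sum_congr rfl fun r _ => f.map_smul_univ _ _

theorem MultilinearMap.continuous_of_euclidean (f : MultilinearMap ℝ (fun _ : Fin k => Euc p) W) :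
    Continuous f := by
  rw [show (f : (Fin k → Euc p) → W) = _ from funext f.apply_eq_sum_euclidean]
  fun_prop

/-- An alternating map on a Euclidean space is continuous. -/
def AlternatingMap.toContinuous (f : Euc p [⋀^Fin k]→ₗ[ℝ] W) : Euc p [⋀^Fin k]→L[ℝ] W :=
  { f with cont := f.toMultilinearMap.continuous_of_euclidean }

/-- A family of alternating maps is smooth if its values on fixed vectors are. -/
theorem contDiffAt_continuousAlternatingMap [FiniteDimensional ℝ W] {Z : Type*}
    [NormedAddCommGroup Z] [NormedSpace ℝ Z] {f : Z → Euc p [⋀^Fin k]→L[ℝ] W} {z : Z} {n : ℕ∞ω}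
    (h : ∀ v, ContDiffAt ℝ n (fun z => f z v) z) : ContDiffAt ℝ n f z := by
  let b := EuclideanSpace.basisFun (Fin p) ℝ
  let L : (Euc p [⋀^Fin k]→L[ℝ] W) →ₗ[ℝ] ((Fin k → Fin p) → W) :=
    { toFun := fun a r => a (fun i => b (r i))
      map_add' := fun _ _ => rfl
      map_smul' := fun _ _ => rfl }
  have hL : LinearMap.ker L = ⊥ := by
    refine LinearMap.ker_eq_bot'.2 fun a ha => ?_
    refine ContinuousAlternatingMap.toAlternatingMap_injective ?_
    refine AlternatingMap.coe_multilinearMap_injective (Module.Basis.ext_multilinear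
      (fun _ => b.toBasis) fun r => ?_)
    have h : a (fun i => b (r i)) = 0 := congrFun ha r
    simpa [b] using h
  obtain ⟨g, hg⟩ := L.exists_leftInverse_of_injective hL
  have hf : f = fun z => g.toContinuousLinearMap (L (f z)) :=
    funext fun z => (congrArg (fun T => T (f z)) hg).symm
  rw [hf]
  exact g.toContinuousLinearMap.contDiff.contDiffAt.comp z (contDiffAt_pi.2 fun r => h _)

theorem ContDiffAt.continuousAlternatingMap_apply {Z : Type*}
    [NormedAddCommGroup Z] [NormedSpace ℝ Z] {f : Z → Euc p [⋀^Fin k]→L[ℝ] W} {z : Z} {n : ℕ∞ω}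
    (hf : ContDiffAt ℝ n f z) {v : Fin k → Z → Euc p} (hv : ∀ i, ContDiffAt ℝ n (v i) z) :
    ContDiffAt ℝ n (fun z => f z fun i => v i z) z := by
  rw [show (fun z => f z fun i => v i z) = _ from funext fun z =>
    (f z).toMultilinearMap.apply_eq_sum_euclidean fun i => v i z]
  refine ContDiffAt.sum fun r _ => ContDiffAt.smul (contDiffAt_prod fun i _ => ?_) ?_
  · exact (EuclideanSpace.proj (𝕜 := ℝ) (r i)).contDiff.contDiffAt.comp z (hv i)
  · let w : Fin k → Euc p := fun i => EuclideanSpace.basisFun (Fin p) ℝ (r i)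
    exact (ContinuousAlternatingMap.apply ℝ (Euc p) W w).contDiff.contDiffAt.comp z hf

end AlternatingMaps

/-! ### Foliated forms in flat charts -/

noncomputable section LocalForms

variable {E : Type*} [NormedAddCommGroup E] [NormedSpace ℝ E] [FiniteDimensional ℝ E]
  {M : Type*} [TopologicalSpace M] [T2Space M] [SecondCountableTopology M] [ChartedSpace E M]
  [IsManifold 𝓘(ℝ, E) ∞ M] {p q : ℕ} {F : Foliation E M p q}

/-- There are global fields with given constant coordinates near a point of a foliated chart. -/
theorem IsFoliatedChart.exists_fields {φ : OpenPartialHomeomorph M (Euc p × Euc q)}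
    (hφ : IsFoliatedChart F.tangent φ) {x : M} (hx : x ∈ φ.source) :
    ∃ L : Euc p → F.fields, ∀ v, ∀ᶠ y in 𝓝 x, leafCoord φ (L v).1 (φ y) = v := by
  obtain ⟨ρ, hρ1, hρ⟩ := exists_cutoff_nhds (E := E) φ.open_source hx
  refine ⟨cutLeafField hφ ρ hρ, fun v => ?_⟩
  filter_upwards [hρ1, φ.open_source.mem_nhds hx] with y hy hys
  exact hφ.leafCoord_eq_of_eq_leafField hys (by rw [cutLeafField_apply, hy, one_smul])

variable {W : Type*} [NormedAddCommGroup W] [NormedSpace ℝ W] [FiniteDimensional ℝ W]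
  {V : M → Type*} [TopologicalSpace (TotalSpace W V)] [∀ x, TopologicalSpace (V x)]
  [FiberBundle W V] [∀ x, AddCommGroup (V x)] [∀ x, Module ℝ (V x)] [VectorBundle ℝ W V]
  [ContMDiffVectorBundle ∞ W V 𝓘(ℝ, E)] {D : FlatConnection F W V} (c : FlatChart D) {k : ℕ}

namespace FlatChart

/-- The part of the model space that corresponds to the domain of the frame. -/
def target : Set (Euc p × Euc q) := c.chart.target ∩ c.chart.symm ⁻¹' c.dom

theorem isOpen_target : IsOpen c.target := c.chart.isOpen_inter_preimage_symm c.isOpen_dom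

theorem mem_target {x : M} (hx : x ∈ c.dom) : c.chart x ∈ c.target :=
  ⟨c.chart.map_source (c.dom_subset hx), by
    rwa [Set.mem_preimage, c.chart.left_inv (c.dom_subset hx)]⟩

open Classical in
/-- The tangent vector of the leaf through `x` with given coordinates in the chart (and `0` if `x`
is not in the domain of the chart). -/
def tangentMap (x : M) : Euc p →ₗ[ℝ] F.tangent x :=
  if h : x ∈ c.chart.source then
    (leafField c.chart x).codRestrict _ (c.isFoliatedChart.leafField_mem h)
  else 0

theorem coe_tangentMap {x : M} (hx : x ∈ c.dom) (v : Euc p) :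
    (c.tangentMap x v : TangentSpace 𝓘(ℝ, E) x) = leafField c.chart x v := by
  rw [tangentMap, dif_pos (c.dom_subset hx)]
  rfl

theorem tangentMap_leafCoord {x : M} (hx : x ∈ c.dom) (X : F.fields) :
    c.tangentMap x (leafCoord c.chart X.1 (c.chart x)) = ⟨X.1 x, X.2 x⟩ :=
  Subtype.ext ((c.coe_tangentMap hx _).trans
    (c.isFoliatedChart.eq_leafField_leafCoord (c.dom_subset hx) (X.2 x)).symm)

theorem exists_eq_tangentMap {x : M} (hx : x ∈ c.dom) (w : F.tangent x) :
    ∃ v, c.tangentMap x v = w :=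
  ⟨_, Subtype.ext ((c.coe_tangentMap hx _).trans
    (c.isFoliatedChart.eq_leafField (c.dom_subset hx) w.2 rfl).symm)⟩

/-- A family of alternating maps on the leaves, read in a flat chart. -/
def localForm (α : ∀ x, F.tangent x [⋀^Fin k]→ₗ[ℝ] V x) (z : Euc p × Euc q) :
    Euc p [⋀^Fin k]→L[ℝ] W :=
  ((c.frame (c.chart.symm z)).compAlternatingMap
    ((α (c.chart.symm z)).compLinearMap (c.tangentMap (c.chart.symm z)))).toContinuous

theorem localForm_apply (α : ∀ x, F.tangent x [⋀^Fin k]→ₗ[ℝ] V x) (z : Euc p × Euc q)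
    (v : Fin k → Euc p) : c.localForm α z v = c.frame (c.chart.symm z)
      (α (c.chart.symm z) fun i => c.tangentMap (c.chart.symm z) (v i)) := rfl

theorem localForm_chart_apply (α : ∀ x, F.tangent x [⋀^Fin k]→ₗ[ℝ] V x) {x : M}
    (hx : x ∈ c.dom) (v : Fin k → Euc p) :
    c.localForm α (c.chart x) v = c.frame x (α x fun i => c.tangentMap x (v i)) := by
  rw [localForm_apply, c.chart.left_inv (c.dom_subset hx)]

/-- A family of alternating maps at a point of a flat chart is determined by its coordinates. -/
theorem localForm_injective {α β : ∀ x, F.tangent x [⋀^Fin k]→ₗ[ℝ] V x} {x : M} (hx : x ∈ c.dom)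
    (h : c.localForm α (c.chart x) = c.localForm β (c.chart x)) : α x = β x := by
  ext w
  choose v hv using fun i => c.exists_eq_tangentMap hx (w i)
  refine (c.bijective x hx).1 ?_
  have h1 := congrArg (fun a => a v) h
  simpa only [c.localForm_chart_apply _ hx, hv] using h1

/-- The value of a form on fields, in terms of the coordinates of both in a flat chart. -/
theorem frame_evalForm (α : FoliatedForms F W V k) (X : Fin k → F.fields) {x : M} (hx : x ∈ c.dom) :
    c.frame x (evalForm X α x) =
      c.localForm α.1 (c.chart x) fun i => leafCoord c.chart (X i).1 (c.chart x) := by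
  rw [c.localForm_chart_apply _ hx]
  simp only [c.tangentMap_leafCoord hx]
  rfl

theorem exists_fields {x : M} (hx : x ∈ c.dom) :
    ∃ L : Euc p → F.fields, ∀ v, ∀ᶠ y in 𝓝 x, leafCoord c.chart (L v).1 (c.chart y) = v :=
  c.isFoliatedChart.exists_fields (c.dom_subset hx)

theorem eventually_symm {z : Euc p × Euc q} (hz : z ∈ c.target) {P : M → Prop}
    (h : ∀ᶠ y in 𝓝 (c.chart.symm z), P y) : ∀ᶠ z' in 𝓝 z, P (c.chart.symm z') :=
  (c.chart.symm.continuousAt hz.1).eventually h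

theorem contDiffAt_frame (s : Cₛ^∞⟮𝓘(ℝ, E); W, V⟯) {z : Euc p × Euc q} (hz : z ∈ c.target) :
    ContDiffAt ℝ ∞ ((fun y => c.frame y (s y)) ∘ c.chart.symm) z :=
  c.isFoliatedChart.contDiffAt_comp_symm hz.1 ((c.contMDiffAt_iff s _ hz.2).1 (s.contMDiff _))

theorem contDiffAt_localForm (α : FoliatedForms F W V k) {z : Euc p × Euc q} (hz : z ∈ c.target) :
    ContDiffAt ℝ ∞ (c.localForm α.1) z := by
  refine contDiffAt_continuousAlternatingMap fun v => ?_
  obtain ⟨L, hL⟩ := c.exists_fields hz.2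
  refine (c.contDiffAt_frame (evalForm (fun i => L (v i)) α) hz).congr_of_eventuallyEq ?_
  filter_upwards [c.eventually_symm hz (Filter.eventually_all.2 fun i => hL (v i)),
    c.isOpen_target.mem_nhds hz] with z' h hz'
  have h1 := c.frame_evalForm α (fun i => L (v i)) hz'.2
  simp only [h] at h1
  rw [c.chart.right_inv hz'.1] at h1
  exact h1.symm

/-- A family of alternating maps is smooth if it is in flat charts. -/
theorem contMDiffAt_of_localForm {α : ∀ x, F.tangent x [⋀^Fin k]→ₗ[ℝ] V x} {x : M}
    (hx : x ∈ c.dom) (h : ContDiffAt ℝ ∞ (c.localForm α) (c.chart x)) (X : Fin k → F.fields) :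
    ContMDiffAt 𝓘(ℝ, E) (𝓘(ℝ, E).prod 𝓘(ℝ, W)) ∞
      (fun x => TotalSpace.mk' W x (α x fun i => ⟨(X i).1 x, (X i).2 x⟩)) x := by
  rw [c.contMDiffAt_iff _ x hx]
  have h1 : ContDiffAt ℝ ∞
      (fun z => c.localForm α z fun i => leafCoord c.chart (X i).1 z) (c.chart x) := by
    refine h.continuousAlternatingMap_apply fun i => ?_
    exact c.isFoliatedChart.contDiffAt_leafCoord _ (c.mem_target hx).1
  refine (c.isFoliatedChart.contMDiffAt_comp (c.dom_subset hx) h1).congr_of_eventuallyEq ?_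
  filter_upwards [c.isOpen_dom.mem_nhds hx] with y hy
  refine Eq.trans ?_ (c.localForm_chart_apply α hy _).symm
  simp only [c.tangentMap_leafCoord hy]

end FlatChart

end LocalForms

/-! ### The Koszul formula in flat charts -/

noncomputable section Koszul

/-- The double sum over `i < j` in terms of `i ≤ j'`, where `j = j' + 1`. -/
theorem Fin.sum_ite_castSucc_lt {A : Type*} [AddCommMonoid A] {n : ℕ}
    (f : Fin (n + 1) → Fin (n + 2) → A) :
    (∑ i : Fin (n + 1), ∑ j : Fin (n + 2), if i.castSucc < j then f i j else 0) =
      ∑ i : Fin (n + 1), ∑ j ≥ i, f i j.succ := by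
  refine Finset.sum_congr rfl fun i _ => ?_
  rw [Fin.sum_univ_succ, if_neg (Fin.not_lt_zero _), zero_add]
  simp only [Fin.castSucc_lt_succ_iff]
  rw [← Finset.sum_filter]
  exact Finset.sum_congr (by ext; simp) fun _ _ => rfl

theorem Fin.removeNth_removeNth_succ {A : Type*} {n : ℕ} (X : Fin (n + 2) → A) {i j : Fin (n + 1)}
    (h : i ≤ j) : i.removeNth (j.succ.removeNth X) = j.removeNth (i.castSucc.removeNth X) := by
  have h2 := Fin.removeNth_removeNth_eq_swap X i j.succ
  rw [h2, Fin.succAbove_of_castSucc_lt _ _ (Fin.castSucc_lt_succ_iff.2 h),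
    Fin.predAbove_of_castSucc_lt _ _ (Fin.castSucc_lt_succ_iff.2 h), Fin.pred_succ]

/-- The signs of `extDeriv` are integers, those of the Koszul formula are real numbers. -/
theorem neg_one_pow_smul_int {A : Type*} [AddCommGroup A] [Module ℝ A] (n : ℕ) (a : A) :
    (-1 : ℤ) ^ n • a = (-1 : ℝ) ^ n • a := by
  rcases n.even_or_odd with h | h <;> simp [h]

variable {E : Type*} [NormedAddCommGroup E] [NormedSpace ℝ E] [FiniteDimensional ℝ E]
  {M : Type*} [TopologicalSpace M] [T2Space M] [SecondCountableTopology M] [ChartedSpace E M]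
  [IsManifold 𝓘(ℝ, E) ∞ M] {p q : ℕ} {F : Foliation E M p q}
  {W : Type*} [NormedAddCommGroup W] [NormedSpace ℝ W] [FiniteDimensional ℝ W]
  {V : M → Type*} [TopologicalSpace (TotalSpace W V)] [∀ x, TopologicalSpace (V x)]
  [FiberBundle W V] [∀ x, AddCommGroup (V x)] [∀ x, Module ℝ (V x)] [VectorBundle ℝ W V]
  [ContMDiffVectorBundle ∞ W V 𝓘(ℝ, E)] {D : FlatConnection F W V} (c : FlatChart D) {k : ℕ}

namespace FlatChart

/-- In a flat chart, `∇` differentiates the coordinate expression of `α(X₁, …, X_k)` along the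
plaque. -/
theorem frame_nabla_evalForm (Y : F.fields) (α : FoliatedForms F W V k) (X : Fin k → F.fields)
    {x : M} (hx : x ∈ c.dom) :
    c.frame x (D.nabla Y (evalForm X α) x) =
      fderiv ℝ (fun a => c.localForm α.1 (a, (c.chart x).2)
        fun i => leafCoord c.chart (X i).1 (a, (c.chart x).2)) (c.chart x).1
        (leafCoord c.chart Y.1 (c.chart x)) := by
  have hxs := c.dom_subset hx
  have hz := c.mem_target hx
  have hg : ContMDiffAt 𝓘(ℝ, E) 𝓘(ℝ, W) ∞ (fun y => c.frame y (evalForm X α y)) x :=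
    (c.contMDiffAt_iff _ x hx).1 ((evalForm X α).contMDiff x)
  rw [c.frame_nabla Y _ x hx, c.isFoliatedChart.dirDeriv_eq_fderiv hxs (Y.2 x)
    (hg.mdifferentiableAt (by simp))]
  have h1 : ((fun y => c.frame y (evalForm X α y)) ∘ c.chart.symm) =ᶠ[𝓝 (c.chart x)]
      fun z => c.localForm α.1 z fun i => leafCoord c.chart (X i).1 z := by
    filter_upwards [c.isOpen_target.mem_nhds hz] with z hz'
    refine (c.frame_evalForm α X hz'.2).trans ?_
    rw [c.chart.right_inv hz'.1]
  have h2 : DifferentiableAt ℝ (fun z => c.localForm α.1 z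
      fun i => leafCoord c.chart (X i).1 z) (c.chart x) :=
    ((c.contDiffAt_localForm α hz).continuousAlternatingMap_apply fun i =>
      c.isFoliatedChart.contDiffAt_leafCoord (X i).1 hz.1).differentiableAt (by simp)
  rw [h1.fderiv_eq]
  have h3 := (HasFDerivAt.comp (f := fun a => (a, (c.chart x).2)) (c.chart x).1 h2.hasFDerivAt
    (hasFDerivAt_prodMk_left (𝕜 := ℝ) (c.chart x).1 (c.chart x).2)).fderiv
  exact (congrArg (fun A => A (leafCoord c.chart Y.1 (c.chart x))) h3).symm

/-- In a flat chart, the Koszul formula computes minus the exterior derivative along the leaves. -/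
theorem frame_koszul (α : FoliatedForms F W V k) (X : Fin (k + 1) → F.fields) {x : M}
    (hx : x ∈ c.dom) :
    c.frame x (koszul D X α x) = -sliceExtDeriv (c.localForm α.1) (c.chart x)
      fun i => leafCoord c.chart (X i).1 (c.chart x) := by
  have hz := c.mem_target hx
  set z := c.chart x with hzx
  let θ : Euc p → Euc p [⋀^Fin k]→L[ℝ] W := fun a => c.localForm α.1 (a, z.2)
  let Z : Fin (k + 1) → Euc p → Euc p := fun i a => leafCoord c.chart (X i).1 (a, z.2)
  have hslice : ContDiffAt ℝ ∞ (fun a : Euc p => (a, z.2)) z.1 :=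
    contDiffAt_id.prodMk contDiffAt_const
  have hθ : DifferentiableAt ℝ θ z.1 :=
    (ContDiffAt.comp (f := fun a : Euc p => (a, z.2)) z.1 (c.contDiffAt_localForm α hz)
      hslice).differentiableAt (by simp)
  have hZ : ∀ i, DifferentiableAt ℝ (Z i) z.1 := fun i =>
    (ContDiffAt.comp (f := fun a : Euc p => (a, z.2)) z.1
      (c.isFoliatedChart.contDiffAt_leafCoord (X i).1 hz.1) hslice).differentiableAt (by simp)
  have hn : ∀ i : Fin (k + 1), c.frame x (D.nabla (X i) (evalForm (i.removeNth X) α) x) =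
      fderiv ℝ (fun a => θ a (i.removeNth (Z · a))) z.1 (Z i z.1) := fun i =>
    c.frame_nabla_evalForm (X i) α _ hx
  let L : Cₛ^∞⟮𝓘(ℝ, E); W, V⟯ →ₗ[ℝ] W := c.frame x ∘ₗ evalSection x
  change L (koszul D X α) = -extDeriv θ z.1 fun i => Z i z.1
  cases k with
  | zero =>
    rw [extDeriv_apply_vectorField_of_pairwise_commute hθ hZ
      fun i j h => (h (Subsingleton.elim (α := Fin 1) i j)).elim]
    rw [Fin.sum_univ_one]
    refine (map_neg L _).trans (congrArg Neg.neg ?_)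
    refine Eq.trans ?_ ((hn 0).trans (by simp))
    change L (D.nabla (X 0) (evalForm ![] α)) = L (D.nabla (X 0) (evalForm _ α))
    rw [Subsingleton.elim (Fin.removeNth 0 X) ![]]
  | succ k =>
    rw [extDeriv_apply_vectorField hθ hZ, neg_sub, sub_eq_add_neg, ← Finset.sum_neg_distrib]
    simp only [koszul, LinearMap.add_apply, LinearMap.sum_apply, map_add, map_sum]
    congr 1
    · simp only [apply_ite (fun A : FoliatedForms F W V (k + 1) →ₗ[ℝ] _ => A α),
        apply_ite L, LinearMap.zero_apply, map_zero]
      rw [Fin.sum_ite_castSucc_lt]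
      refine Finset.sum_congr rfl fun i _ => Finset.sum_congr rfl fun j hj => ?_
      rw [Fin.removeNth_removeNth_succ X (Finset.mem_Ici.1 hj), LinearMap.smul_apply, map_smul]
      have h1 : L (evalForm (Fin.cons (Foliation.bracket (X i.castSucc) (X j.succ))
          (j.removeNth (i.castSucc.removeNth X))) α) =
          θ z.1 (Matrix.vecCons (lieBracket ℝ (Z i.castSucc) (Z j.succ) z.1)
            (j.removeNth (i.castSucc.removeNth (Z · z.1)))) := by
        refine (c.frame_evalForm α _ hx).trans (congrArg (θ z.1) ?_)
        refine funext (Fin.cases ?_ fun l => ?_)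
        · exact c.isFoliatedChart.leafCoord_mlieBracket (X i.castSucc).1 (X j.succ).1
            (X i.castSucc).2 (X j.succ).2 hz.1
        · rfl
      refine (congrArg _ h1).trans ?_
      rw [Fin.val_succ, show (i : ℕ) + (j + 1) + 1 = i + j + 2 by omega, pow_add,
        neg_one_sq, mul_one, neg_one_pow_smul_int]
    · refine Finset.sum_congr rfl fun i _ => ?_
      rw [LinearMap.smul_apply, map_smul]
      refine (congrArg _ (hn i)).trans ?_
      rw [pow_succ, mul_neg_one, neg_smul, neg_one_pow_smul_int]

end FlatChart

end Koszul

/-! ### The differential of foliated forms and local exactness -/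

noncomputable section Differential

theorem sliceExtDeriv_neg {P Q : Type} {W : Type*} [NormedAddCommGroup P] [NormedSpace ℝ P]
    [NormedAddCommGroup Q] [NormedSpace ℝ Q] [NormedAddCommGroup W] [NormedSpace ℝ W] {k : ℕ}
    (θ : P × Q → P [⋀^Fin k]→L[ℝ] W) (z : P × Q) :
    sliceExtDeriv (fun z => -θ z) z = -sliceExtDeriv θ z := by
  have h := extDeriv_smul (x := z.1) (-1 : ℝ) (fun x => θ (x, z.2))
  simp only [neg_one_smul] at h
  exact h

theorem sliceExtDeriv_zero {P Q : Type} {W : Type*} [NormedAddCommGroup P] [NormedSpace ℝ P]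
    [NormedAddCommGroup Q] [NormedSpace ℝ Q] [NormedAddCommGroup W] [NormedSpace ℝ W] {k : ℕ}
    (z : P × Q) : sliceExtDeriv (fun _ => (0 : P [⋀^Fin k]→L[ℝ] W)) z = 0 := by
  have h := extDeriv_smul (x := z.1) (0 : ℝ) (fun _ : P => (0 : P [⋀^Fin k]→L[ℝ] W))
  rw [zero_smul, zero_smul] at h
  exact h

variable {E : Type*} [NormedAddCommGroup E] [NormedSpace ℝ E] [FiniteDimensional ℝ E]
  {M : Type*} [TopologicalSpace M] [T2Space M] [SecondCountableTopology M] [ChartedSpace E M]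
  [IsManifold 𝓘(ℝ, E) ∞ M] {p q : ℕ} {F : Foliation E M p q}
  {W : Type*} [NormedAddCommGroup W] [NormedSpace ℝ W] [FiniteDimensional ℝ W]
  {V : M → Type*} [TopologicalSpace (TotalSpace W V)] [∀ x, TopologicalSpace (V x)]
  [FiberBundle W V] [∀ x, AddCommGroup (V x)] [∀ x, Module ℝ (V x)] [VectorBundle ℝ W V]
  [ContMDiffVectorBundle ∞ W V 𝓘(ℝ, E)] {D : FlatConnection F W V} (c : FlatChart D) {k : ℕ}

namespace FlatChart

theorem bijective_tangentMap {x : M} (hx : x ∈ c.dom) : Function.Bijective (c.tangentMap x) := by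
  refine ⟨fun v w h => ?_, c.exists_eq_tangentMap hx⟩
  have h1 : leafField c.chart x v = leafField c.chart x w :=
    (c.coe_tangentMap hx v).symm.trans ((congrArg Subtype.val h).trans (c.coe_tangentMap hx w))
  have h2 := c.isFoliatedChart.mfderiv_leafField (c.dom_subset hx)
  exact congrArg Prod.fst ((h2 v).symm.trans ((congrArg _ h1).trans (h2 w)))

open Classical in
/-- The alternating map on the tangent space of the leaf through `x` with given coordinates in a
flat chart (and `0` if `x` is not in the domain of the frame). -/
def ofModel (a : Euc p [⋀^Fin k]→L[ℝ] W) (x : M) : F.tangent x [⋀^Fin k]→ₗ[ℝ] V x :=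
  if hx : x ∈ c.dom then
    (LinearEquiv.ofBijective _ (c.bijective x hx)).symm.toLinearMap.compAlternatingMap
      (a.toAlternatingMap.compLinearMap
        (LinearEquiv.ofBijective _ (c.bijective_tangentMap hx)).symm.toLinearMap)
  else 0

theorem localForm_eq_of_eq_ofModel {α : ∀ x, F.tangent x [⋀^Fin k]→ₗ[ℝ] V x} {x : M}
    (hx : x ∈ c.dom) {a : Euc p [⋀^Fin k]→L[ℝ] W} (h : α x = c.ofModel a x) :
    c.localForm α (c.chart x) = a := by
  ext v
  rw [c.localForm_chart_apply α hx, h, ofModel, dif_pos hx]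
  refine ((LinearEquiv.ofBijective _ (c.bijective x hx)).apply_symm_apply _).trans ?_
  refine congrArg a (funext fun i => ?_)
  exact (LinearEquiv.ofBijective _ (c.bijective_tangentMap hx)).symm_apply_apply (v i)

theorem localForm_zero : c.localForm (fun x => (0 : F.tangent x [⋀^Fin k]→ₗ[ℝ] V x)) = 0 := by
  ext z v
  exact map_zero (c.frame _)

theorem eq_zero_of_localForm {α : ∀ x, F.tangent x [⋀^Fin k]→ₗ[ℝ] V x} {x : M} (hx : x ∈ c.dom)
    (h : c.localForm α (c.chart x) = 0) : α x = 0 :=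
  c.localForm_injective (β := fun _ => 0) hx (by rw [h, c.localForm_zero]; rfl)

theorem localForm_congr {α β : ∀ x, F.tangent x [⋀^Fin k]→ₗ[ℝ] V x} {z : Euc p × Euc q}
    (h : α (c.chart.symm z) = β (c.chart.symm z)) : c.localForm α z = c.localForm β z := by
  ext v
  rw [localForm_apply, localForm_apply, h]

theorem localForm_eq_zero {α : ∀ x, F.tangent x [⋀^Fin k]→ₗ[ℝ] V x} {z : Euc p × Euc q}
    (h : α (c.chart.symm z) = 0) : c.localForm α z = 0 := by
  rw [c.localForm_congr (β := fun _ => 0) h, c.localForm_zero]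
  rfl

end FlatChart

namespace FlatConnection

variable (D)

include D in
/-- A form at a point is determined by the values at that point of its contractions with global
fields, because every vector tangent to the leaf extends to a global field. -/
theorem form_eq_of_evalForm {α β : FoliatedForms F W V k} {x : M}
    (h : ∀ X, evalForm X α x = evalForm X β x) : α.1 x = β.1 x := by
  obtain ⟨c, hx⟩ := FlatChart.exists_mem_dom D x
  refine c.localForm_injective hx (ContinuousAlternatingMap.ext fun v => ?_)
  obtain ⟨L, hL⟩ := c.exists_fields hx
  have h1 := fun α : FoliatedForms F W V k => c.frame_evalForm α (fun i => L (v i)) hx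
  simp only [fun i => (hL (v i)).self_of_nhds] at h1
  rw [← h1 α, ← h1 β, h]

include D in
/-- A form is determined by its values on fields. -/
theorem evalForm_ext {α β : FoliatedForms F W V k} (h : ∀ X, evalForm X α = evalForm X β) :
    α = β :=
  Subtype.ext (funext fun _ => D.form_eq_of_evalForm fun X => by rw [h])

/-- The differential of a form at a point, computed in a chosen flat chart around it. The sign is
that of the Koszul formula, in which the term of `∇_{X_i}` carries `(-1)^i` with `i` counted from
`1`. -/
def differentialAt (α : FoliatedForms F W V k) (x : M) : F.tangent x [⋀^Fin (k + 1)]→ₗ[ℝ] V x :=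
  (FlatChart.exists_mem_dom D x).choose.ofModel
    (-sliceExtDeriv ((FlatChart.exists_mem_dom D x).choose.localForm α.1)
      ((FlatChart.exists_mem_dom D x).choose.chart x)) x

/-- The local definition of the differential satisfies the Koszul formula; in particular it does not
depend on the flat chart. -/
theorem differentialAt_apply (α : FoliatedForms F W V k) (X : Fin (k + 1) → F.fields) (x : M) :
    D.differentialAt α x (fun i => ⟨(X i).1 x, (X i).2 x⟩) = koszul D X α x := by
  have hx := (FlatChart.exists_mem_dom D x).choose_spec
  have h := (FlatChart.exists_mem_dom D x).choose.localForm_eq_of_eq_ofModel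
    (α := D.differentialAt α) hx rfl
  revert h hx
  generalize (FlatChart.exists_mem_dom D x).choose = c
  intro h hx
  refine (c.bijective x h).1 ?_
  have h1 := c.localForm_chart_apply (D.differentialAt α) h
    fun i => leafCoord c.chart (X i).1 (c.chart x)
  simp only [c.tangentMap_leafCoord h] at h1
  rw [← h1, hx, c.frame_koszul α X h]
  rfl

/-- The differential of foliated forms. -/
def differential : FoliatedForms F W V k →ₗ[ℝ] FoliatedForms F W V (k + 1) where
  toFun α := ⟨D.differentialAt α, fun X => by
    simp only [D.differentialAt_apply α X]
    exact (koszul D X α).contMDiff⟩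
  map_add' α β := D.evalForm_ext fun X => by
    ext x
    refine (D.differentialAt_apply _ X x).trans ?_
    rw [(koszul D X).map_add]
    exact congrArg₂ (· + ·) (D.differentialAt_apply α X x).symm (D.differentialAt_apply β X x).symm
  map_smul' a α := D.evalForm_ext fun X => by
    ext x
    refine (D.differentialAt_apply _ X x).trans ?_
    rw [(koszul D X).map_smul]
    exact congrArg (a • ·) (D.differentialAt_apply α X x).symm

theorem evalForm_differential (α : FoliatedForms F W V k) (X : Fin (k + 1) → F.fields) :
    evalForm X (D.differential α) = koszul D X α := by
  ext x
  exact D.differentialAt_apply α X x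

variable {D}

/-- In every flat chart the differential is minus the exterior derivative along the plaques. -/
theorem _root_.FlatChart.localForm_differential (α : FoliatedForms F W V k) {z : Euc p × Euc q}
    (hz : z ∈ c.target) :
    c.localForm (D.differential α).1 z = -sliceExtDeriv (c.localForm α.1) z := by
  ext v
  obtain ⟨L, hL⟩ := c.exists_fields hz.2
  have hL' := fun i => (hL (v i)).self_of_nhds
  have h1 := c.frame_evalForm (D.differential α) (fun i => L (v i)) hz.2
  have h2 := c.frame_koszul α (fun i => L (v i)) hz.2
  rw [D.evalForm_differential, h2] at h1
  simp only [hL'] at h1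
  rw [c.chart.right_inv hz.1] at h1
  exact h1.symm

theorem differential_differential (α : FoliatedForms F W V k) :
    D.differential (D.differential α) = 0 := by
  refine Subtype.ext (funext fun x => ?_)
  obtain ⟨c, hx⟩ := FlatChart.exists_mem_dom D x
  have hz := c.mem_target hx
  refine c.eq_zero_of_localForm hx ?_
  rw [c.localForm_differential _ hz]
  have h : c.localForm (D.differential α).1 =ᶠ[𝓝 (c.chart x)]
      fun z => -sliceExtDeriv (c.localForm α.1) z := by
    filter_upwards [c.isOpen_target.mem_nhds hz] with z hz
    exact c.localForm_differential α hz
  rw [h.sliceExtDeriv.eq_of_nhds, sliceExtDeriv_neg,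
    sliceExtDeriv_sliceExtDeriv (c.contDiffAt_localForm α hz), neg_zero, neg_zero]

/-- The differential does not increase supports. -/
theorem differential_eq_zero {α : FoliatedForms F W V k} {x : M} (h : ∀ᶠ y in 𝓝 x, α.1 y = 0) :
    (D.differential α).1 x = 0 := by
  obtain ⟨c, hx⟩ := FlatChart.exists_mem_dom D x
  have hz := c.mem_target hx
  refine c.eq_zero_of_localForm hx ?_
  rw [c.localForm_differential _ hz]
  have h : c.localForm α.1 =ᶠ[𝓝 (c.chart x)] fun z => 0 := by
    rw [← c.chart.left_inv (c.dom_subset hx)] at h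
    filter_upwards [c.eventually_symm hz h] with z hz
    exact c.localForm_eq_zero hz
  rw [h.sliceExtDeriv.eq_of_nhds, sliceExtDeriv_zero, neg_zero]

/-- Every smooth family of forms on the model space is, near a given point of a flat chart, the
coordinate expression of a global foliated form. -/
theorem _root_.FlatChart.exists_form (η : Euc p × Euc q → Euc p [⋀^Fin k]→L[ℝ] W)
    (hη : ContDiff ℝ ∞ η) {x : M} (hx : x ∈ c.dom) :
    ∃ β : FoliatedForms F W V k, ∀ᶠ z in 𝓝 (c.chart x), c.localForm β.1 z = η z := by
  obtain ⟨ρ, hρ1, hρ⟩ := exists_cutoff_nhds (E := E) c.isOpen_dom hx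
  let β : ∀ x, F.tangent x [⋀^Fin k]→ₗ[ℝ] V x := fun y => c.ofModel (η (c.chart y)) y
  have hβ : ∀ y ∈ c.dom, c.localForm β (c.chart y) = η (c.chart y) := fun y hy =>
    c.localForm_eq_of_eq_ofModel hy rfl
  have hβ' : ∀ z ∈ c.target, c.localForm β z = η z := fun z hz => by
    have h := hβ _ hz.2
    rwa [c.chart.right_inv hz.1] at h
  have hs : ∀ y ∈ c.dom, ContDiffAt ℝ ∞ (c.localForm β) (c.chart y) := fun y hy =>
    hη.contDiffAt.congr_of_eventuallyEq (by
      filter_upwards [c.isOpen_target.mem_nhds (c.mem_target hy)] with z hz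
      exact hβ' z hz)
  refine ⟨⟨fun y => ρ y • β y, fun X => ?_⟩, ?_⟩
  · exact (cutSection ρ (fun y => β y fun i => ⟨(X i).1 y, (X i).2 y⟩) c.isOpen_dom hρ
      fun y hy => (c.contMDiffAt_of_localForm hy (hs y hy) X).contMDiffWithinAt).contMDiff
  · have hz := c.mem_target hx
    rw [← c.chart.left_inv (c.dom_subset hx)] at hρ1
    filter_upwards [c.eventually_symm hz hρ1, c.isOpen_target.mem_nhds hz] with z hz1 hz
    refine Eq.trans (c.localForm_congr ?_) (hβ' z hz)
    change ρ _ • β _ = _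
    rw [hz1, one_smul]

/-- A form of positive degree that is closed near a point is exact near that point. -/
theorem exists_differential_eq (α : FoliatedForms F W V (k + 1)) (x : M)
    (h : ∀ᶠ y in 𝓝 x, (D.differential α).1 y = 0) :
    ∃ β : FoliatedForms F W V k, ∀ᶠ y in 𝓝 x, (D.differential β).1 y = α.1 y := by
  obtain ⟨c, hx⟩ := FlatChart.exists_mem_dom D x
  have hz := c.mem_target hx
  -- A cutoff function on the model space makes the coordinate expression of `α` globally smooth.
  obtain ⟨χ, hχ1, hχ⟩ := exists_cutoff_nhds (E := Euc p × Euc q) c.isOpen_target hz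
  have hθ : ContDiff ℝ ∞ fun z => χ z • c.localForm α.1 z :=
    contMDiff_iff_contDiff.1 (contMDiff_cutoff_smul χ c.isOpen_target hχ fun z hz =>
      (c.contDiffAt_localForm α hz).contMDiffAt.contMDiffWithinAt)
  have hθα : ∀ᶠ z in 𝓝 (c.chart x), χ z • c.localForm α.1 z = c.localForm α.1 z := by
    filter_upwards [hχ1] with z hz
    rw [hz, one_smul]
  have hcl : ∀ᶠ z in 𝓝 (c.chart x), sliceExtDeriv (fun z => χ z • c.localForm α.1 z) z = 0 := by
    rw [← c.chart.left_inv (c.dom_subset hx)] at h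
    filter_upwards [Filter.EventuallyEq.sliceExtDeriv hθα, c.eventually_symm hz h,
      c.isOpen_target.mem_nhds hz] with z hz1 hz2 hz3
    rw [hz1, ← neg_eq_zero, ← c.localForm_differential α hz3]
    exact c.localForm_eq_zero hz2
  obtain ⟨r, hr, hball⟩ := Metric.eventually_nhds_iff_ball.1 hcl
  obtain ⟨η, hη, hηθ⟩ := exists_sliceExtDeriv_eq hθ (c.chart x) hball
  -- The differential is minus the exterior derivative along the plaques.
  obtain ⟨β, hβ⟩ := c.exists_form (fun z => -η z) hη.neg hx
  refine ⟨β, ?_⟩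
  have hev : ∀ᶠ z in 𝓝 (c.chart x), z ∈ c.target →
      c.localForm (D.differential β).1 z = c.localForm α.1 z := by
    filter_upwards [Filter.EventuallyEq.sliceExtDeriv hβ, hθα, Metric.ball_mem_nhds _ hr]
      with z hz1 hz2 hz3 hz
    rw [c.localForm_differential β hz, hz1, sliceExtDeriv_neg, neg_neg, hηθ z hz3, hz2]
  filter_upwards [(c.chart.continuousAt (c.dom_subset hx)).eventually hev,
    c.isOpen_dom.mem_nhds hx] with y hy1 hy
  exact c.localForm_injective hy (hy1 (c.mem_target hy))

end FlatConnection

end Differential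

/-! ### The resolution by sheaves of foliated forms -/

noncomputable section Resolution

variable {E : Type*} [NormedAddCommGroup E] [NormedSpace ℝ E] [FiniteDimensional ℝ E]
  {M : Type u} [TopologicalSpace M] [T2Space M] [SecondCountableTopology M] [ChartedSpace E M]
  [IsManifold 𝓘(ℝ, E) ∞ M] {p q : ℕ} {F : Foliation E M p q}
  {W : Type*} [NormedAddCommGroup W] [NormedSpace ℝ W] [FiniteDimensional ℝ W]
  {V : M → Type*} [TopologicalSpace (TotalSpace W V)] [∀ x, TopologicalSpace (V x)]
  [FiberBundle W V] [∀ x, AddCommGroup (V x)] [∀ x, Module ℝ (V x)] [VectorBundle ℝ W V]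
  [ContMDiffVectorBundle ∞ W V 𝓘(ℝ, E)] (D : FlatConnection F W V) {k : ℕ}

section Small

instance (x : M) : FiniteDimensional ℝ (F.tangent x) :=
  have : FiniteDimensional ℝ (TangentSpace 𝓘(ℝ, E) x) := inferInstanceAs (FiniteDimensional ℝ E)
  inferInstance

variable [∀ x, Small.{u} (V x)]

/-- An alternating map is determined by its values on a basis, so that its universe level is that of
its target. -/
instance (x : M) : Small.{u} (F.tangent x [⋀^Fin k]→ₗ[ℝ] V x) := by
  let b := Module.finBasis ℝ (F.tangent x)
  refine small_of_injective (β := (Fin k → Fin (Module.finrank ℝ (F.tangent x))) → V x)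
    (f := fun α r => α fun i => b (r i)) fun α β h => ?_
  exact b.ext_alternating fun r _ => congrFun h r

variable (F V) in
/-- The alternating `k`-forms at `x` along the leaves with values in `V`, as a type in the universe
of `M`. -/
abbrev FormFiber (k : ℕ) (x : M) : Type u := Shrink.{u} (F.tangent x [⋀^Fin k]→ₗ[ℝ] V x)

/-- The form `f • α`, where `f` is a smooth function. -/
def FoliatedForms.funSMul (f : C^∞⟮𝓘(ℝ, E), M; ℝ⟯) (α : FoliatedForms F W V k) :
    FoliatedForms F W V k :=
  ⟨fun x => f x • α.1 x, fun X => (_root_.funSMul f (evalForm X α)).contMDiff⟩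

variable (F W V) in
/-- The foliated forms as a space of sections. -/
def formSpace (k : ℕ) :
    SectionSpace (X := TopCat.of M) (FormFiber F V k) (FoliatedForms F W V k) where
  ev x := (Shrink.linearEquiv.{u} ℝ (F.tangent x [⋀^Fin k]→ₗ[ℝ] V x)).symm.toLinearMap ∘ₗ
    LinearMap.proj x ∘ₗ (foliatedForms F W V k).subtype
  ext α h := Subtype.ext (funext fun x =>
    (LinearEquiv.map_eq_zero_iff (Shrink.linearEquiv.{u} ℝ _).symm).1 (h x))
  glue s hs := by
    refine ⟨⟨fun x => Shrink.linearEquiv.{u} ℝ (F.tangent x [⋀^Fin k]→ₗ[ℝ] V x) (s x),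
      fun X x => ?_⟩, fun x => LinearEquiv.symm_apply_apply _ _⟩
    obtain ⟨α, hα⟩ := hs x
    refine (α.2 X x).congr_of_eventuallyEq ?_
    filter_upwards [hα] with y hy
    rw [← hy]
    refine congrArg (TotalSpace.mk' W y) ?_
    refine congrArg (fun a : F.tangent y [⋀^Fin k]→ₗ[ℝ] V y => a fun i => ⟨(X i).1 y, (X i).2 y⟩) ?_
    exact LinearEquiv.apply_symm_apply _ (α.1 y)
  cutoff K U hK hU hKU := by
    obtain ⟨ρ, h1, h⟩ := exists_cutoff (E := E) (M := M) hK hU hKU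
    refine ⟨ρ, h1, fun x hx => notMem_tsupport_iff_eventuallyEq.1 fun hx' => hx (h hx'), fun α =>
      ⟨FoliatedForms.funSMul ρ α, fun x => ?_⟩⟩
    exact (Shrink.linearEquiv.{u} ℝ (F.tangent x [⋀^Fin k]→ₗ[ℝ] V x)).symm.map_smul (ρ x) (α.1 x)

theorem formSpace_ev_eq_zero_iff (α : FoliatedForms F W V k) (x : M) :
    (formSpace F W V k).ev x α = 0 ↔ α.1 x = 0 :=
  LinearEquiv.map_eq_zero_iff (Shrink.linearEquiv.{u} ℝ _).symm

theorem formSpace_ev_eq_iff (α β : FoliatedForms F W V k) (x : M) :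
    (formSpace F W V k).ev x α = (formSpace F W V k).ev x β ↔ α.1 x = β.1 x :=
  (Shrink.linearEquiv.{u} ℝ _).symm.injective.eq_iff

end Small

/-- The form of degree `0` given by a section. -/
def FoliatedForms.ofSection (s : Cₛ^∞⟮𝓘(ℝ, E); W, V⟯) : FoliatedForms F W V 0 :=
  ⟨fun x => AlternatingMap.constOfIsEmpty ℝ (F.tangent x) (Fin 0) (s x), fun _ => s.contMDiff⟩

/-- The closed forms of degree `0` are the constant sections. -/
theorem FlatConnection.differential_eq_zero_iff (α : FoliatedForms F W V 0) (x : M) :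
    (D.differential α).1 x = 0 ↔ ∀ X, D.nabla X (evalForm ![] α) x = 0 := by
  have h : ∀ X : Fin 1 → F.fields,
      evalForm X (D.differential α) x = -D.nabla (X 0) (evalForm ![] α) x := fun X => by
    rw [D.evalForm_differential]
    rfl
  constructor
  · intro h0 X
    rw [← neg_eq_zero]
    refine (h fun _ => X).symm.trans ?_
    change (D.differential α).1 x _ = 0
    rw [h0]
    rfl
  · intro h0
    refine D.form_eq_of_evalForm (β := 0) fun X => ?_
    rw [h X, h0, neg_zero]
    rfl

variable [∀ x, Small.{u} (V x)]

/-- The complex of foliated forms is a resolution of the sheaf of flat sections. -/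
def FlatConnection.localResolution {T' : TopCat.of M → Type u} [∀ x, AddCommGroup (T' x)]
    [∀ x, Module ℝ (T' x)] (P : LinearLocalPredicate T') (e : ∀ x : M, T' x ≃ₗ[ℝ] V x)
    (h : ∀ (U : Opens (TopCat.of M)) (s : ∀ x : U, T' x), P.pred s ↔
      ∀ x : U, ∃ t : Cₛ^∞⟮𝓘(ℝ, E); W, V⟯, (∀ᶠ y : U in 𝓝 x, t y.1 = e y.1 (s y)) ∧
        ∀ᶠ y in 𝓝 x.1, ∀ X, D.nabla X t y = 0) :
    LocalResolution (formSpace F W V) (fun _ => D.differential) P where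
  local_d n α x hx := (formSpace_ev_eq_zero_iff _ _).2 (D.differential_eq_zero
    (hx.mono fun y hy => (formSpace_ev_eq_zero_iff _ _).1 hy))
  d_d n α := D.differential_differential α
  exact n α x hx := by
    obtain ⟨β, hβ⟩ := D.exists_differential_eq α x
      (hx.mono fun y hy => (formSpace_ev_eq_zero_iff _ _).1 hy)
    exact ⟨β, hβ.mono fun y hy => (formSpace_ev_eq_iff _ _ _).2 hy⟩
  j x := (e x).trans ((AlternatingMap.constLinearEquivOfIsEmpty (R' := ℝ) (ι := Fin 0)
    (M'' := F.tangent x)).trans (Shrink.linearEquiv.{u} ℝ _).symm)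
  pred_iff U s := by
    refine (h U s).trans (forall_congr' fun x => ⟨?_, ?_⟩)
    · rintro ⟨t, ht, h⟩
      refine ⟨FoliatedForms.ofSection t, ht.mono fun y hy => ?_, h.mono fun y hy => ?_⟩
      · rw [LinearEquiv.trans_apply, ← hy]
        rfl
      · exact (formSpace_ev_eq_zero_iff _ _).2 ((D.differential_eq_zero_iff _ y).2 hy)
    · rintro ⟨α, hα, h⟩
      refine ⟨evalForm ![] α, hα.mono fun y hy => ?_, h.mono fun y hy => ?_⟩
      · have h1 : α.1 y.1 = AlternatingMap.constOfIsEmpty ℝ (F.tangent y.1) (Fin 0) (e y.1 (s y)) :=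
          (Shrink.linearEquiv.{u} ℝ _).symm.injective hy
        change α.1 y.1 _ = _
        rw [h1]
        rfl
      · exact (D.differential_eq_zero_iff _ y).1 ((formSpace_ev_eq_zero_iff _ _).1 hy)

end Resolution

/-! ### Cohomology of foliated forms -/

section Cohomology

variable {E : Type*} [NormedAddCommGroup E] [NormedSpace ℝ E] [FiniteDimensional ℝ E]
  {M : Type*} [TopologicalSpace M] [T2Space M] [SecondCountableTopology M] [ChartedSpace E M]
  [IsManifold 𝓘(ℝ, E) ∞ M] {p q : ℕ} {F : Foliation E M p q}
  {W : Type*} [NormedAddCommGroup W] [NormedSpace ℝ W] [FiniteDimensional ℝ W]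
  {V : M → Type*} [TopologicalSpace (TotalSpace W V)] [∀ x, TopologicalSpace (V x)]
  [FiberBundle W V] [∀ x, AddCommGroup (V x)] [∀ x, Module ℝ (V x)] [VectorBundle ℝ W V]
  [ContMDiffVectorBundle ∞ W V 𝓘(ℝ, E)] (D : FlatConnection F W V)
  (A : ∀ k, Submodule ℝ (FoliatedForms F W V k)) (k : ℕ)

namespace FlatConnection

/-- The cocycles, which are defined by the vanishing of the Koszul formula, are the kernel of the
differential. -/
theorem cocycles_eq : cocycles D A k = A k ⊓ LinearMap.ker D.differential := by
  refine congrArg (A k ⊓ ·) (Submodule.ext fun α => ?_)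
  simp only [Submodule.mem_iInf, LinearMap.mem_ker]
  constructor
  · intro h
    refine D.evalForm_ext fun X => ?_
    rw [D.evalForm_differential, h, map_zero]
  · intro h X
    rw [← D.evalForm_differential, h, map_zero]

/-- The coboundaries, which are defined by the Koszul formula, are the image of the differential. -/
theorem coboundaries_eq :
    coboundaries D A k =
      LocalResolution.boundaries (Ω := FoliatedForms F W V) (fun _ => D.differential) A k := by
  cases k with
  | zero => rfl
  | succ k =>
    refine Submodule.ext fun α => ⟨?_, ?_⟩
    · rintro ⟨β, hβ, h⟩
      exact ⟨β, hβ, D.evalForm_ext fun X => (D.evalForm_differential β X).trans (h X).symm⟩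
    · rintro ⟨β, hβ, rfl⟩
      exact ⟨β, hβ, D.evalForm_differential β⟩

variable {A k} in
/-- A surjection of the cocycles onto `Y` whose kernel consists of the coboundaries identifies `Y`
with the cohomology. -/
theorem nonempty_cohomologyOf_equiv {Y : Type*} [AddCommGroup Y] [Module ℝ Y]
    (h : ∃ cls : ↥(A k ⊓ LinearMap.ker (D.differential (k := k))) →ₗ[ℝ] Y, Function.Surjective cls ∧
      ∀ y, cls y = 0 ↔
        y.1 ∈ LocalResolution.boundaries (Ω := FoliatedForms F W V) (fun _ => D.differential) A k) :
    Nonempty (cohomologyOf D A k ≃ₗ[ℝ] Y) := by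
  rw [← D.cocycles_eq, ← D.coboundaries_eq] at h
  obtain ⟨cls, hsurj, hker⟩ := h
  have h1 : (coboundaries D A k).submoduleOf (cocycles D A k) = LinearMap.ker cls := by
    ext y
    exact (hker y).symm
  exact ⟨(Submodule.quotEquivOfEq _ _ h1).trans (cls.quotKerEquivOfSurjective hsurj)⟩

end FlatConnection

end Cohomology

/-! ### Functions constant along the leaves -/

section BasicFunctions

variable {E : Type*} [NormedAddCommGroup E] [NormedSpace ℝ E] [FiniteDimensional ℝ E]
  {M : Type*} [TopologicalSpace M] [T2Space M] [SecondCountableTopology M] [ChartedSpace E M]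
  [IsManifold 𝓘(ℝ, E) ∞ M] {p q : ℕ} {F : Foliation E M p q}
  {φ : OpenPartialHomeomorph M (Euc p × Euc q)} (hφ : IsFoliatedChart F.tangent φ) {x : M}
  (hx : x ∈ φ.source) {f : M → ℝ}

/-- The derivative of a function along a slice. -/
theorem hasFDerivAt_slice {P Q : Type*} [NormedAddCommGroup P] [NormedSpace ℝ P]
    [NormedAddCommGroup Q] [NormedSpace ℝ Q] {g : P × Q → ℝ} {z : P × Q}
    (hg : DifferentiableAt ℝ g z) : HasFDerivAt (fun a => g (a, z.2))
      ((fderiv ℝ g z).comp (.inl ℝ P Q)) z.1 :=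
  HasFDerivAt.comp (f := fun a => (a, z.2)) z.1 hg.hasFDerivAt
    (hasFDerivAt_prodMk_left (𝕜 := ℝ) z.1 z.2)

include hφ hx

/-- The derivatives along the leaves of a function that is constant on a plaque vanish. -/
theorem dirDeriv_eq_zero_of_eventually_plaque (hf : ContMDiffAt 𝓘(ℝ, E) 𝓘(ℝ, ℝ) ∞ f x)
    (h : ∀ᶠ y in 𝓝 x, (φ y).2 = (φ x).2 → f y = f x) (X : F.fields) : dirDeriv X.1 f x = 0 := by
  rw [hφ.dirDeriv_eq_fderiv hx (X.2 x) (hf.mdifferentiableAt (by simp))]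
  have hd : DifferentiableAt ℝ (f ∘ φ.symm) (φ x) :=
    (hφ.contDiffAt_comp_symm (φ.map_source hx) (by rwa [φ.left_inv hx])).differentiableAt (by simp)
  have h1 : (fun a => (f ∘ φ.symm) (a, (φ x).2)) =ᶠ[𝓝 (φ x).1] fun _ => f x := by
    rw [← φ.left_inv hx] at h
    have h2 : ∀ᶠ z in 𝓝 (φ x), z.2 = (φ x).2 → f (φ.symm z) = f x := by
      filter_upwards [(φ.symm.continuousAt (φ.map_source hx)).eventually h,
        φ.open_target.mem_nhds (φ.map_source hx)] with z hz hzt hz2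
      have := hz (by rw [φ.right_inv hzt, φ.left_inv hx, hz2])
      rwa [φ.left_inv hx] at this
    have h3 : Filter.Tendsto (fun a => (a, (φ x).2)) (𝓝 (φ x).1) (𝓝 (φ x)) :=
      Continuous.tendsto (by fun_prop) _
    exact (h3.eventually h2).mono fun a ha => ha rfl
  have h2 := (hasFDerivAt_slice hd).unique ((hasFDerivAt_const (f x) _).congr_of_eventuallyEq h1)
  exact congrArg (fun A => A (leafCoord φ X.1 (φ x))) h2

/-- A function whose derivatives along the leaves vanish is constant on small plaques. -/
theorem eventually_plaque_of_dirDeriv_eq_zero (hf : ContMDiff 𝓘(ℝ, E) 𝓘(ℝ, ℝ) ∞ f)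
    (h : ∀ᶠ y in 𝓝 x, ∀ X : F.fields, dirDeriv X.1 f y = 0) :
    ∀ᶠ y in 𝓝 x, (φ y).2 = (φ x).2 → f y = f x := by
  rw [← φ.left_inv hx] at h
  obtain ⟨r, hr, hball⟩ := Metric.eventually_nhds_iff_ball.1
    (((φ.symm.continuousAt (φ.map_source hx)).eventually h).and
      (φ.open_target.mem_nhds (φ.map_source hx)))
  have hmem : ∀ a ∈ Metric.ball (φ x).1 r, (a, (φ x).2) ∈ Metric.ball (φ x) r := fun a ha => by
    rw [Metric.mem_ball, Prod.dist_eq, dist_self]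
    exact max_lt ha hr
  have hd : ∀ a ∈ Metric.ball (φ x).1 r,
      HasFDerivAt (fun a => (f ∘ φ.symm) (a, (φ x).2)) (0 : Euc p →L[ℝ] ℝ) a := by
    intro a ha
    set z : Euc p × Euc q := (a, (φ x).2)
    obtain ⟨h0, hz⟩ := hball z (hmem a ha)
    have hd : DifferentiableAt ℝ (f ∘ φ.symm) z :=
      (hφ.contDiffAt_comp_symm hz (hf _)).differentiableAt (by simp)
    refine (hasFDerivAt_slice hd).congr_fderiv (ContinuousLinearMap.ext fun v => ?_)
    obtain ⟨L, hL⟩ := hφ.exists_fields (φ.map_target hz)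
    have h1 := hφ.dirDeriv_eq_fderiv (φ.map_target hz) ((L v).2 _)
      ((hf (φ.symm z)).mdifferentiableAt (by simp))
    rw [h0 (L v), (hL v).self_of_nhds, φ.right_inv hz] at h1
    exact h1.symm
  have hconst : ∀ a ∈ Metric.ball (φ x).1 r,
      (f ∘ φ.symm) (a, (φ x).2) = (f ∘ φ.symm) ((φ x).1, (φ x).2) := fun a ha =>
    Metric.isOpen_ball.is_const_of_fderiv_eq_zero (convex_ball _ _).isPreconnected
      (fun b hb => (hd b hb).differentiableAt.differentiableWithinAt)
      (fun b hb => (hd b hb).fderiv) ha (Metric.mem_ball_self hr)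
  filter_upwards [(φ.continuousAt hx).eventually (Metric.ball_mem_nhds _ hr),
    φ.open_source.mem_nhds hx] with y hy hys hy2
  have h1 := hconst (φ y).1 (by
    rw [Prod.dist_eq] at hy
    exact (le_max_left _ _).trans_lt hy)
  rw [← hy2] at h1
  simp only [Function.comp_apply, Prod.mk.eta] at h1
  rw [φ.left_inv hys, hy2] at h1
  exact h1.trans (congrArg f (φ.left_inv hx))

end BasicFunctions

/-! ### Comparison with sheaf cohomology -/

section Sheaves

variable {E : Type*} [NormedAddCommGroup E] [NormedSpace ℝ E] [FiniteDimensional ℝ E]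
  {M : Type u} [TopologicalSpace M] [T2Space M] [SecondCountableTopology M] [ChartedSpace E M]
  [IsManifold 𝓘(ℝ, E) ∞ M] {p q : ℕ} {F : Foliation E M p q}

/-- The sections of the sheaf of constant sections are given locally by global sections that are
constant near the point. The definition of the sheaf asks this only at the point, for every point,
which is the same since `∇` is local. -/
theorem constantSections_pred_iff {W : Type*} [NormedAddCommGroup W] [NormedSpace ℝ W]
    {V : M → Type u} [TopologicalSpace (TotalSpace W V)] [∀ x, TopologicalSpace (V x)]
    [FiberBundle W V] [∀ x, AddCommGroup (V x)] [∀ x, Module ℝ (V x)] [VectorBundle ℝ W V]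
    (D : FlatConnection F W V) (U : Opens (TopCat.of M)) (s : ∀ x : U, V x) :
    (constantSections D).pred s ↔ ∀ x : U, ∃ t : Cₛ^∞⟮𝓘(ℝ, E); W, V⟯,
      (∀ᶠ y : U in 𝓝 x, t y.1 = s y) ∧ ∀ᶠ y in 𝓝 x.1, ∀ X, D.nabla X t y = 0 := by
  constructor
  · intro h x
    obtain ⟨t, ht, -⟩ := h x
    refine ⟨t, ht, ?_⟩
    refine (eventually_nhds_coe (X := TopCat.of M) x fun y => ∀ X, D.nabla X t y = 0).1 ?_
    filter_upwards [ht.eventually_nhds] with y hy X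
    obtain ⟨t', ht', h'⟩ := h y
    refine (D.nabla_congr_right X ?_).trans (h' X)
    refine (eventually_nhds_coe (X := TopCat.of M) y fun y => t y = t' y).1 ?_
    filter_upwards [hy, ht'] with z hz hz'
    rw [hz, hz']
  · intro h x
    obtain ⟨t, ht, h'⟩ := h x
    exact ⟨t, ht, h'.self_of_nhds⟩

/-- A smooth function on an open set agrees near each point with a global smooth function. -/
theorem exists_contMDiff_eventuallyEq {U : Opens (TopCat.of M)} {f : U → ℝ}
    (hf : ContMDiff 𝓘(ℝ, E) 𝓘(ℝ, ℝ) ∞ (M := (U : Opens M)) f) (x : U) :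
    ∃ g : C^∞⟮𝓘(ℝ, E), M; ℝ⟯, ∀ᶠ y : U in 𝓝 x, g y.1 = f y := by
  classical
  obtain ⟨ρ, hρ1, hρ⟩ := exists_cutoff_nhds (E := E) (M := M) U.isOpen x.2
  let f' : M → ℝ := fun y => if h : y ∈ U then f ⟨y, h⟩ else 0
  have hf' : ContMDiffOn 𝓘(ℝ, E) 𝓘(ℝ, ℝ) ∞ f' (U : Set M) := by
    intro y hy
    have h1 : ContMDiffAt 𝓘(ℝ, E) 𝓘(ℝ, ℝ) ∞ (fun y : (U : Opens M) => f' y) ⟨y, hy⟩ :=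
      (hf ⟨y, hy⟩).congr_of_eventuallyEq (Filter.Eventually.of_forall fun y => dif_pos y.2)
    exact (contMDiffAt_subtype_iff.1 h1).contMDiffWithinAt
  refine ⟨⟨_, contMDiff_cutoff_smul ρ U.isOpen hρ hf'⟩, ?_⟩
  refine ((eventually_nhds_coe (X := TopCat.of M) x fun y => ρ y = 1).2 hρ1).mono fun y hy => ?_
  change ρ y.1 • f' y.1 = f y
  rw [hy, one_smul]
  exact dif_pos y.2

/-- The functions that are locally constant along the leaves are the constant sections of the
trivial line bundle. -/
theorem basicFunctions_pred_iff (U : Opens (TopCat.of M)) (s : ∀ _ : U, ULift.{u} ℝ) :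
    (basicFunctions F).pred s ↔ ∀ x : U, ∃ t : Cₛ^∞⟮𝓘(ℝ, E); ℝ, Bundle.Trivial M ℝ⟯,
      (∀ᶠ y : U in 𝓝 x, t y.1 = (s y).down) ∧
        ∀ᶠ y in 𝓝 x.1, ∀ X, (trivialConnection F).nabla X t y = 0 := by
  constructor
  · rintro ⟨hs, h⟩ x
    obtain ⟨g, hg⟩ := exists_contMDiff_eventuallyEq hs x
    refine ⟨trivialSectionEquiv.symm g, hg, ?_⟩
    refine (eventually_nhds_coe (X := TopCat.of M) x
      fun y => ∀ X, (trivialConnection F).nabla X (trivialSectionEquiv.symm g) y = 0).1 ?_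
    filter_upwards [hg.eventually_nhds] with y hy X
    obtain ⟨φ, hφy, hφ⟩ := F.exists_chart y.1
    refine dirDeriv_eq_zero_of_eventually_plaque hφ hφy (g.contMDiff _) ?_ X
    refine (eventually_nhds_coe (X := TopCat.of M) y
      fun z => (φ z).2 = (φ y.1).2 → g z = g y.1).1 ?_
    filter_upwards [h y φ hφ hφy, hy] with z hz hz' hz2
    rw [hz', hy.self_of_nhds, hz hz2]
  · intro h
    refine ⟨fun x => ?_, fun x φ hφ hx => ?_⟩
    · obtain ⟨t, ht, -⟩ := h x
      have h1 : ContMDiff 𝓘(ℝ, E) 𝓘(ℝ, ℝ) ∞ fun y : (U : Opens M) => trivialSectionEquiv t y.1 :=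
        (trivialSectionEquiv t).contMDiff.comp contMDiff_subtype_val
      exact (h1 x).congr_of_eventuallyEq (ht.mono fun y hy => hy.symm)
    · obtain ⟨t, ht, h⟩ := h x
      have h1 := eventually_plaque_of_dirDeriv_eq_zero hφ hx (trivialSectionEquiv t).contMDiff h
      have h2 := (eventually_nhds_coe (X := TopCat.of M) x
        fun y => (φ y).2 = (φ x.1).2 → trivialSectionEquiv t y = trivialSectionEquiv t x.1).2 h1
      filter_upwards [h2, ht] with y hy hyt hy2
      exact ULift.down_injective (hyt.symm.trans ((hy hy2).trans ht.self_of_nhds))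

/-- The comparison theorem for a sheaf `P` that is identified, by linear isomorphisms `e` of the
fibres, with the sheaf of constant sections of a foliated bundle `V`. The fibres of `V` may live in
a universe other than that of `M`, provided they are small. -/
theorem nonempty_foliatedCohomology_equiv {W : Type*} [NormedAddCommGroup W] [NormedSpace ℝ W]
    [FiniteDimensional ℝ W] {V : M → Type*} [TopologicalSpace (TotalSpace W V)]
    [∀ x, TopologicalSpace (V x)] [FiberBundle W V] [∀ x, AddCommGroup (V x)]
    [∀ x, Module ℝ (V x)] [VectorBundle ℝ W V] [ContMDiffVectorBundle ∞ W V 𝓘(ℝ, E)]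
    [∀ x, Small.{u} (V x)] (D : FlatConnection F W V) {T' : TopCat.of M → Type u}
    [∀ x, AddCommGroup (T' x)] [∀ x, Module ℝ (T' x)] (P : LinearLocalPredicate T')
    (e : ∀ x : M, T' x ≃ₗ[ℝ] V x)
    (h : ∀ (U : Opens (TopCat.of M)) (s : ∀ x : U, T' x), P.pred s ↔
      ∀ x : U, ∃ t : Cₛ^∞⟮𝓘(ℝ, E); W, V⟯, (∀ᶠ y : U in 𝓝 x, t y.1 = e y.1 (s y)) ∧
        ∀ᶠ y in 𝓝 x.1, ∀ X, D.nabla X t y = 0) (k : ℕ) :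
    Nonempty (foliatedCohomology D k ≃ₗ[ℝ] P.Value (sheafCohomology (TopCat.of M) k)) ∧
    Nonempty (compactFoliatedCohomology D k ≃ₗ[ℝ]
      P.Value (compactSheafCohomology (TopCat.of M) k)) := by
  have : LocallyCompactSpace M := Manifold.locallyCompact_of_finiteDimensional 𝓘(ℝ, E)
  have : LocallyCompactSpace (TopCat.of M) := this
  have : SecondCountableTopology (TopCat.of M) := ‹SecondCountableTopology M›
  have : T2Space (TopCat.of M) := ‹T2Space M›
  let L := D.localResolution P e h
  refine ⟨D.nonempty_cohomologyOf_equiv (L.exists_sheafCohomology_cls k),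
    D.nonempty_cohomologyOf_equiv (L.exists_compactSheafCohomology_cls _ (fun n α => ?_) k)⟩
  exact exists_congr fun K => and_congr_right fun _ => forall₂_congr fun x _ =>
    (formSpace_ev_eq_zero_iff α x).symm

end Sheaves

theorem mainTheorem11 {E : Type*} [NormedAddCommGroup E] [NormedSpace ℝ E] [FiniteDimensional ℝ E]
    {M : Type u} [TopologicalSpace M] [T2Space M] [SecondCountableTopology M]
    [ChartedSpace E M] [IsManifold 𝓘(ℝ, E) ∞ M] {p q : ℕ} (F : Foliation E M p q)
    {W : Type*} [NormedAddCommGroup W] [NormedSpace ℝ W] [FiniteDimensional ℝ W]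
    (V : M → Type u) [TopologicalSpace (TotalSpace W V)] [∀ x, TopologicalSpace (V x)]
    [FiberBundle W V] [∀ x, AddCommGroup (V x)] [∀ x, Module ℝ (V x)] [VectorBundle ℝ W V]
    [ContMDiffVectorBundle ∞ W V 𝓘(ℝ, E)] (D : FlatConnection F W V) (k : ℕ) :
    Nonempty (foliatedCohomology D k ≃ₗ[ℝ]
      (constantSections D).Value (sheafCohomology (TopCat.of M) k)) ∧
    Nonempty (compactFoliatedCohomology D k ≃ₗ[ℝ]
      (constantSections D).Value (compactSheafCohomology (TopCat.of M) k)) ∧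
    Nonempty (foliatedCohomology (trivialConnection F) k ≃ₗ[ℝ]
      (basicFunctions F).Value (sheafCohomology (TopCat.of M) k)) ∧
    Nonempty (compactFoliatedCohomology (trivialConnection F) k ≃ₗ[ℝ]
      (basicFunctions F).Value (compactSheafCohomology (TopCat.of M) k)) := by
  have h1 := nonempty_foliatedCohomology_equiv D (constantSections D)
    (fun x => LinearEquiv.refl ℝ (V x)) (constantSections_pred_iff D) k
  -- The trivial bundle has fibres in the lowest universe, but its sheaf has values in `ULift ℝ`.
  have : ∀ x : M, Small.{u} (Bundle.Trivial M ℝ x) := fun _ => small_zero ℝ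
  have h2 := nonempty_foliatedCohomology_equiv (trivialConnection F) (basicFunctions F)
    (fun x => (ULift.moduleEquiv : ULift.{u} ℝ ≃ₗ[ℝ] ℝ)) basicFunctions_pred_iff k
  exact ⟨h1.1, h1.2, h2.1, h2.2⟩
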